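/- Let $\phi:\mathbb C\to[-\infty,\infty)$ be a subharmonic function ($\phi\not\equiv-\infty$) which is not harmonic and whose distributional Laplacian $\mu=\Delta\phi$ is a doubling measure, i.e. there is a constant $c$ with $\mu(D(z,2r))\le c\,\mu(D(z,r))$ for all $z\in\mathbb C$, $r>0$. For $z\in\mathbb C$ let $\rho(z)>0$ be the radius with $\mu(D(z,\rho(z)))=1$, and let $$d_\phi(z,\zeta)=\inf_\gamma\int_0^1\frac{|\gamma'(t)|}{\rho(\gamma(t))}\,dt,$$ where the infimum is over all piecewise $\mathcal C^1$ curves $\gamma:[0,1]\to\mathbb C$ with $\gamma(0)=z$ and $\gamma(1)=\zeta$. A positive measurable function $\omega$ on $\mathbb C$ is called a flat weight for $\phi$ if there is $A>0$ such that $|\log\omega(z)-\log\omega(\zeta)|\le A\,(1+\log^+d_\phi(z,\zeta))$ for all $z,\zeta\in\mathbb C$. Then $\phi$ is finite at every point, and for every $\varepsilon>0$, every flat weight $\omega$ for $\phi$ and every $m\in\mathbb N$ there exists $C>0$ such that for all $\eta\in\mathbb C$ there is an entire function $P_\eta$ with $P_\eta(\eta)=1$ and $$|P_\eta(z)|\le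 C\,e^{\varepsilon(\phi(z)-\phi(\eta))}\,\frac{\omega(\eta)}{\omega(z)}\,\frac{1}{1+d_\phi(z,\eta)^m}\qquad\text{for all }z\in\mathbb C.$$ -/

import Mathlib

open MeasureTheory Set Metric
open scoped ENNReal NNReal

namespace PeakFunctions

noncomputable section

/-- The mean `(1 / 2π) ∫₀^{2π} φ(c + r e^{iθ}) dθ` of an extended-real function over a circle, as the
mean of the positive part minus the mean of the negative part. For a function that is bounded above
on the circle the first term is finite, so the difference is well defined (possibly `⊥`). -/
def circleMean (φ : ℂ → EReal) (c : ℂ) (r : ℝ) : EReal :=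
  (laverage (volume.restrict (Ioc (0 : ℝ) (2 * Real.pi)))
      (fun θ => (φ (circleMap c r θ)).toENNReal) : EReal) -
    (laverage (volume.restrict (Ioc (0 : ℝ) (2 * Real.pi)))
      (fun θ => (-φ (circleMap c r θ)).toENNReal) : EReal)

/-- Subharmonic functions `φ : ℂ → [-∞, ∞)` on the whole plane: upper semicontinuous,
not identically `-∞`, and satisfying the sub-mean value inequality on all circles. -/
structure IsSubharmonic (φ : ℂ → EReal) : Prop where
  ne_top : ∀ z, φ z ≠ ⊤
  exists_ne_bot : ∃ z, φ z ≠ ⊥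
  upperSemicontinuous : UpperSemicontinuous φ
  le_circleMean : ∀ (c : ℂ) (r : ℝ), 0 < r → φ c ≤ circleMean φ c r

/-- `μ` is the distributional Laplacian `Δφ = (∂²/∂x² + ∂²/∂y²) φ` of `φ`: the function `φ` is
locally integrable, `μ` is a nonnegative Borel measure, finite on compact sets, and
`∫ φ Δψ dm = ∫ ψ dμ` for all real test functions `ψ`. -/
structure IsLaplacian (φ : ℂ → EReal) (μ : Measure ℂ) : Prop where
  aemeasurable : AEMeasurable φ
  lintegral_abs_lt_top : ∀ K : Set ℂ, IsCompact K → ∫⁻ z in K, (φ z).abs < ⊤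
  measure_lt_top : ∀ K : Set ℂ, IsCompact K → μ K < ⊤
  integral_mul_laplacian : ∀ ψ : ℂ → ℝ, ContDiff ℝ (⊤ : ℕ∞) ψ → HasCompactSupport ψ →
    ∫ z, (φ z).toReal * Laplacian.laplacian ψ z = ∫ z, ψ z ∂μ

/-- Doubling measures: `μ(D(z, 2r)) ≤ C μ(D(z, r))` for all disks. -/
def IsDoubling (μ : Measure ℂ) : Prop :=
  ∃ C : ℝ≥0, ∀ (z : ℂ) (r : ℝ), 0 < r → μ (ball z (2 * r)) ≤ C * μ (ball z r)

/-- `ρ(z)`: the positive radius `r` with `μ(D(z, r)) = 1`. It exists and is unique when `μ` is a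
nonzero doubling measure that is finite on compact sets, so that the infimum below is over
a one-point set. -/
def rho (μ : Measure ℂ) (z : ℂ) : ℝ :=
  sInf {r : ℝ | 0 < r ∧ μ (ball z r) = 1}

/-- Piecewise `C¹` curves `γ : [0, 1] → ℂ`. -/
def IsPiecewiseC1 (γ : ℝ → ℂ) : Prop :=
  ContinuousOn γ (Icc 0 1) ∧
    ∃ (n : ℕ) (t : ℕ → ℝ), Monotone t ∧ t 0 = 0 ∧ t n = 1 ∧
      ∀ i < n, ContDiffOn ℝ 1 γ (Icc (t i) (t (i + 1)))

/-- The length `∫₀¹ |γ'(t)| ρ(γ(t))⁻¹ dt` of a curve in the metric `ρ⁻² dz ⊗ dz̄`. -/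
def rhoLength (μ : Measure ℂ) (γ : ℝ → ℂ) : ℝ :=
  ∫ t in (0 : ℝ)..1, ‖deriv γ t‖ / rho μ (γ t)

/-- The distance `d_φ`, for `μ = Δφ`: the infimum of the lengths of the piecewise `C¹` curves that
join the two points. -/
def rhoDist (μ : Measure ℂ) (z ζ : ℂ) : ℝ :=
  sInf {L : ℝ | ∃ γ : ℝ → ℂ, IsPiecewiseC1 γ ∧ γ 0 = z ∧ γ 1 = ζ ∧ L = rhoLength μ γ}

/-- Flat weights: positive (Lebesgue) measurable functions `ω` on `ℂ` with
`|log ω(z) - log ω(ζ)| ≤ C (1 + log⁺ d_φ(z, ζ))`. -/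
structure IsFlatWeight (μ : Measure ℂ) (ω : ℂ → ℝ) : Prop where
  aemeasurable : AEMeasurable ω
  pos : ∀ z, 0 < ω z
  abs_log_sub_log_le : ∃ C : ℝ, 0 < C ∧ ∀ z ζ : ℂ,
    |Real.log (ω z) - Real.log (ω ζ)| ≤ C * (1 + Real.posLog (rhoDist μ z ζ))

end

end PeakFunctions

/-!
The peak functions are built by hand, without `∂̄`-estimates, as limits of explicit products.

After translating `η` to the origin and rescaling by `ρ(η)`, let `κ` be `ε / 2π` times the Laplacian
of `φ`. On a disk of radius `2 ^ n` the function `ε φ` is the sum of the real part of an analytic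
function and of the logarithmic potential of the part of `κ` in a slightly larger disk
(`IsSubharmonic.exists_analytic`). The analytic part is removed by an exponential factor. What
remains is to find entire functions `F` with `F 0 = 1` whose modulus is at most the exponential of
`pot κ n z = ∫ log |1 - z / w| dκ(w)`, with a gain of an arbitrary power of `1 + |z|`, uniformly in
`n` and in all `κ` with a given doubling constant and given mass of the unit disk
(`exists_entire_le_exp_pot`).

The function `F` is a product over dyadic annuli `2 ^ k ≤ |w| < 2 ^ (k + 1)`. For a single annulus
(`exists_scale_approx`), let `V` be the mass of the disk of radius `2`. A small proportion of the
measure is removed near the vertices of a regular `N`-gon (`gainMeasure`). This lowers the potential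
at large `z` by a fixed multiple `θ V` of the mass. By the cancellation in sums over the `N`-th roots
of unity, it raises the potential near the annulus only by a small fraction of `θ V`, and it is
invisible near `0` to order `N`. The rest of the measure is divided into small cells, whose masses
are rounded down to integers, and `F` is the polynomial with these zeros (`CellPartition.poly`),
corrected by a power of a truncated exponential (`truncExp`) that restores the first moments
`∫ w ^ (-j) dκ(w)`. So the error is of order `|z| ^ (p + 1)` near `0`, where `p` is chosen after the
doubling constant, and the errors of all the annuli outside the circle `|w| = |z|` add up to a
fraction of the gain of the annulus next to it. Since masses grow exponentially in `k`, the gain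
exceeds any power of `1 + |z|`.

The representation of `φ` comes from testing the definition of the distributional Laplacian with
convolutions of a cut-off logarithm, which gives an identity almost everywhere. It holds everywhere
because logarithmic potentials of doubling measures are continuous, `φ` is upper semicontinuous, and
`φ` is bounded by its means over almost every circle (`IsSubharmonic.eq_of_ae_eq`).

Finally `n` tends to infinity by a normal families argument (`exists_entire_tendsto`). The factor
`(1 + |z - η| / ρ(η)) ^ M` absorbs both the flat weight and the powers of `d_φ`, because `d_φ(z, η)`
is at most polynomial in `|z - η| / ρ(η)` (`IsDoublingWith.exists_rhoDist_le`).
-/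

namespace PeakFunctions

/-- `κ` is a doubling measure with constant `c`: balls have finite and positive mass, and doubling
the radius multiplies the mass by at most `c`. -/
structure IsDoublingWith (c : ℝ) (κ : Measure ℂ) : Prop where
  lt_top : ∀ z r, κ (ball z r) < ⊤
  pos : ∀ z r, 0 < r → 0 < κ.real (ball z r)
  le : ∀ z r, 0 < r → κ.real (ball z (2 * r)) ≤ c * κ.real (ball z r)

/-- The ratio in the reverse doubling inequality. -/
noncomputable def revRatio (c : ℝ) : ℝ := 1 - 1 / c ^ 3

namespace IsDoublingWith

variable {c : ℝ} {κ : Measure ℂ}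

theorem real_mono (h : IsDoublingWith c κ) {z z' : ℂ} {r r' : ℝ} (hs : ball z r ⊆ ball z' r') :
    κ.real (ball z r) ≤ κ.real (ball z' r') :=
  measureReal_mono hs (h.lt_top _ _).ne

theorem one_le (h : IsDoublingWith c κ) : 1 ≤ c := by
  have h1 := h.le 0 1 one_pos
  have h2 := h.pos 0 1 one_pos
  have h3 : κ.real (ball 0 1) ≤ κ.real (ball 0 (2 * 1)) := h.real_mono (ball_subset_ball (by norm_num))
  by_contra! hc
  nlinarith

theorem two_pow_le (h : IsDoublingWith c κ) (n : ℕ) (z : ℂ) {r : ℝ} (hr : 0 < r) :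
    κ.real (ball z (2 ^ n * r)) ≤ c ^ n * κ.real (ball z r) := by
  induction n with
  | zero => simp
  | succ n ih =>
    have h1 := h.le z (2 ^ n * r) (by positivity)
    have hc := h.one_le
    calc κ.real (ball z (2 ^ (n + 1) * r)) = κ.real (ball z (2 * (2 ^ n * r))) := by ring_nf
      _ ≤ c * (c ^ n * κ.real (ball z r)) := h1.trans (by gcongr)
      _ = _ := by ring

/-- Comparison of the masses of two balls, the radius of the larger one being controlled. -/
theorem le_of_subset (h : IsDoublingWith c κ) (n : ℕ) {z z' : ℂ} {r r' : ℝ} (hr : 0 < r)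
    (hs : dist z' z + r' ≤ 2 ^ n * r) :
    κ.real (ball z' r') ≤ c ^ n * κ.real (ball z r) :=
  (h.real_mono (ball_subset_ball' (by linarith))).trans (h.two_pow_le n z hr)

theorem revRatio_lt_one (h : IsDoublingWith c κ) : revRatio c < 1 := by
  have := h.one_le
  have : 0 < 1 / c ^ 3 := by positivity
  unfold revRatio; linarith

theorem revRatio_nonneg (h : IsDoublingWith c κ) : 0 ≤ revRatio c := by
  have := h.one_le
  have : 1 / c ^ 3 ≤ 1 := by rw [div_le_one (by positivity)]; exact one_le_pow₀ this
  unfold revRatio; linarith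

/-- Reverse doubling: the annulus `ball z (2 * r) \ ball z r` contains a ball of radius `r / 2`,
which carries a fixed proportion of the mass. -/
theorem real_ball_le (h : IsDoublingWith c κ) (z : ℂ) {r : ℝ} (hr : 0 < r) :
    κ.real (ball z r) ≤ revRatio c * κ.real (ball z (2 * r)) := by
  have hc := h.one_le
  set p : ℂ := z + ((3 / 2 * r : ℝ) : ℂ) with hp
  have hd : dist p z = 3 / 2 * r := by
    rw [hp, dist_eq_norm, add_sub_cancel_left, Complex.norm_real, Real.norm_of_nonneg (by positivity)]
  have h1 : κ.real (ball z (2 * r)) ≤ c ^ 3 * κ.real (ball p (r / 2)) :=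
    h.le_of_subset 3 (by positivity) (by rw [dist_comm, hd]; linarith)
  have hdisj : Disjoint (ball z r) (ball p (r / 2)) :=
    ball_disjoint_ball (by rw [dist_comm, hd]; linarith)
  have h2 : κ.real (ball z r) + κ.real (ball p (r / 2)) ≤ κ.real (ball z (2 * r)) := by
    rw [← measureReal_union hdisj measurableSet_ball (h.lt_top _ _).ne (h.lt_top _ _).ne]
    refine measureReal_mono (union_subset (ball_subset_ball (by linarith))
      (ball_subset_ball' (by rw [hd]; linarith))) (h.lt_top _ _).ne
  have h3 : κ.real (ball z (2 * r)) / c ^ 3 ≤ κ.real (ball p (r / 2)) := by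
    rw [div_le_iff₀ (by positivity)]; linarith
  have : revRatio c * κ.real (ball z (2 * r))
      = κ.real (ball z (2 * r)) - κ.real (ball z (2 * r)) / c ^ 3 := by unfold revRatio; ring
  linarith

theorem real_ball_div_le (h : IsDoublingWith c κ) (n : ℕ) (z : ℂ) {r : ℝ} (hr : 0 < r) :
    κ.real (ball z (r / 2 ^ n)) ≤ revRatio c ^ n * κ.real (ball z r) := by
  induction n with
  | zero => simp
  | succ n ih =>
    have h1 := h.real_ball_le z (r := r / 2 ^ (n + 1)) (by positivity)
    have h2 := h.revRatio_nonneg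
    calc _ ≤ _ := h1
      _ = revRatio c * κ.real (ball z (r / 2 ^ n)) := by congr 3; rw [pow_succ]; field_simp
      _ ≤ revRatio c * (revRatio c ^ n * κ.real (ball z r)) := by gcongr
      _ = _ := by ring

/-- For a doubling measure the logarithmic singularity is integrable, with a scale invariant
bound: `log (r / ‖w - z‖)` is at most the number of balls `ball z (r / 2 ^ j)` containing `w`, and
the masses of these balls decrease geometrically. -/
theorem lintegral_log_le (h : IsDoublingWith c κ) (z : ℂ) {r : ℝ} (hr : 0 < r) :
    ∫⁻ w in ball z r, ENNReal.ofReal (Real.log (r / ‖w - z‖)) ∂κ ≤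
      ENNReal.ofReal (c ^ 3 * κ.real (ball z r)) := by
  have hc := h.one_le
  have hq0 := h.revRatio_nonneg
  have hq1 := h.revRatio_lt_one
  have hpt : ∀ w ∈ ball z r, ENNReal.ofReal (Real.log (r / ‖w - z‖)) ≤
      ∑' j : ℕ, (ball z (r / 2 ^ j)).indicator (fun _ => (1 : ℝ≥0∞)) w := by
    intro w hw
    rcases eq_or_ne w z with rfl | hne
    · simp
    have hn : 0 < ‖w - z‖ := norm_pos_iff.2 (sub_ne_zero.2 hne)
    rw [mem_ball, dist_eq_norm] at hw
    obtain ⟨n, hn1, hn2⟩ := exists_nat_pow_near (x := r / ‖w - z‖) (y := 2)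
      ((one_le_div hn).2 hw.le) one_lt_two
    have hlog : ∀ m : ℕ, r / ‖w - z‖ ≤ 2 ^ m → Real.log (r / ‖w - z‖) ≤ m := by
      intro m hm
      calc Real.log (r / ‖w - z‖) ≤ Real.log (2 ^ m) := Real.log_le_log (by positivity) hm
        _ = m * Real.log 2 := by rw [Real.log_pow]
        _ ≤ m * 1 := by gcongr; linarith [Real.log_two_lt_d9]
        _ = _ := by ring
    obtain ⟨m, hm1, hm2⟩ : ∃ m : ℕ, Real.log (r / ‖w - z‖) ≤ m ∧
        ∀ j < m, (2 : ℝ) ^ j < r / ‖w - z‖ := by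
      rcases hn1.lt_or_eq with hlt | heq
      · exact ⟨n + 1, hlog _ hn2.le, fun j hj =>
          (pow_le_pow_right₀ one_le_two (by omega)).trans_lt hlt⟩
      · exact ⟨n, hlog _ heq.ge, fun j hj => (pow_lt_pow_right₀ one_lt_two hj).trans_le heq.le⟩
    calc ENNReal.ofReal (Real.log (r / ‖w - z‖)) ≤ ENNReal.ofReal (m : ℕ) :=
          ENNReal.ofReal_le_ofReal hm1
      _ = (m : ℝ≥0∞) := by rw [ENNReal.ofReal_natCast]
      _ = ∑ j ∈ Finset.range m, (ball z (r / 2 ^ j)).indicator (fun _ => (1 : ℝ≥0∞)) w := by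
          rw [Finset.sum_congr rfl (g := fun _ => (1 : ℝ≥0∞))]
          · simp
          · intro j hj
            rw [indicator_of_mem]
            have := hm2 j (Finset.mem_range.1 hj)
            rw [lt_div_iff₀ hn] at this
            rw [mem_ball, dist_eq_norm, lt_div_iff₀ (by positivity)]
            linarith
      _ ≤ _ := ENNReal.sum_le_tsum _
  calc ∫⁻ w in ball z r, ENNReal.ofReal (Real.log (r / ‖w - z‖)) ∂κ
      ≤ ∫⁻ w in ball z r, ∑' j : ℕ, (ball z (r / 2 ^ j)).indicator (fun _ => (1 : ℝ≥0∞)) w ∂κ :=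
        setLIntegral_mono' measurableSet_ball hpt
    _ = ∑' j : ℕ, ∫⁻ w in ball z r, (ball z (r / 2 ^ j)).indicator (fun _ => (1 : ℝ≥0∞)) w ∂κ :=
        lintegral_tsum fun j => (measurable_const.indicator measurableSet_ball).aemeasurable
    _ ≤ ∑' j : ℕ, ENNReal.ofReal (revRatio c ^ j * κ.real (ball z r)) := by
        refine ENNReal.tsum_le_tsum fun j => ?_
        calc _ ≤ ∫⁻ w, (ball z (r / 2 ^ j)).indicator (fun _ => (1 : ℝ≥0∞)) w ∂κ :=
              setLIntegral_le_lintegral _ _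
          _ = κ (ball z (r / 2 ^ j)) := lintegral_indicator_one measurableSet_ball
          _ = ENNReal.ofReal (κ.real (ball z (r / 2 ^ j))) :=
              (ofReal_measureReal (h.lt_top _ _).ne).symm
          _ ≤ _ := ENNReal.ofReal_le_ofReal (h.real_ball_div_le j z hr)
    _ = ENNReal.ofReal (∑' j : ℕ, revRatio c ^ j * κ.real (ball z r)) :=
        (ENNReal.ofReal_tsum_of_nonneg (fun j => by positivity)
          ((summable_geometric_of_lt_one hq0 hq1).mul_right _)).symm
    _ = _ := by
        rw [tsum_mul_right, tsum_geometric_of_lt_one hq0 hq1]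
        congr 2
        unfold revRatio; field_simp; ring

theorem log_div_nonneg {z w : ℂ} {r : ℝ} (hw : w ∈ ball z r) : 0 ≤ Real.log (r / ‖w - z‖) := by
  rcases eq_or_ne w z with rfl | hne
  · simp
  · rw [mem_ball, dist_eq_norm] at hw
    exact Real.log_nonneg ((one_le_div (norm_pos_iff.2 (sub_ne_zero.2 hne))).2 hw.le)

theorem measurable_log_div (r : ℝ) (z : ℂ) : Measurable fun w : ℂ => Real.log (r / ‖w - z‖) := by
  fun_prop

theorem integrableOn_log_div (h : IsDoublingWith c κ) (z : ℂ) {r : ℝ} (hr : 0 < r) :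
    IntegrableOn (fun w => Real.log (r / ‖w - z‖)) (ball z r) κ := by
  refine ⟨(measurable_log_div r z).aestronglyMeasurable, ?_⟩
  rw [hasFiniteIntegral_iff_ofReal]
  · exact (h.lintegral_log_le z hr).trans_lt ENNReal.ofReal_lt_top
  · filter_upwards [ae_restrict_mem measurableSet_ball] with w hw using log_div_nonneg hw

theorem integral_log_div_le (h : IsDoublingWith c κ) (z : ℂ) {r : ℝ} (hr : 0 < r) :
    ∫ w in ball z r, Real.log (r / ‖w - z‖) ∂κ ≤ c ^ 3 * κ.real (ball z r) := by
  have hc := h.one_le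
  rw [integral_eq_lintegral_of_nonneg_ae]
  · exact ENNReal.toReal_le_of_le_ofReal (by positivity) (h.lintegral_log_le z hr)
  · filter_upwards [ae_restrict_mem measurableSet_ball] with w hw using log_div_nonneg hw
  · exact (measurable_log_div r z).aestronglyMeasurable

theorem measure_singleton (h : IsDoublingWith c κ) (z : ℂ) : κ {z} = 0 := by
  have hq0 := h.revRatio_nonneg
  have hq1 := h.revRatio_lt_one
  have hfin : κ {z} < ⊤ := (measure_mono (singleton_subset_iff.2 (mem_ball_self one_pos))).trans_lt
    (h.lt_top z 1)
  have : κ.real {z} ≤ 0 := by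
    have hlim : Filter.Tendsto (fun n : ℕ => revRatio c ^ n * κ.real (ball z 1)) Filter.atTop
        (nhds 0) := by
      simpa using (tendsto_pow_atTop_nhds_zero_of_lt_one hq0 hq1).mul_const (κ.real (ball z 1))
    refine ge_of_tendsto' hlim fun n => ?_
    refine le_trans ?_ (h.real_ball_div_le n z one_pos)
    exact measureReal_mono (singleton_subset_iff.2 (mem_ball_self (by positivity)))
      (h.lt_top _ _).ne
  rw [← ofReal_measureReal hfin.ne, le_antisymm this measureReal_nonneg, ENNReal.ofReal_zero]

/-- The logarithmic kernel is integrable on bounded sets. -/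
theorem integrableOn_log_norm_sub (h : IsDoublingWith c κ) (z p : ℂ) (R : ℝ) :
    IntegrableOn (fun w => Real.log ‖w - z‖) (ball p R) κ := by
  have hm : Measurable fun w : ℂ => Real.log ‖w - z‖ := by fun_prop
  have h1 : IntegrableOn (fun w => Real.log ‖w - z‖) (ball z 1) κ := by
    have := (h.integrableOn_log_div z one_pos).neg
    refine this.congr (Filter.Eventually.of_forall fun w => ?_)
    simp [Real.log_inv]
  have h2 : IntegrableOn (fun w => Real.log ‖w - z‖) (ball p R \ ball z 1) κ := by
    refine Measure.integrableOn_of_bounded (M := R + dist p z)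
      ((measure_mono sdiff_subset).trans_lt (h.lt_top p R)).ne hm.aestronglyMeasurable ?_
    filter_upwards [ae_restrict_mem (measurableSet_ball.diff measurableSet_ball)] with w hw
    have hw1 : 1 ≤ ‖w - z‖ := by
      have := hw.2; rw [mem_ball, dist_eq_norm] at this; linarith
    have hw2 : dist w p < R := hw.1
    rw [Real.norm_of_nonneg (Real.log_nonneg hw1)]
    have := Real.log_le_sub_one_of_pos (x := ‖w - z‖) (by linarith)
    have h3 := dist_triangle w p z
    rw [dist_eq_norm w z] at h3
    linarith
  refine (h1.union h2).mono_set fun w hw => ?_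
  by_cases hz : w ∈ ball z 1
  · exact Or.inl hz
  · exact Or.inr ⟨hw, hz⟩

end IsDoublingWith

/-! ### The remainder of the logarithmic series -/

/-- The Taylor polynomial `∑_{1 ≤ j ≤ p} x ^ j / j` of `-log (1 - x)`. -/
noncomputable def logPoly (p : ℕ) (x : ℂ) : ℂ := ∑ j ∈ Finset.range p, x ^ (j + 1) / (j + 1)

/-- The remainder `log ‖1 - x‖ + Re ∑_{1 ≤ j ≤ p} x ^ j / j`. -/
noncomputable def logRem (p : ℕ) (x : ℂ) : ℝ := Real.log ‖1 - x‖ + (logPoly p x).re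

theorem hasDerivAt_logPoly (p : ℕ) (x : ℂ) :
    HasDerivAt (logPoly p) (∑ j ∈ Finset.range p, x ^ j) x := by
  unfold logPoly
  refine HasDerivAt.fun_sum fun j _ => ?_
  have := (hasDerivAt_pow (j + 1) x).div_const ((j : ℂ) + 1)
  have h0 : (j : ℂ) + 1 ≠ 0 := Nat.cast_add_one_ne_zero j
  rwa [Nat.cast_add_one, Nat.add_sub_cancel, mul_div_cancel_left₀ _ h0] at this

/-- The remainder is the real part of a primitive of `-x ^ p / (1 - x)`. -/
theorem abs_logRem_sub_le (p : ℕ) {x y : ℂ} {m : ℝ} (hm : m ≤ 1 / 2) (hx : ‖x‖ ≤ m)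
    (hy : ‖y‖ ≤ m) : |logRem p x - logRem p y| ≤ 2 * m ^ p * ‖x - y‖ := by
  have key : ∀ z ∈ closedBall (0 : ℂ) m, HasDerivAt (fun z => Complex.log (1 - z) + logPoly p z)
      (-(z ^ p / (1 - z))) z ∧ ‖-(z ^ p / (1 - z))‖ ≤ 2 * m ^ p := by
    intro z hz
    have hz1 : ‖z‖ ≤ m := by simpa using hz
    have hz2 : 1 / 2 ≤ ‖1 - z‖ := by
      have := norm_sub_norm_le (1 : ℂ) z
      rw [norm_one] at this; linarith
    have hne : 1 - z ≠ 0 := norm_pos_iff.1 (by linarith)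
    have hne' : z - 1 ≠ 0 := by rw [← neg_sub]; exact neg_ne_zero.2 hne
    have hsl : 1 - z ∈ Complex.slitPlane := by
      refine Or.inl ?_
      have := Complex.re_le_norm z
      simp; linarith
    constructor
    · have h1 := ((hasDerivAt_id z).const_sub 1).clog hsl
      have hg := geom_sum_eq (x := z) (by intro h; exact hne (by rw [h]; ring)) p
      have h2 := h1.add (hasDerivAt_logPoly p z)
      have h3 : -(z ^ p / (1 - z)) = -1 / (1 - id z) + ∑ j ∈ Finset.range p, z ^ j := by
        rw [hg]
        simp only [id]
        field_simp
        ring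
      rw [h3]
      exact h2
    · rw [norm_neg, norm_div, norm_pow]
      rw [div_le_iff₀ (by linarith)]
      have : ‖z‖ ^ p ≤ m ^ p := pow_le_pow_left₀ (norm_nonneg _) hz1 p
      have h0 : 0 ≤ m ^ p := (pow_nonneg (norm_nonneg z) p).trans this
      nlinarith
  have h := (convex_closedBall (0 : ℂ) m).norm_image_sub_le_of_norm_hasDerivWithin_le
    (fun z hz => (key z hz).1.hasDerivWithinAt) (fun z hz => (key z hz).2)
    (x := y) (y := x) (by simpa using hy) (by simpa using hx)
  refine le_trans ?_ h
  have : logRem p x - logRem p y = ((fun z => Complex.log (1 - z) + logPoly p z) x -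
      (fun z => Complex.log (1 - z) + logPoly p z) y).re := by
    simp [logRem, Complex.log_re]
  rw [this]
  exact Complex.abs_re_le_norm _

theorem logRem_zero (p : ℕ) : logRem p 0 = 0 := by simp [logRem, logPoly]

theorem abs_logRem_le (p : ℕ) {x : ℂ} (hx : ‖x‖ ≤ 1 / 2) : |logRem p x| ≤ 2 * ‖x‖ ^ (p + 1) := by
  have := abs_logRem_sub_le p hx le_rfl (y := 0) (by simp)
  rw [logRem_zero, sub_zero, sub_zero] at this
  rw [pow_succ, ← mul_assoc]; exact this

/-! ### Roots of unity -/

open Polynomial in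
theorem prod_sub_nthRootsFinset {N : ℕ} (hN : 0 < N) (x : ℂ) :
    ∏ ζ ∈ nthRootsFinset N (1 : ℂ), (x - ζ) = x ^ N - 1 := by
  have := (Complex.isPrimitiveRoot_exp N hN.ne').pow_sub_pow_eq_prod_sub_mul x 1 hN
  simpa using this.symm

open Polynomial in
theorem card_nthRootsFinset_one {N : ℕ} (hN : 0 < N) : (nthRootsFinset N (1 : ℂ)).card = N :=
  (Complex.isPrimitiveRoot_exp N hN.ne').card_nthRootsFinset

open Polynomial in
theorem norm_eq_one_of_mem {N : ℕ} (hN : 0 < N) {ζ : ℂ} (h : ζ ∈ nthRootsFinset N (1 : ℂ)) :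
    ‖ζ‖ = 1 :=
  Complex.norm_eq_one_of_pow_eq_one ((mem_nthRootsFinset hN 1).1 h) hN.ne'

open Polynomial in
/-- Nontrivial power sums of roots of unity vanish. -/
theorem sum_inv_pow_nthRootsFinset {N : ℕ} (hN : 0 < N) {j : ℕ} (hj0 : 0 < j) (hj : j < N) :
    ∑ ζ ∈ nthRootsFinset N (1 : ℂ), (ζ⁻¹) ^ j = 0 := by
  have hprim := Complex.isPrimitiveRoot_exp N hN.ne'
  set ω := Complex.exp (2 * Real.pi * Complex.I / N) with hω
  have hω0 : ω ≠ 0 := Complex.exp_ne_zero _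
  have hωN : ω ^ N = 1 := hprim.pow_eq_one
  have h : ∑ ζ ∈ nthRootsFinset N (1 : ℂ), (ζ⁻¹) ^ j =
      ∑ ζ ∈ nthRootsFinset N (1 : ℂ), (ω⁻¹) ^ j * (ζ⁻¹) ^ j := by
    refine Finset.sum_bij' (fun ζ _ => ω⁻¹ * ζ) (fun ζ _ => ω * ζ) ?_ ?_ ?_ ?_ ?_
    · intro ζ hζ
      rw [mem_nthRootsFinset hN] at hζ ⊢
      rw [mul_pow, hζ, inv_pow, hωN]; simp
    · intro ζ hζ
      rw [mem_nthRootsFinset hN] at hζ ⊢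
      rw [mul_pow, hζ, hωN]; simp
    · intro ζ _; field_simp
    · intro ζ _; field_simp
    · intro ζ _
      rw [← mul_pow, mul_inv, inv_inv, ← mul_assoc, inv_mul_cancel₀ hω0, one_mul]
  rw [← Finset.mul_sum] at h
  have h1 : (ω⁻¹) ^ j ≠ 1 := by
    rw [inv_pow, Ne, inv_eq_one]
    exact hprim.pow_ne_one_of_pos_of_lt hj0.ne' hj
  have h2 : (1 - (ω⁻¹) ^ j) * ∑ ζ ∈ nthRootsFinset N (1 : ℂ), (ζ⁻¹) ^ j = 0 := by
    rw [sub_mul, one_mul, ← h, sub_self]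
  exact (mul_eq_zero.1 h2).resolve_left (sub_ne_zero.2 (Ne.symm h1))

/-- A root of unity `ξ ≠ 1` of order `N` has distance at least `1 / N` from `1`, because
`N = ∑ (1 - ξ ^ j)` and `‖1 - ξ ^ j‖ ≤ j ‖1 - ξ‖`. -/
theorem inv_le_norm_one_sub {N : ℕ} (hN : 0 < N) {ξ : ℂ} (h : ξ ^ N = 1) (h1 : ξ ≠ 1) :
    1 / (N : ℝ) ≤ ‖1 - ξ‖ := by
  have hn : ‖ξ‖ = 1 := Complex.norm_eq_one_of_pow_eq_one h hN.ne'
  have hs : ∑ j ∈ Finset.range N, ξ ^ j = 0 := by rw [geom_sum_eq h1, h]; simp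
  have hb : ∀ j : ℕ, ‖1 - ξ ^ j‖ ≤ j * ‖1 - ξ‖ := by
    intro j
    induction j with
    | zero => simp
    | succ j ih =>
      calc ‖1 - ξ ^ (j + 1)‖ = ‖(1 - ξ ^ j) + ξ ^ j * (1 - ξ)‖ := by ring_nf
        _ ≤ ‖1 - ξ ^ j‖ + ‖ξ ^ j * (1 - ξ)‖ := norm_add_le _ _
        _ ≤ j * ‖1 - ξ‖ + 1 * ‖1 - ξ‖ := by rw [norm_mul, norm_pow, hn, one_pow]; gcongr
        _ = _ := by push_cast; ring
  have : (N : ℝ) ≤ N * (N * ‖1 - ξ‖) := by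
    calc (N : ℝ) = ‖(N : ℂ)‖ := by simp
      _ = ‖∑ j ∈ Finset.range N, (1 - ξ ^ j)‖ := by rw [Finset.sum_sub_distrib, hs]; simp
      _ ≤ ∑ j ∈ Finset.range N, ‖1 - ξ ^ j‖ := norm_sum_le _ _
      _ ≤ ∑ j ∈ Finset.range N, N * ‖1 - ξ‖ := by
          refine Finset.sum_le_sum fun j hj => (hb j).trans ?_
          gcongr; exact (Finset.mem_range.1 hj).le
      _ = _ := by simp
  have hN' : (0 : ℝ) < N := by exact_mod_cast hN
  rw [div_le_iff₀ hN']
  nlinarith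

open Polynomial in
theorem inv_le_norm_sub_of_mem {N : ℕ} (hN : 0 < N) {ζ ζ' : ℂ} (h : ζ ∈ nthRootsFinset N (1 : ℂ))
    (h' : ζ' ∈ nthRootsFinset N (1 : ℂ)) (hne : ζ ≠ ζ') : 1 / (N : ℝ) ≤ ‖ζ - ζ'‖ := by
  have hζ := norm_eq_one_of_mem hN h
  have h0 : ζ ≠ 0 := norm_pos_iff.1 (by rw [hζ]; exact one_pos)
  have := inv_le_norm_one_sub hN (ξ := ζ' / ζ) (by
    rw [div_pow, (mem_nthRootsFinset hN 1).1 h, (mem_nthRootsFinset hN 1).1 h', div_one])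
    (by rw [Ne, div_eq_one_iff_eq h0]; exact hne.symm)
  calc 1 / (N : ℝ) ≤ ‖1 - ζ' / ζ‖ := this
    _ = ‖ζ * (1 - ζ' / ζ)‖ := by rw [norm_mul, hζ, one_mul]
    _ = ‖ζ - ζ'‖ := by congr 1; field_simp

open Polynomial in
/-- Away from the roots of unity, `x ^ N` is away from `1`. -/
theorem le_norm_pow_sub_one {N : ℕ} (hN : 0 < N) {x : ℂ} {s : ℝ} (hs1 : s ≤ 3 / 2)
    (h : ∀ ζ ∈ nthRootsFinset N (1 : ℂ), s ≤ ‖x - ζ‖) : s / 3 ≤ ‖x ^ N - 1‖ := by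
  by_contra! hlt
  set y := x ^ N - 1 with hy
  have hy1 : ‖y‖ < 1 / 2 := by linarith
  have hxN : x ^ N = 1 + y := by rw [hy]; ring
  have hne : 1 + y ≠ 0 := by
    intro h0
    have : y = -1 := by linear_combination h0
    rw [this] at hy1; norm_num at hy1
  have hNC : (N : ℂ) ≠ 0 := by exact_mod_cast hN.ne'
  set E := Complex.exp (Complex.log (1 + y) / N) with hE
  have hEN : E ^ N = 1 + y := by
    rw [hE, ← Complex.exp_nat_mul, mul_div_cancel₀ _ hNC, Complex.exp_log hne]
  have hE0 : E ≠ 0 := Complex.exp_ne_zero _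
  have hlog : ‖Complex.log (1 + y) / N‖ ≤ 3 / 2 * ‖y‖ := by
    rw [norm_div, Complex.norm_natCast]
    have h1 := Complex.norm_log_one_add_half_le_self (z := y) hy1.le
    have h2 : (1 : ℝ) ≤ N := by exact_mod_cast hN
    exact (div_le_self (norm_nonneg _) h2).trans h1
  have hE1 : ‖E - 1‖ ≤ 3 * ‖y‖ := by
    have := Complex.norm_exp_sub_one_le (x := Complex.log (1 + y) / N) (by linarith)
    linarith
  have hmem : x / E ∈ nthRootsFinset N (1 : ℂ) := by
    rw [mem_nthRootsFinset hN, div_pow, hEN, hxN, div_self hne]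
  have h1 := h _ hmem
  have h2 : ‖x - x / E‖ = ‖E - 1‖ := by
    have : x - x / E = (x / E) * (E - 1) := by field_simp
    rw [this, norm_mul, norm_eq_one_of_mem hN hmem, one_mul]
  rw [h2] at h1
  linarith

/-! ### The gain measure -/

theorem IsDoublingWith.integrableOn_log_one_sub_div {c : ℝ} {κ : Measure ℂ}
    (h : IsDoublingWith c κ) (z p : ℂ) (R : ℝ) :
    IntegrableOn (fun w => Real.log ‖1 - z / w‖) (ball p R) κ := by
  have h1 := (h.integrableOn_log_norm_sub z p R).sub (h.integrableOn_log_norm_sub 0 p R)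
  refine h1.congr ?_
  have h2 : ∀ᵐ w ∂κ, w ≠ z := by
    rw [ae_iff]; simpa using h.measure_singleton z
  have h3 : ∀ᵐ w ∂κ, w ≠ 0 := by
    rw [ae_iff]; simpa using h.measure_singleton 0
  filter_upwards [ae_restrict_of_ae h2, ae_restrict_of_ae h3] with w hz h0
  have e : 1 - z / w = (w - z) / w := by field_simp
  rw [e, norm_div, Real.log_div (norm_ne_zero_iff.2 (sub_ne_zero.2 hz)) (norm_ne_zero_iff.2 h0)]
  simp

/-- Crude lower bound, valid for all `z`, for the mean over a small ball of `log ‖1 - z / w‖`. -/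
theorem IsDoublingWith.mul_le_setIntegral_log {c : ℝ} {κ : Measure ℂ}
    (h : IsDoublingWith c κ) {a : ℂ} (ha : ‖a‖ = 3 / 2) (z : ℂ) {r : ℝ} (hr : 0 < r)
    (hr4 : r ≤ 1 / 4) :
    κ.real (ball a r) * (Real.log r - c ^ 6 - 1) ≤ ∫ w in ball a r, Real.log ‖1 - z / w‖ ∂κ := by
  have hc := h.one_le
  have hint := h.integrableOn_log_one_sub_div z a r
  have hl2 := Real.log_two_lt_d9
  have hball : ∀ w ∈ ball a r, 1 ≤ ‖w‖ ∧ ‖w‖ ≤ 2 := by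
    intro w hw
    rw [mem_ball, dist_eq_norm] at hw
    have h1 := norm_sub_norm_le w a
    have h2 := norm_sub_norm_le a w
    rw [norm_sub_rev] at h2
    constructor <;> linarith
  have hne : ∀ w ∈ ball a r, w ≠ z →
      Real.log ‖w - z‖ - Real.log 2 ≤ Real.log ‖1 - z / w‖ := by
    intro w hw hwz
    have hw0 : 0 < ‖w‖ := by linarith [(hball w hw).1]
    have e : 1 - z / w = (w - z) / w := by have := norm_pos_iff.1 hw0; field_simp
    rw [e, norm_div, Real.log_div (norm_ne_zero_iff.2 (sub_ne_zero.2 hwz)) hw0.ne']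
    have := Real.log_le_log hw0 (hball w hw).2
    linarith
  rcases le_or_gt (2 * r) ‖a - z‖ with hfar | hnear
  · calc κ.real (ball a r) * (Real.log r - c ^ 6 - 1)
        = ∫ w in ball a r, (Real.log r - c ^ 6 - 1) ∂κ := by simp
      _ ≤ _ := by
        refine setIntegral_mono_on (integrableOn_const (h.lt_top a r).ne) hint measurableSet_ball
          fun w hw => ?_
        have hwr : r ≤ ‖w - z‖ := by
          rw [mem_ball, dist_eq_norm] at hw
          have := norm_sub_le_norm_sub_add_norm_sub a w z
          rw [norm_sub_rev a w] at this
          linarith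
        have h1 := hne w hw (by rintro rfl; simp at hwr; linarith)
        have h2 := Real.log_le_log hr hwr
        have : 0 ≤ c ^ 6 := by positivity
        linarith
  · have hi2 : IntegrableOn (fun w => Real.log (4 * r / ‖w - z‖)) (ball z (4 * r)) κ :=
      h.integrableOn_log_div z (by positivity)
    have hsub : ball a r ⊆ ball z (4 * r) := ball_subset_ball' (by rw [dist_eq_norm]; linarith)
    have h3 : ∫ w in ball a r, Real.log (4 * r / ‖w - z‖) ∂κ ≤ c ^ 6 * κ.real (ball a r) := by
      calc _ ≤ ∫ w in ball z (4 * r), Real.log (4 * r / ‖w - z‖) ∂κ := by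
            refine setIntegral_mono_set hi2 ?_ hsub.eventuallyLE
            filter_upwards [ae_restrict_mem measurableSet_ball] with w hw
              using IsDoublingWith.log_div_nonneg hw
        _ ≤ c ^ 3 * κ.real (ball z (4 * r)) := h.integral_log_div_le z (by positivity)
        _ ≤ c ^ 3 * (c ^ 3 * κ.real (ball a r)) := by
            gcongr
            exact h.le_of_subset 3 hr (by rw [dist_comm, dist_eq_norm]; linarith)
        _ = _ := by ring
    have h4 : ∫ w in ball a r, (Real.log (4 * r) - 1 - Real.log (4 * r / ‖w - z‖)) ∂κ ≤
        ∫ w in ball a r, Real.log ‖1 - z / w‖ ∂κ := by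
      refine setIntegral_mono_on ((integrableOn_const (h.lt_top a r).ne).sub
        (hi2.mono_set hsub)) hint measurableSet_ball fun w hw => ?_
      rcases eq_or_ne w z with rfl | hwz
      · have hw0 : w ≠ 0 := norm_pos_iff.1 (by linarith [(hball w hw).1])
        have : Real.log (4 * r) ≤ 0 := Real.log_nonpos (by positivity) (by linarith)
        simp [div_self hw0]; linarith
      · have h1 := hne w hw hwz
        rw [Real.log_div (by positivity) (norm_ne_zero_iff.2 (sub_ne_zero.2 hwz))]
        linarith
    rw [integral_sub (f := fun _ => Real.log (4 * r) - 1) (integrableOn_const (h.lt_top a r).ne)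
      (hi2.mono_set hsub)] at h4
    simp only [integral_const, MeasurableSet.univ, measureReal_restrict_apply, univ_inter,
      smul_eq_mul] at h4
    have h5 : Real.log r ≤ Real.log (4 * r) := Real.log_le_log hr (by linarith)
    have h6 : 0 ≤ κ.real (ball a r) := measureReal_nonneg
    nlinarith

theorem log_one_sub_div_ge {a z w : ℂ} (ha : ‖a‖ = 3 / 2) {r s : ℝ} (hrs : r ≤ s / 2)
    (hs1 : s ≤ 1) (hs0 : 0 < s) (hz : s ≤ ‖a - z‖) (hw : ‖w - a‖ < r) :
    Real.log ‖1 - z / a‖ - 4 * r / s ≤ Real.log ‖1 - z / w‖ := by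
  have hr0 : 0 < r := (norm_nonneg _).trans_lt hw
  have h1 := norm_sub_norm_le w a
  have h2 := norm_sub_norm_le a w
  rw [norm_sub_rev] at h2
  have h3 := norm_sub_le_norm_sub_add_norm_sub a w z
  rw [norm_sub_rev a w] at h3
  have hw0 : 0 < ‖w‖ := by linarith
  have hwz : 0 < ‖w - z‖ := by linarith
  have haz : 0 < ‖a - z‖ := by linarith
  have ha0 : 0 < ‖a‖ := by linarith
  have e : 1 - z / w = (w - z) / w := by have := norm_pos_iff.1 hw0; field_simp
  have e' : 1 - z / a = (a - z) / a := by have := norm_pos_iff.1 ha0; field_simp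
  rw [e, e', norm_div, norm_div, Real.log_div hwz.ne' hw0.ne', Real.log_div haz.ne' ha0.ne']
  have h4 : Real.log ‖a - z‖ - Real.log ‖w - z‖ ≤ 2 * r / s := by
    rw [← Real.log_div haz.ne' hwz.ne']
    refine (Real.log_le_sub_one_of_pos (by positivity)).trans ?_
    rw [div_sub_one hwz.ne', div_le_div_iff₀ hwz hs0]
    nlinarith
  have h5 : Real.log ‖w‖ - Real.log ‖a‖ ≤ 2 * r / s := by
    rw [← Real.log_div hw0.ne' ha0.ne']
    refine (Real.log_le_sub_one_of_pos (by positivity)).trans ?_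
    rw [div_sub_one ha0.ne', div_le_div_iff₀ ha0 hs0]
    nlinarith
  have h6 : 4 * r / s = 2 * r / s + 2 * r / s := by ring
  linarith

open Polynomial in
/-- The sum over the vertices `a` of a regular polygon of a function that is nearly `log ‖1 - z / a‖`,
except at a vertex very close to `z`, is not much smaller than `0`. If a vertex `a₀` is very close
to `z`, then `z` is replaced by the nearby point `a₀ + 2 s`, and otherwise the product
`∏ (1 - z / a) = 1 - (2 z / 3) ^ N` is used. -/
theorem sum_ge_of_near_log {N : ℕ} (hN : 0 < N) (z : ℂ) {s K : ℝ} (hs : s = 1 / (12 * N ^ 2))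
    (hK : 0 ≤ K)
    (X : ℂ → ℝ) (hfar : ∀ ζ ∈ nthRootsFinset N (1 : ℂ), s ≤ ‖3 / 2 * ζ - z‖ →
      Real.log ‖1 - z / (3 / 2 * ζ)‖ - 1 / N ≤ X ζ)
    (hall : ∀ ζ ∈ nthRootsFinset N (1 : ℂ), - K ≤ X ζ) :
    Real.log (s / 5) - 2 - K ≤ ∑ ζ ∈ nthRootsFinset N (1 : ℂ), X ζ := by
  classical
  set S := nthRootsFinset N (1 : ℂ) with hS
  have hN1 : (1 : ℝ) ≤ N := by exact_mod_cast hN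
  have hs0 : 0 < s := by rw [hs]; positivity
  have hs12 : 12 * s * N ^ 2 = 1 := by rw [hs]; field_simp
  have hs1 : s ≤ 1 / 12 := by
    rw [hs]; exact one_div_le_one_div_of_le (by norm_num) (by nlinarith)
  have hsN : 12 * s * N ≤ 1 := by nlinarith
  have hn : ∀ ζ ∈ S, ‖ζ‖ = 1 := fun ζ hζ => norm_eq_one_of_mem hN hζ
  have h0 : ∀ ζ ∈ S, ζ ≠ 0 := fun ζ hζ => norm_pos_iff.1 (by rw [hn ζ hζ]; exact one_pos)
  have hnorm : ∀ x : ℂ, ∀ ζ ∈ S, ‖1 - x / (3 / 2 * ζ)‖ = ‖2 / 3 * x - ζ‖ := by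
    intro x ζ hζ
    have := h0 ζ hζ
    calc ‖1 - x / (3 / 2 * ζ)‖ = ‖ζ‖ * ‖1 - x / (3 / 2 * ζ)‖ := by rw [hn ζ hζ, one_mul]
      _ = ‖2 / 3 * x - ζ‖ := by
        rw [← norm_mul, norm_sub_rev]; congr 1; field_simp
  have hd : ∀ x : ℂ, ∀ ζ : ℂ, ‖3 / 2 * ζ - x‖ = 3 / 2 * ‖2 / 3 * x - ζ‖ := by
    intro x ζ
    rw [norm_sub_rev]
    calc ‖x - 3 / 2 * ζ‖ = ‖(3 / 2 : ℂ) * (2 / 3 * x - ζ)‖ := by congr 1; ring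
      _ = _ := by rw [norm_mul]; norm_num
  -- the logarithm of the product, at a point that is not close to the vertices
  have hprod : ∀ x : ℂ, (∀ ζ ∈ S, s ≤ ‖3 / 2 * ζ - x‖) →
      Real.log (s / 5) ≤ ∑ ζ ∈ S, Real.log ‖1 - x / (3 / 2 * ζ)‖ := by
    intro x hx
    have h1 : ∀ ζ ∈ S, 2 / 3 * s ≤ ‖2 / 3 * x - ζ‖ := fun ζ hζ => by
      have := hx ζ hζ; rw [hd] at this; linarith
    have h2 := le_norm_pow_sub_one hN (by linarith) h1
    rw [Finset.sum_congr rfl fun ζ hζ => by rw [hnorm x ζ hζ],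
      ← Real.log_prod (fun ζ hζ => by have := h1 ζ hζ; linarith), ← norm_prod,
      prod_sub_nthRootsFinset hN]
    exact Real.log_le_log (by positivity) (by linarith)
  have hcard : (S.card : ℝ) = N := by rw [hS, card_nthRootsFinset_one hN]
  by_cases hz : ∀ ζ ∈ S, s ≤ ‖3 / 2 * ζ - z‖
  · have h1 := hprod z hz
    have h2 : ∑ ζ ∈ S, (Real.log ‖1 - z / (3 / 2 * ζ)‖ - 1 / N) ≤ ∑ ζ ∈ S, X ζ :=
      Finset.sum_le_sum fun ζ hζ => hfar ζ hζ (hz ζ hζ)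
    rw [Finset.sum_sub_distrib, Finset.sum_const, nsmul_eq_mul, hcard] at h2
    have : (N : ℝ) * (1 / N) = 1 := by field_simp
    linarith
  · push Not at hz
    obtain ⟨ζ₀, hζ₀, hnear⟩ := hz
    set z' : ℂ := 3 / 2 * ζ₀ + (2 * s : ℝ) with hz'
    have hz'0 : ‖3 / 2 * ζ₀ - z'‖ = 2 * s := by
      rw [hz', sub_add_cancel_left, norm_neg, Complex.norm_real, Real.norm_of_nonneg (by positivity)]
    have hzz' : ‖z - z'‖ ≤ 3 * s := by
      have := norm_sub_le_norm_sub_add_norm_sub z (3 / 2 * ζ₀) z'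
      rw [norm_sub_rev z (3 / 2 * ζ₀)] at this; linarith
    have hsep : ∀ ζ ∈ S, ζ ≠ ζ₀ → 1 / N ≤ ‖3 / 2 * ζ - z'‖ + 2 * s := by
      intro ζ hζ hne
      have h1 := inv_le_norm_sub_of_mem hN hζ hζ₀ hne
      have h2 : ‖3 / 2 * ζ - 3 / 2 * ζ₀‖ = 3 / 2 * ‖ζ - ζ₀‖ := by
        rw [← mul_sub, norm_mul]; norm_num
      have h3 := norm_sub_le_norm_sub_add_norm_sub (3 / 2 * ζ) z' (3 / 2 * ζ₀)
      rw [norm_sub_rev z'] at h3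
      have := norm_nonneg (ζ - ζ₀)
      linarith
    have h12 : 12 * s ≤ 1 / N := by rw [le_div_iff₀ (by linarith)]; linarith
    have hp := hprod z' (fun ζ hζ => by
      rcases eq_or_ne ζ ζ₀ with rfl | hne
      · rw [hz'0]; linarith
      · have := hsep ζ hζ hne
        linarith)
    rw [← Finset.add_sum_erase _ _ hζ₀] at hp ⊢
    have h1 : Real.log ‖1 - z' / (3 / 2 * ζ₀)‖ ≤ 0 := by
      refine Real.log_nonpos (norm_nonneg _) ?_
      have := hd z' ζ₀
      rw [hnorm z' ζ₀ hζ₀]; linarith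
    have h2 : ∀ ζ ∈ S.erase ζ₀, Real.log ‖1 - z' / (3 / 2 * ζ)‖ - 2 / N ≤ X ζ := by
      intro ζ hζ
      obtain ⟨hne, hζ⟩ := Finset.mem_erase.1 hζ
      have h3 := hsep ζ hζ hne
      have h4 := norm_sub_le_norm_sub_add_norm_sub (3 / 2 * ζ) z z'
      have h5 := hfar ζ hζ (by linarith)
      refine le_trans ?_ h5
      have h6 : Real.log ‖1 - z' / (3 / 2 * ζ)‖ - Real.log ‖1 - z / (3 / 2 * ζ)‖ ≤ 1 / N := by
        have h7 := hd z ζ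
        have h8 := hd z' ζ
        have h9 : 0 < ‖2 / 3 * z - ζ‖ := by linarith
        have h10 : 0 < ‖2 / 3 * z' - ζ‖ := by linarith
        rw [hnorm z ζ hζ, hnorm z' ζ hζ, ← Real.log_div h10.ne' h9.ne']
        refine (Real.log_le_sub_one_of_pos (by positivity)).trans ?_
        rw [div_sub_one h9.ne', div_le_div_iff₀ h9 (by linarith)]
        have h11 := norm_sub_le_norm_sub_add_norm_sub (3 / 2 * ζ) z z'
        have h12' := norm_sub_le_norm_sub_add_norm_sub (3 / 2 * ζ) z' z
        rw [norm_sub_rev z' z] at h12'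
        have h13 : 1 / (2 * N : ℝ) ≤ ‖3 / 2 * ζ - z‖ := by
          have : 1 / (2 * N : ℝ) = 1 / N / 2 := by ring
          rw [this]; linarith
        rw [div_le_iff₀ (by positivity)] at h13
        nlinarith
      have : 2 / (N : ℝ) = 1 / N + 1 / N := by ring
      linarith
    have h3 := Finset.sum_le_sum h2
    rw [Finset.sum_sub_distrib, Finset.sum_const, nsmul_eq_mul] at h3
    have h4 : ((S.erase ζ₀).card : ℝ) * (2 / N) ≤ 2 := by
      have : ((S.erase ζ₀).card : ℝ) ≤ N := by
        rw [← hcard]; exact_mod_cast Finset.card_le_card (Finset.erase_subset _ _)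
      rw [mul_div_assoc', div_le_iff₀ (by linarith)]; linarith
    have h5 := hall ζ₀ hζ₀
    linarith

open Polynomial in
/-- The gain measure: near each vertex of the regular `N`-gon of radius `3 / 2`, in a ball of
radius `r`, it is the multiple of `κ` whose mass in that ball is `t`. -/
noncomputable def gainMeasure (κ : Measure ℂ) (N : ℕ) (r t : ℝ) : Measure ℂ :=
  ∑ ζ ∈ nthRootsFinset N (1 : ℂ),
    ENNReal.ofReal (t / κ.real (ball (3 / 2 * ζ) r)) • κ.restrict (ball (3 / 2 * ζ) r)

/-- The annulus `1 ≤ ‖w‖ < 2`. -/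
def unitAnnulus : Set ℂ := ball 0 2 \ ball 0 1

theorem measurableSet_unitAnnulus : MeasurableSet unitAnnulus :=
  measurableSet_ball.diff measurableSet_ball

theorem mem_unitAnnulus {w : ℂ} : w ∈ unitAnnulus ↔ 1 ≤ ‖w‖ ∧ ‖w‖ < 2 := by
  simp [unitAnnulus, and_comm]

open Polynomial

section Gain

variable {c : ℝ} {κ : Measure ℂ} {N : ℕ} {r t : ℝ}

theorem norm_vertex (hN : 0 < N) {ζ : ℂ} (hζ : ζ ∈ nthRootsFinset N (1 : ℂ)) :
    ‖3 / 2 * ζ‖ = 3 / 2 := by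
  rw [norm_mul, norm_eq_one_of_mem hN hζ]; norm_num

theorem ball_vertex_subset (hN : 0 < N) (hr : r ≤ 1 / 4) {ζ : ℂ}
    (hζ : ζ ∈ nthRootsFinset N (1 : ℂ)) : ball (3 / 2 * ζ) r ⊆ unitAnnulus := by
  intro w hw
  have ha := norm_vertex hN hζ
  rw [mem_ball, dist_eq_norm] at hw
  have h1 := norm_sub_norm_le w (3 / 2 * ζ)
  have h2 := norm_sub_norm_le (3 / 2 * ζ) w
  rw [norm_sub_rev] at h2
  rw [mem_unitAnnulus]
  constructor <;> linarith

theorem gainMeasure_le (h : IsDoublingWith c κ) (hN : 0 < N) (hr0 : 0 < r) (hr : r ≤ 1 / 4)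
    (ht : ∀ ζ ∈ nthRootsFinset N (1 : ℂ), N * t ≤ κ.real (ball (3 / 2 * ζ) r)) :
    gainMeasure κ N r t ≤ κ.restrict unitAnnulus := by
  have hN' : (0 : ℝ) < N := by exact_mod_cast hN
  have h1 : ∀ ζ ∈ nthRootsFinset N (1 : ℂ), ENNReal.ofReal (t / κ.real (ball (3 / 2 * ζ) r)) •
      κ.restrict (ball (3 / 2 * ζ) r) ≤ ENNReal.ofReal (1 / N) • κ.restrict unitAnnulus := by
    intro ζ hζ
    have h2 : ENNReal.ofReal (t / κ.real (ball (3 / 2 * ζ) r)) ≤ ENNReal.ofReal (1 / N) := by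
      refine ENNReal.ofReal_le_ofReal ?_
      rw [div_le_div_iff₀ (h.pos _ _ hr0) hN']
      have := ht ζ hζ; linarith
    have h3 : κ.restrict (ball (3 / 2 * ζ) r) ≤ κ.restrict unitAnnulus :=
      Measure.restrict_mono (ball_vertex_subset hN hr hζ) le_rfl
    intro s
    simp only [Measure.smul_apply, smul_eq_mul]
    exact mul_le_mul' h2 (h3 s)
  have hsum : ∀ T : Finset ℂ, T ⊆ nthRootsFinset N (1 : ℂ) →
      ∑ ζ ∈ T, ENNReal.ofReal (t / κ.real (ball (3 / 2 * ζ) r)) •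
        κ.restrict (ball (3 / 2 * ζ) r) ≤ ∑ ζ ∈ T, ENNReal.ofReal (1 / N) • κ.restrict unitAnnulus :=
    fun T hT => Finset.sum_le_sum fun ζ hζ => h1 ζ (hT hζ)
  refine (hsum _ subset_rfl).trans (le_of_eq ?_)
  rw [Finset.sum_const, card_nthRootsFinset_one hN, ← Nat.cast_smul_eq_nsmul ℝ≥0∞, smul_smul]
  have : (N : ℝ≥0∞) * ENNReal.ofReal (1 / N) = 1 := by
    rw [← ENNReal.ofReal_natCast, ← ENNReal.ofReal_mul (by positivity), mul_one_div_cancel hN'.ne',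
      ENNReal.ofReal_one]
  rw [this, one_smul]

theorem integral_gainMeasure (hN : 0 < N) (hr : r ≤ 1 / 4) (ht : 0 ≤ t) {E : Type*}
    [NormedAddCommGroup E] [NormedSpace ℝ E] {f : ℂ → E} (hf : IntegrableOn f unitAnnulus κ) :
    ∫ w, f w ∂(gainMeasure κ N r t) = ∑ ζ ∈ nthRootsFinset N (1 : ℂ),
      (t / κ.real (ball (3 / 2 * ζ) r)) • ∫ w in ball (3 / 2 * ζ) r, f w ∂κ := by
  rw [gainMeasure, integral_finsetSum_measure]
  · refine Finset.sum_congr rfl fun ζ _ => ?_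
    rw [integral_smul_measure, ENNReal.toReal_ofReal (by positivity)]
  · intro ζ hζ
    refine Integrable.smul_measure (hf.mono_set (ball_vertex_subset hN hr hζ)) ENNReal.ofReal_ne_top

/-- Lower bounds for the means over the balls give a lower bound for the integral. -/
theorem mul_sum_le_integral_gainMeasure (h : IsDoublingWith c κ) (hN : 0 < N) (hr0 : 0 < r)
    (hr : r ≤ 1 / 4) (ht : 0 ≤ t) {f : ℂ → ℝ} (hf : IntegrableOn f unitAnnulus κ) (X : ℂ → ℝ)
    (hX : ∀ ζ ∈ nthRootsFinset N (1 : ℂ),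
      κ.real (ball (3 / 2 * ζ) r) * X ζ ≤ ∫ w in ball (3 / 2 * ζ) r, f w ∂κ) :
    t * ∑ ζ ∈ nthRootsFinset N (1 : ℂ), X ζ ≤ ∫ w, f w ∂(gainMeasure κ N r t) := by
  rw [integral_gainMeasure hN hr ht hf, Finset.mul_sum]
  refine Finset.sum_le_sum fun ζ hζ => ?_
  have h1 := h.pos (3 / 2 * ζ) r hr0
  calc t * X ζ = t / κ.real (ball (3 / 2 * ζ) r) * (κ.real (ball (3 / 2 * ζ) r) * X ζ) := by
        rw [← mul_assoc, div_mul_cancel₀ _ h1.ne']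
    _ ≤ _ := by rw [smul_eq_mul]; gcongr; exact hX ζ hζ

theorem IsDoublingWith.integrableOn_log_unitAnnulus (h : IsDoublingWith c κ) (z : ℂ) :
    IntegrableOn (fun w => Real.log ‖1 - z / w‖) unitAnnulus κ :=
  (h.integrableOn_log_one_sub_div z 0 2).mono_set sdiff_subset

theorem setIntegral_ball_ge (h : IsDoublingWith c κ) (hN : 0 < N)
    (hr : r ≤ 1 / 4) {f : ℂ → ℝ} (hf : IntegrableOn f unitAnnulus κ) {ζ : ℂ}
    (hζ : ζ ∈ nthRootsFinset N (1 : ℂ)) {x : ℝ} (hx : ∀ w ∈ ball (3 / 2 * ζ) r, x ≤ f w) :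
    κ.real (ball (3 / 2 * ζ) r) * x ≤ ∫ w in ball (3 / 2 * ζ) r, f w ∂κ := by
  calc κ.real (ball (3 / 2 * ζ) r) * x = ∫ w in ball (3 / 2 * ζ) r, x ∂κ := by simp
    _ ≤ _ := setIntegral_mono_on (integrableOn_const (h.lt_top _ r).ne)
        (hf.mono_set (ball_vertex_subset hN hr hζ)) measurableSet_ball hx

/-- The potential of the gain measure is almost nonnegative: the loss is logarithmic in `N`, while
the total mass is `N * t`. -/
theorem integral_log_gainMeasure_ge (h : IsDoublingWith c κ) (hN : 0 < N) (ht : 0 ≤ t)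
    {s : ℝ} (hs : s = 1 / (12 * N ^ 2)) (hr : r = s / (4 * N)) (z : ℂ) :
    t * (Real.log (s / 5) - 2 - (c ^ 6 + 1 - Real.log r)) ≤
      ∫ w, Real.log ‖1 - z / w‖ ∂(gainMeasure κ N r t) := by
  have hN1 : (1 : ℝ) ≤ N := by exact_mod_cast hN
  have hs0 : 0 < s := by rw [hs]; positivity
  have hs1 : s ≤ 1 / 12 := by
    rw [hs]; exact one_div_le_one_div_of_le (by norm_num) (by nlinarith)
  have hr0 : 0 < r := by rw [hr]; positivity
  have hrs : r ≤ s / 2 := by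
    rw [hr]; exact div_le_div_of_nonneg_left hs0.le (by norm_num) (by linarith)
  have hr4 : r ≤ 1 / 4 := by linarith
  have hc := h.one_le
  have hf := h.integrableOn_log_unitAnnulus z
  have hlr : Real.log r ≤ 0 := Real.log_nonpos hr0.le (by linarith)
  have hc6 : 0 ≤ c ^ 6 := by positivity
  set X : ℂ → ℝ := fun ζ => (κ.real (ball (3 / 2 * ζ) r))⁻¹ *
    ∫ w in ball (3 / 2 * ζ) r, Real.log ‖1 - z / w‖ ∂κ with hXdef
  have hX : ∀ ζ, κ.real (ball (3 / 2 * ζ) r) * X ζ =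
      ∫ w in ball (3 / 2 * ζ) r, Real.log ‖1 - z / w‖ ∂κ := fun ζ => by
    have := (h.pos (3 / 2 * ζ) r hr0).ne'
    rw [hXdef]; exact mul_inv_cancel_left₀ this _
  refine le_trans ?_ (mul_sum_le_integral_gainMeasure h hN hr0 hr4 ht hf X fun ζ _ => (hX ζ).le)
  refine mul_le_mul_of_nonneg_left ?_ ht
  refine sum_ge_of_near_log hN z hs (by linarith) X ?_ ?_
  · intro ζ hζ hz
    refine le_of_mul_le_mul_left ?_ (h.pos (3 / 2 * ζ) r hr0)
    rw [hX]
    refine setIntegral_ball_ge h hN hr4 hf hζ fun w hw => ?_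
    have := log_one_sub_div_ge (norm_vertex hN hζ) hrs (by linarith) hs0 hz
      (by rwa [mem_ball, dist_eq_norm] at hw)
    have e : 4 * r / s = 1 / N := by rw [hr]; field_simp
    rwa [e] at this
  · intro ζ hζ
    refine le_of_mul_le_mul_left ?_ (h.pos (3 / 2 * ζ) r hr0)
    rw [hX]
    have := h.mul_le_setIntegral_log (norm_vertex hN hζ) z hr0 hr4
    calc _ = κ.real (ball (3 / 2 * ζ) r) * (Real.log r - c ^ 6 - 1) := by ring
      _ ≤ _ := this

/-- Far away, `log ‖1 - z / w‖` is comparable to `log ‖z‖`. -/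
theorem log_norm_le_log_one_sub_div {z w : ℂ} (hz : 8 ≤ ‖z‖) (hw1 : 1 ≤ ‖w‖) (hw2 : ‖w‖ ≤ 2) :
    1 / 3 * Real.log ‖z‖ ≤ Real.log ‖1 - z / w‖ := by
  have h1 : ‖z‖ / 4 ≤ ‖1 - z / w‖ := by
    have := norm_sub_norm_le (z / w) 1
    rw [norm_one, norm_div, norm_sub_rev] at this
    have : ‖z‖ / 2 ≤ ‖z‖ / ‖w‖ := by gcongr
    linarith
  have h2 := Real.log_le_log (by positivity) h1
  rw [Real.log_div (by positivity) (by norm_num)] at h2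
  have h3 := Real.log_le_log (by norm_num) hz
  have h4 : Real.log 8 = 3 * Real.log 2 := by
    rw [show (8 : ℝ) = 2 ^ 3 by norm_num, Real.log_pow]; norm_num
  have h5 : Real.log 4 = 2 * Real.log 2 := by
    rw [show (4 : ℝ) = 2 ^ 2 by norm_num, Real.log_pow]; norm_num
  linarith

theorem integral_log_gainMeasure_far (h : IsDoublingWith c κ) (hN : 0 < N) (hr0 : 0 < r)
    (hr : r ≤ 1 / 4) (ht : 0 ≤ t) {z : ℂ} (hz : 8 ≤ ‖z‖) :
    t * N * (1 / 3 * Real.log ‖z‖) ≤ ∫ w, Real.log ‖1 - z / w‖ ∂(gainMeasure κ N r t) := by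
  have hf := h.integrableOn_log_unitAnnulus z
  have := mul_sum_le_integral_gainMeasure h hN hr0 hr ht hf (fun _ => 1 / 3 * Real.log ‖z‖)
    fun ζ hζ => setIntegral_ball_ge h hN hr hf hζ fun w hw => by
      have := mem_unitAnnulus.1 (ball_vertex_subset hN hr hζ hw)
      exact log_norm_le_log_one_sub_div hz this.1 this.2.le
  rw [Finset.sum_const, card_nthRootsFinset_one hN, nsmul_eq_mul] at this
  linarith

theorem measurable_logRem (p : ℕ) : Measurable (logRem p) := by
  unfold logRem logPoly
  fun_prop

theorem norm_div_sub_div_le {a w : ℂ} (z : ℂ) (ha : 1 ≤ ‖a‖) (hw : 1 ≤ ‖w‖) :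
    ‖z / w - z / a‖ ≤ ‖z‖ * ‖w - a‖ := by
  have ha0 : a ≠ 0 := norm_pos_iff.1 (by linarith)
  have hw0 : w ≠ 0 := norm_pos_iff.1 (by linarith)
  have e : z / w - z / a = z * (a - w) / (w * a) := by field_simp
  rw [e, norm_div, norm_mul, norm_mul, norm_sub_rev]
  exact div_le_self (by positivity) (by nlinarith)

theorem norm_div_le_of_one_le {w : ℂ} (z : ℂ) (hw : 1 ≤ ‖w‖) : ‖z / w‖ ≤ ‖z‖ := by
  rw [norm_div]; exact div_le_self (norm_nonneg _) hw

theorem abs_logRem_div_sub_le (p : ℕ) {z a w : ℂ} (hz : ‖z‖ ≤ 1 / 2) (ha : 1 ≤ ‖a‖) (hw : 1 ≤ ‖w‖) :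
    |logRem p (z / w) - logRem p (z / a)| ≤ 2 * ‖z‖ ^ (p + 1) * ‖w - a‖ := by
  have h1 := abs_logRem_sub_le p hz (norm_div_le_of_one_le z hw) (norm_div_le_of_one_le z ha)
  have h2 := norm_div_sub_div_le z ha hw
  calc _ ≤ _ := h1
    _ ≤ 2 * ‖z‖ ^ p * (‖z‖ * ‖w - a‖) := by gcongr
    _ = _ := by ring

theorem IsDoublingWith.integrableOn_logRem (h : IsDoublingWith c κ) (p : ℕ) {z : ℂ}
    (hz : ‖z‖ ≤ 1 / 2) : IntegrableOn (fun w => logRem p (z / w)) unitAnnulus κ := by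
  refine Measure.integrableOn_of_bounded (M := 2)
    ((measure_mono sdiff_subset).trans_lt (h.lt_top 0 2)).ne
    ((measurable_logRem p).comp (by fun_prop)).aestronglyMeasurable ?_
  filter_upwards [ae_restrict_mem measurableSet_unitAnnulus] with w hw
  have h1 := norm_div_le_of_one_le z (mem_unitAnnulus.1 hw).1
  refine (abs_logRem_le p (h1.trans hz)).trans ?_
  have : ‖z / w‖ ^ (p + 1) ≤ 1 := pow_le_one₀ (norm_nonneg _) (by linarith)
  linarith

/-- The powers below `N` cancel in the sum over the vertices of the `N`-gon, so the sum of the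
remainders is of the order `‖z‖ ^ N` near the origin; this is weakened here to the order `p + 1`. -/
theorem sum_logRem_vertices {p : ℕ} (hN : 0 < N) (hp : p < N) {z : ℂ} (hz : ‖z‖ ≤ 1 / 2) :
    -(2 * ‖z‖ ^ (p + 1)) ≤ ∑ ζ ∈ nthRootsFinset N (1 : ℂ), logRem p (z / (3 / 2 * ζ)) := by
  set x := 2 / 3 * z with hx
  have hxz : ‖x‖ ≤ ‖z‖ := by
    rw [hx, norm_mul]; norm_num; linarith [norm_nonneg z]
  have hn : ∀ ζ ∈ nthRootsFinset N (1 : ℂ), ‖ζ‖ = 1 := fun ζ hζ => norm_eq_one_of_mem hN hζ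
  have h0 : ∀ ζ ∈ nthRootsFinset N (1 : ℂ), ζ ≠ 0 := fun ζ hζ =>
    norm_pos_iff.1 (by rw [hn ζ hζ]; exact one_pos)
  have e1 : ∑ ζ ∈ nthRootsFinset N (1 : ℂ), logRem p (z / (3 / 2 * ζ)) =
      ∑ ζ ∈ nthRootsFinset N (1 : ℂ), (Real.log ‖x - ζ‖ + (logPoly p (x * ζ⁻¹)).re) := by
    refine Finset.sum_congr rfl fun ζ hζ => ?_
    have := h0 ζ hζ
    have e : z / (3 / 2 * ζ) = x * ζ⁻¹ := by rw [hx]; field_simp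
    rw [e, logRem]
    congr 2
    calc ‖1 - x * ζ⁻¹‖ = ‖ζ‖ * ‖1 - x * ζ⁻¹‖ := by rw [hn ζ hζ, one_mul]
      _ = ‖x - ζ‖ := by rw [← norm_mul, norm_sub_rev]; congr 1; field_simp
  have e2 : ∑ ζ ∈ nthRootsFinset N (1 : ℂ), (logPoly p (x * ζ⁻¹)).re = 0 := by
    rw [← Complex.re_sum]
    unfold logPoly
    rw [Finset.sum_comm, Finset.sum_eq_zero, Complex.zero_re]
    intro j hj
    rw [Finset.sum_congr rfl fun ζ _ => by rw [mul_pow, mul_div_right_comm],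
      ← Finset.mul_sum, sum_inv_pow_nthRootsFinset hN (Nat.succ_pos j)
        (by have := Finset.mem_range.1 hj; omega), mul_zero]
  rw [e1, Finset.sum_add_distrib, e2, add_zero, ← Real.log_prod, ← norm_prod,
    prod_sub_nthRootsFinset hN]
  · have h1 : ‖x ^ N‖ ≤ 1 / 2 := by
      rw [norm_pow]
      calc ‖x‖ ^ N ≤ ‖x‖ ^ 1 := pow_le_pow_of_le_one (norm_nonneg _) (by linarith) hN
        _ ≤ 1 / 2 := by rw [pow_one]; linarith
    have h2 := abs_logRem_le 0 h1
    simp only [logRem, logPoly, Finset.range_zero, Finset.sum_empty, Complex.zero_re, add_zero,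
      zero_add, pow_one] at h2
    rw [norm_sub_rev]
    have h3 : ‖x ^ N‖ ≤ ‖z‖ ^ (p + 1) := by
      rw [norm_pow]
      calc ‖x‖ ^ N ≤ ‖x‖ ^ (p + 1) := pow_le_pow_of_le_one (norm_nonneg _) (by linarith) hp
        _ ≤ _ := pow_le_pow_left₀ (norm_nonneg _) hxz _
    have := neg_abs_le (Real.log ‖1 - x ^ N‖)
    linarith
  · intro ζ hζ
    have := norm_sub_norm_le ζ x
    rw [hn ζ hζ, norm_sub_rev] at this
    linarith

theorem integral_logRem_gainMeasure_ge (h : IsDoublingWith c κ) {p : ℕ} (hN : 0 < N) (hp : p < N)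
    (hr0 : 0 < r) (hr : r ≤ 1 / 4) (hrN : N * r ≤ 1) (ht : 0 ≤ t) {z : ℂ} (hz : ‖z‖ ≤ 1 / 2) :
    -(4 * t * ‖z‖ ^ (p + 1)) ≤ ∫ w, logRem p (z / w) ∂(gainMeasure κ N r t) := by
  have hf := h.integrableOn_logRem p hz
  have h1 := mul_sum_le_integral_gainMeasure h hN hr0 hr ht hf
    (fun ζ => logRem p (z / (3 / 2 * ζ)) - 2 * ‖z‖ ^ (p + 1) * r)
    fun ζ hζ => setIntegral_ball_ge h hN hr hf hζ fun w hw => by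
      have hw1 := mem_unitAnnulus.1 (ball_vertex_subset hN hr hζ hw)
      have h2 := abs_logRem_div_sub_le p hz (a := 3 / 2 * ζ) (by rw [norm_vertex hN hζ]; norm_num)
        hw1.1
      rw [mem_ball, dist_eq_norm] at hw
      have h3 : 2 * ‖z‖ ^ (p + 1) * ‖w - 3 / 2 * ζ‖ ≤ 2 * ‖z‖ ^ (p + 1) * r := by gcongr
      have := neg_abs_le (logRem p (z / w) - logRem p (z / (3 / 2 * ζ)))
      linarith
  refine le_trans ?_ h1
  rw [Finset.sum_sub_distrib, Finset.sum_const, card_nthRootsFinset_one hN, nsmul_eq_mul]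
  have h2 := sum_logRem_vertices hN hp hz
  have h3 : 0 ≤ ‖z‖ ^ (p + 1) := by positivity
  have h4 : (N : ℝ) * (2 * ‖z‖ ^ (p + 1) * r) ≤ 2 * ‖z‖ ^ (p + 1) := by nlinarith
  have := mul_le_mul_of_nonneg_left (show -(4 * ‖z‖ ^ (p + 1)) ≤
    ∑ ζ ∈ nthRootsFinset N (1 : ℂ), logRem p (z / (3 / 2 * ζ)) -
      N * (2 * ‖z‖ ^ (p + 1) * r) by linarith) ht
  linarith

theorem norm_inv_pow_sub_le {a w : ℂ} (ha : 1 ≤ ‖a‖) (hw : 1 ≤ ‖w‖) (j : ℕ) :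
    ‖(w⁻¹) ^ j - (a⁻¹) ^ j‖ ≤ j * ‖w - a‖ := by
  have h1 : ‖w⁻¹‖ ≤ 1 := by rw [norm_inv]; exact inv_le_one_of_one_le₀ hw
  have h2 : ‖a⁻¹‖ ≤ 1 := by rw [norm_inv]; exact inv_le_one_of_one_le₀ ha
  have h3 : ‖w⁻¹ - a⁻¹‖ ≤ ‖w - a‖ := by
    simpa using norm_div_sub_div_le 1 ha hw
  induction j with
  | zero => simp
  | succ j ih =>
    calc ‖(w⁻¹) ^ (j + 1) - (a⁻¹) ^ (j + 1)‖
        = ‖((w⁻¹) ^ j - (a⁻¹) ^ j) * w⁻¹ + (a⁻¹) ^ j * (w⁻¹ - a⁻¹)‖ := by ring_nf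
      _ ≤ ‖(w⁻¹) ^ j - (a⁻¹) ^ j‖ * ‖w⁻¹‖ + ‖a⁻¹‖ ^ j * ‖w⁻¹ - a⁻¹‖ := by
          refine (norm_add_le _ _).trans ?_
          rw [norm_mul, norm_mul, norm_pow]
      _ ≤ (j * ‖w - a‖) * 1 + 1 * ‖w - a‖ := by
          gcongr
          exact pow_le_one₀ (norm_nonneg _) h2
      _ = _ := by push_cast; ring

theorem IsDoublingWith.integrableOn_inv_pow (h : IsDoublingWith c κ) (j : ℕ) :
    IntegrableOn (fun w : ℂ => (w⁻¹) ^ j) unitAnnulus κ := by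
  refine Measure.integrableOn_of_bounded (M := 1)
    ((measure_mono sdiff_subset).trans_lt (h.lt_top 0 2)).ne
    (by fun_prop : Measurable fun w : ℂ => (w⁻¹) ^ j).aestronglyMeasurable ?_
  filter_upwards [ae_restrict_mem measurableSet_unitAnnulus] with w hw
  rw [norm_pow, norm_inv]
  exact pow_le_one₀ (by positivity) (inv_le_one_of_one_le₀ (mem_unitAnnulus.1 hw).1)

/-- The negative moments of the gain measure are small, since those of the vertices vanish. -/
theorem norm_moment_gainMeasure_le (h : IsDoublingWith c κ) {j : ℕ} (hN : 0 < N) (hj0 : 0 < j)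
    (hj : j < N) (hr0 : 0 < r) (hr : r ≤ 1 / 4) (hrN : N * r ≤ 1) (ht : 0 ≤ t) :
    ‖∫ w, (w⁻¹) ^ j ∂(gainMeasure κ N r t)‖ ≤ j * t := by
  rw [integral_gainMeasure hN hr ht (h.integrableOn_inv_pow j)]
  have h0 : ∑ ζ ∈ nthRootsFinset N (1 : ℂ), (t : ℂ) * ((3 / 2 * ζ)⁻¹) ^ j = 0 := by
    rw [← Finset.mul_sum, Finset.sum_congr rfl fun ζ _ => by rw [mul_inv, mul_pow],
      ← Finset.mul_sum, sum_inv_pow_nthRootsFinset hN hj0 hj, mul_zero, mul_zero]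
  rw [← sub_zero (Finset.sum _ _), ← h0, ← Finset.sum_sub_distrib]
  refine (norm_sum_le _ _).trans ?_
  calc _ ≤ ∑ ζ ∈ nthRootsFinset N (1 : ℂ), t * (j * r) := by
        refine Finset.sum_le_sum fun ζ hζ => ?_
        have hB := h.pos (3 / 2 * ζ) r hr0
        have e : (t / κ.real (ball (3 / 2 * ζ) r)) • ∫ w in ball (3 / 2 * ζ) r, (w⁻¹) ^ j ∂κ -
            (t : ℂ) * ((3 / 2 * ζ)⁻¹) ^ j = (t / κ.real (ball (3 / 2 * ζ) r)) •
              ∫ w in ball (3 / 2 * ζ) r, ((w⁻¹) ^ j - ((3 / 2 * ζ)⁻¹) ^ j) ∂κ := by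
          rw [integral_sub (f := fun w : ℂ => (w⁻¹) ^ j) (g := fun _ => ((3 / 2 * ζ)⁻¹) ^ j)
            ((h.integrableOn_inv_pow j).mono_set (ball_vertex_subset hN hr hζ))
            (integrableOn_const (h.lt_top _ _).ne), smul_sub]
          congr 1
          simp only [integral_const, MeasurableSet.univ, measureReal_restrict_apply, univ_inter,
            smul_smul]
          rw [div_mul_cancel₀ _ hB.ne', Complex.real_smul]
        rw [e, norm_smul, Real.norm_of_nonneg (by positivity)]
        have h1 := norm_setIntegral_le_of_norm_le_const (μ := κ) (s := ball (3 / 2 * ζ) r)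
          (f := fun w : ℂ => (w⁻¹) ^ j - ((3 / 2 * ζ)⁻¹) ^ j) (C := j * r) (h.lt_top _ _)
          (fun w hw => by
            have hw1 := mem_unitAnnulus.1 (ball_vertex_subset hN hr hζ hw)
            refine (norm_inv_pow_sub_le (by rw [norm_vertex hN hζ]; norm_num) hw1.1 j).trans ?_
            rw [mem_ball, dist_eq_norm] at hw
            gcongr)
        calc _ ≤ t / κ.real (ball (3 / 2 * ζ) r) * (j * r * κ.real (ball (3 / 2 * ζ) r)) := by
              gcongr
          _ = t * (j * r) * (κ.real (ball (3 / 2 * ζ) r) / κ.real (ball (3 / 2 * ζ) r)) := by ring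
          _ = _ := by rw [div_self hB.ne', mul_one]
    _ = j * t * (N * r) := by
        rw [Finset.sum_const, card_nthRootsFinset_one hN, nsmul_eq_mul]; ring
    _ ≤ j * t * 1 := by gcongr
    _ = j * t := mul_one _

end Gain

/-! ### Truncated exponentials of polynomials -/

/-- The polynomial `∑_{j < p} e j x ^ (j + 1)`. -/
noncomputable def linPoly (p : ℕ) (e : ℕ → ℂ) (x : ℂ) : ℂ := ∑ j ∈ Finset.range p, e j * x ^ (j + 1)

/-- The Taylor polynomial of degree `p` of `exp`, evaluated at `linPoly p e x`. -/
noncomputable def truncExp (p : ℕ) (e : ℕ → ℂ) (x : ℂ) : ℂ :=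
  ∑ i ∈ Finset.range (p + 1), linPoly p e x ^ i / i.factorial

theorem linPoly_zero (p : ℕ) (e : ℕ → ℂ) : linPoly p e 0 = 0 := by simp [linPoly]

theorem truncExp_zero (p : ℕ) (e : ℕ → ℂ) : truncExp p e 0 = 1 := by
  rw [truncExp, linPoly_zero, Finset.sum_range_succ']
  simp

theorem differentiable_truncExp (p : ℕ) (e : ℕ → ℂ) : Differentiable ℂ (truncExp p e) := by
  unfold truncExp linPoly; fun_prop

theorem norm_linPoly_le {p : ℕ} {e : ℕ → ℂ} (he : ∀ j < p, ‖e j‖ ≤ 1) {x : ℂ} (hx : ‖x‖ ≤ 1 / 4) :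
    ‖linPoly p e x‖ ≤ 2 * ‖x‖ := by
  calc ‖linPoly p e x‖ ≤ ∑ j ∈ Finset.range p, ‖x‖ * (1 / 2) ^ j := by
        refine norm_sum_le_of_le _ fun j hj => ?_
        rw [norm_mul, norm_pow]
        calc ‖e j‖ * ‖x‖ ^ (j + 1) ≤ 1 * ‖x‖ ^ (j + 1) := by
              gcongr; exact he j (Finset.mem_range.1 hj)
          _ = ‖x‖ * ‖x‖ ^ j := by ring
          _ ≤ ‖x‖ * (1 / 2) ^ j := by gcongr; linarith
    _ = ‖x‖ * ∑ j ∈ Finset.range p, (1 / 2) ^ j := by rw [Finset.mul_sum]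
    _ ≤ ‖x‖ * 2 := by
        gcongr
        have := (summable_geometric_two).sum_le_tsum (Finset.range p) (fun _ _ => by positivity)
        rwa [tsum_geometric_two] at this
    _ = _ := by ring

/-- Near `0` the modulus of the truncated exponential is that of the exponential up to a factor
that is `1` to order `p`. -/
theorem norm_truncExp_le_exp {p : ℕ} {e : ℕ → ℂ} (he : ∀ j < p, ‖e j‖ ≤ 1) {x : ℂ}
    (hx : ‖x‖ ≤ 1 / 4) : ‖truncExp p e x‖ ≤
      Real.exp ((linPoly p e x).re + 6 * 2 ^ (p + 1) * ‖x‖ ^ (p + 1)) := by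
  set u := linPoly p e x with hu
  have h1 : ‖u‖ ≤ 2 * ‖x‖ := norm_linPoly_le he hx
  have h2 := Complex.exp_bound (x := u) (by linarith) (Nat.succ_pos p)
  have h3 : ((p.succ.succ : ℕ) : ℝ) * ((p.succ.factorial : ℝ) * (p.succ : ℕ))⁻¹ ≤ 2 := by
    rw [← div_eq_mul_inv, div_le_iff₀ (by positivity)]
    have : (1 : ℝ) ≤ p.succ.factorial := by exact_mod_cast Nat.succ_le_of_lt (Nat.factorial_pos _)
    push_cast
    nlinarith
  have h4 : ‖Complex.exp u - truncExp p e x‖ ≤ 2 * (2 * ‖x‖) ^ (p + 1) := by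
    calc _ ≤ _ := h2
      _ ≤ ‖u‖ ^ (p + 1) * 2 := by gcongr
      _ ≤ (2 * ‖x‖) ^ (p + 1) * 2 := by gcongr
      _ = _ := by ring
  have h5 : 1 ≤ 3 * Real.exp u.re := by
    have : Real.exp (-1) ≤ Real.exp u.re := by
      rw [Real.exp_le_exp]
      have := neg_le_of_abs_le (Complex.abs_re_le_norm u); linarith
    have h6 : Real.exp 1 ≤ 3 := by linarith [Real.exp_one_lt_d9]
    rw [Real.exp_neg] at this
    have h7 : (1 : ℝ) / 3 ≤ (Real.exp 1)⁻¹ := by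
      rw [one_div]; exact inv_anti₀ (Real.exp_pos _) h6
    linarith
  set Y := 2 * (2 * ‖x‖) ^ (p + 1) with hY
  have hY0 : 0 ≤ Y := by positivity
  calc ‖truncExp p e x‖ = ‖Complex.exp u - (Complex.exp u - truncExp p e x)‖ := by ring_nf
    _ ≤ Real.exp u.re + Y := by
        refine (norm_sub_le _ _).trans ?_
        rw [Complex.norm_exp]; linarith
    _ ≤ Real.exp u.re * (1 + 3 * Y) := by nlinarith
    _ ≤ Real.exp u.re * Real.exp (3 * Y) := by
        gcongr; linarith [Real.add_one_le_exp (3 * Y)]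
    _ = _ := by rw [← Real.exp_add, hY, mul_pow]; ring_nf

/-- The logarithm of a bound for `‖truncExp p e x‖` on `‖x‖ ≤ 8`. -/
noncomputable def truncConst (p : ℕ) : ℝ := Real.log ((1 + p) ^ (p + 1) * 8 ^ (p * p))

theorem norm_truncExp_le_max {p : ℕ} {e : ℕ → ℂ} (he : ∀ j < p, ‖e j‖ ≤ 1) {x : ℂ} {R : ℝ}
    (hR : 1 ≤ R) (hx : ‖x‖ ≤ R) : ‖truncExp p e x‖ ≤ (1 + p) ^ (p + 1) * R ^ (p * p) := by
  have h1 : ‖linPoly p e x‖ ≤ p * R ^ p := by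
    calc ‖linPoly p e x‖ ≤ ∑ j ∈ Finset.range p, R ^ p := by
          refine norm_sum_le_of_le _ fun j hj => ?_
          have hj := Finset.mem_range.1 hj
          rw [norm_mul, norm_pow]
          calc ‖e j‖ * ‖x‖ ^ (j + 1) ≤ 1 * R ^ (j + 1) := by gcongr; exact he j hj
            _ ≤ 1 * R ^ p := by gcongr; omega
            _ = _ := one_mul _
      _ = _ := by simp
  have h2 : ‖linPoly p e x‖ ≤ (1 + p) * R ^ p := h1.trans (by gcongr; linarith)
  have h3 : 1 ≤ (1 + p) * R ^ p := one_le_mul_of_one_le_of_one_le (by linarith [p.cast_nonneg (α := ℝ)]) (one_le_pow₀ hR)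
  calc ‖truncExp p e x‖ ≤ ∑ i ∈ Finset.range (p + 1), ((1 + p) * R ^ p) ^ p := by
        refine norm_sum_le_of_le _ fun i hi => ?_
        have hi := Finset.mem_range.1 hi
        rw [norm_div, norm_pow, Complex.norm_natCast]
        calc _ ≤ ‖linPoly p e x‖ ^ i := div_le_self (by positivity)
              (by exact_mod_cast Nat.succ_le_of_lt (Nat.factorial_pos _))
          _ ≤ ((1 + p) * R ^ p) ^ i := by gcongr
          _ ≤ _ := pow_le_pow_right₀ h3 (by omega)
    _ = _ := by
        rw [Finset.sum_const, Finset.card_range, nsmul_eq_mul, mul_pow, ← pow_mul]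
        push_cast; ring

theorem truncConst_nonneg (p : ℕ) : 0 ≤ truncConst p := by
  refine Real.log_nonneg (one_le_mul_of_one_le_of_one_le (one_le_pow₀ ?_) (one_le_pow₀ (by norm_num)))
  linarith [p.cast_nonneg (α := ℝ)]

theorem norm_truncExp_le_const {p : ℕ} {e : ℕ → ℂ} (he : ∀ j < p, ‖e j‖ ≤ 1) {x : ℂ}
    (hx : ‖x‖ ≤ 8) : ‖truncExp p e x‖ ≤ Real.exp (truncConst p) := by
  rw [truncConst, Real.exp_log (by positivity)]
  exact norm_truncExp_le_max he (by norm_num) hx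

theorem norm_truncExp_le_far {p : ℕ} {e : ℕ → ℂ} (he : ∀ j < p, ‖e j‖ ≤ 1) {x : ℂ}
    (hx : 8 ≤ ‖x‖) : ‖truncExp p e x‖ ≤ Real.exp (truncConst p * Real.log ‖x‖) := by
  have h0 : 0 < ‖x‖ := by linarith
  have h8 : 1 ≤ Real.log 8 := by
    rw [Real.le_log_iff_exp_le (by norm_num)]; linarith [Real.exp_one_lt_d9]
  have h1 : 1 ≤ Real.log ‖x‖ := h8.trans (Real.log_le_log (by norm_num) hx)
  refine (norm_truncExp_le_max he (by linarith) le_rfl).trans ?_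
  rw [← Real.log_le_iff_le_exp (by positivity), truncConst, Real.log_mul (by positivity)
    (by positivity), Real.log_mul (by positivity) (by positivity), Real.log_pow, Real.log_pow,
    Real.log_pow]
  have h2 : 0 ≤ ((p + 1 : ℕ) : ℝ) * Real.log (1 + p) :=
    mul_nonneg (by positivity) (Real.log_nonneg (by linarith [p.cast_nonneg (α := ℝ)]))
  have h3 : 0 ≤ ((p * p : ℕ) : ℝ) * Real.log ‖x‖ := by positivity
  nlinarith

/-! ### Discretisation -/

/-- A partition of the annulus `1 ≤ ‖w‖ < 2` into finitely many measurable cells `cell i`,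
`i < card`, the cell `cell i` being contained in the ball of radius `d` about `pt i`. -/
structure CellPartition (d : ℝ) where
  card : ℕ
  pt : ℕ → ℂ
  cell : ℕ → Set ℂ
  measurableSet_cell : ∀ i, MeasurableSet (cell i)
  disjoint : Pairwise (Function.onFun Disjoint cell)
  iUnion_cell : (⋃ i ∈ Finset.range card, cell i) = unitAnnulus
  one_le_norm : ∀ i < card, 1 ≤ ‖pt i‖
  norm_le_two : ∀ i < card, ‖pt i‖ ≤ 2
  norm_sub_lt : ∀ i < card, ∀ w ∈ cell i, ‖w - pt i‖ < d

theorem nonempty_cellPartition {d : ℝ} (hd : 0 < d) : Nonempty (CellPartition d) := by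
  have hK : IsCompact (closedBall (0 : ℂ) 2 \ ball 0 1) :=
    (isCompact_closedBall 0 2).diff isOpen_ball
  obtain ⟨t, htK, htf, hcov⟩ := hK.finite_cover_balls hd
  set T := htf.toFinset with hT
  set B := T.card
  let f := T.equivFin
  let a : ℕ → ℂ := fun i => if hi : i < B then (f.symm ⟨i, hi⟩ : ℂ) else 0
  let u : ℕ → Set ℂ := fun i => if i < B then ball (a i) d ∩ unitAnnulus else ∅
  have hu : ∀ i, MeasurableSet (u i) := fun i => by
    by_cases hi : i < B
    · simp only [u, hi, if_true]; exact measurableSet_ball.inter measurableSet_unitAnnulus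
    · simp only [u, hi, if_false]; exact MeasurableSet.empty
  have hK' : ∀ i < B, a i ∈ closedBall (0 : ℂ) 2 \ ball 0 1 := fun i hi => by
    refine htK ?_
    simp only [a, hi, dif_pos]
    exact htf.mem_toFinset.1 (f.symm ⟨i, hi⟩).2
  simp only [mem_sdiff, mem_closedBall, dist_zero_right, mem_ball, not_lt] at hK'
  refine ⟨B, a, disjointed u, fun i => MeasurableSet.disjointed hu i, disjoint_disjointed u, ?_,
    fun i hi => (hK' i hi).2, fun i hi => (hK' i hi).1, ?_⟩
  · have h1 : (⋃ i ∈ Finset.range B, disjointed u i) = ⋃ i, disjointed u i := by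
      refine subset_antisymm (iUnion₂_subset fun i _ => subset_iUnion _ i) (iUnion_subset fun i => ?_)
      by_cases hi : i < B
      · exact subset_iUnion₂_of_subset i (Finset.mem_range.2 hi) subset_rfl
      · intro w hw
        have := disjointed_subset u i hw
        simp [u, hi] at this
    rw [h1, iUnion_disjointed]
    refine subset_antisymm (iUnion_subset fun i => ?_) fun w hw => ?_
    · by_cases hi : i < B
      · simp only [u, hi, if_true]; exact inter_subset_right
      · simp [u, hi]
    · have hw' := mem_unitAnnulus.1 hw
      have hwK : w ∈ closedBall (0 : ℂ) 2 \ ball 0 1 := by simp [hw'.1, hw'.2.le]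
      obtain ⟨x, hx, hwx⟩ := mem_iUnion₂.1 (hcov hwK)
      have hxT : x ∈ T := htf.mem_toFinset.2 hx
      refine mem_iUnion.2 ⟨f ⟨x, hxT⟩, ?_⟩
      have ha : a (f ⟨x, hxT⟩) = x := by
        have : ((f ⟨x, hxT⟩ : Fin _) : ℕ) < B := (f ⟨x, hxT⟩).2
        simp only [a, this, dif_pos, Fin.eta, Equiv.symm_apply_apply]
      have hlt : ((f ⟨x, hxT⟩ : Fin _) : ℕ) < B := (f ⟨x, hxT⟩).2
      simp only [u, hlt, if_true, ha]
      exact ⟨hwx, hw⟩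
  · intro i hi w hw
    have := disjointed_subset u i hw
    simp only [u, hi, if_true] at this
    simpa [dist_eq_norm] using this.1

namespace CellPartition

variable {d c : ℝ} {κ ν : Measure ℂ}

/-- The number of zeros placed in a cell: the integer part of its mass. -/
noncomputable def count (P : CellPartition d) (ν : Measure ℂ) (i : ℕ) : ℕ := ⌊ν.real (P.cell i)⌋₊

/-- The polynomial with `count i` zeros at the reference point of each cell. -/
noncomputable def poly (P : CellPartition d) (ν : Measure ℂ) (z : ℂ) : ℂ :=
  ∏ i ∈ Finset.range P.card, (1 - z / P.pt i) ^ P.count ν i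

theorem poly_zero (P : CellPartition d) (ν : Measure ℂ) : P.poly ν 0 = 1 := by simp [poly]

theorem differentiable_poly (P : CellPartition d) (ν : Measure ℂ) :
    Differentiable ℂ (P.poly ν) := by
  unfold poly
  fun_prop

theorem cell_subset (P : CellPartition d) {i : ℕ} (hi : i < P.card) : P.cell i ⊆ unitAnnulus := by
  rw [← P.iUnion_cell]
  exact subset_iUnion₂_of_subset i (Finset.mem_range.2 hi) subset_rfl

theorem isFiniteMeasure_of_le (h : IsDoublingWith c κ) (hν : ν ≤ κ.restrict unitAnnulus) :
    IsFiniteMeasure ν := by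
  refine ⟨(hν univ).trans_lt ?_⟩
  rw [Measure.restrict_apply_univ]
  exact (measure_mono sdiff_subset).trans_lt (h.lt_top 0 2)

theorem real_univ_le (h : IsDoublingWith c κ) (hν : ν ≤ κ.restrict unitAnnulus) :
    ν.real univ ≤ κ.real (ball 0 2) := by
  refine ENNReal.toReal_mono (h.lt_top 0 2).ne ((hν univ).trans ?_)
  rw [Measure.restrict_apply_univ]
  exact measure_mono sdiff_subset

theorem ae_mem (hν : ν ≤ κ.restrict unitAnnulus) : ∀ᵐ w ∂ν, w ∈ unitAnnulus :=
  (Measure.absolutelyContinuous_of_le hν).ae_le (ae_restrict_mem measurableSet_unitAnnulus)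

theorem restrict_eq (hν : ν ≤ κ.restrict unitAnnulus) : ν.restrict unitAnnulus = ν :=
  Measure.restrict_eq_self_of_ae_mem (ae_mem hν)

theorem integral_eq_sum (P : CellPartition d) (hν : ν ≤ κ.restrict unitAnnulus) {E : Type*}
    [NormedAddCommGroup E] [NormedSpace ℝ E] {f : ℂ → E} (hf : Integrable f ν) :
    ∫ w, f w ∂ν = ∑ i ∈ Finset.range P.card, ∫ w in P.cell i, f w ∂ν := by
  conv_lhs => rw [← restrict_eq hν, ← P.iUnion_cell]
  exact integral_biUnion_finset _ (fun i _ => P.measurableSet_cell i)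
    (fun i _ j _ hij => P.disjoint hij) (fun i _ => hf.integrableOn)

theorem sum_real_cell (P : CellPartition d) [IsFiniteMeasure ν]
    (hν : ν ≤ κ.restrict unitAnnulus) :
    ∑ i ∈ Finset.range P.card, ν.real (P.cell i) = ν.real univ := by
  have := P.integral_eq_sum hν (integrable_const (1 : ℝ))
  simpa using this.symm

/-- Comparison of a weighted sum over the cells with an integral. Here `e₁` bounds the oscillation
over a cell, and `e₂` bounds the loss due to the fractional parts of the masses. -/
theorem sum_count_mul_le (P : CellPartition d) (h : IsDoublingWith c κ)
    (hν : ν ≤ κ.restrict unitAnnulus) {f : ℂ → ℝ} (hf : Integrable f ν) (g : ℕ → ℝ) {e₁ e₂ : ℝ}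
    (he₁ : 0 ≤ e₁) (he₂ : 0 ≤ e₂) (hg : ∀ i < P.card, -e₂ ≤ g i)
    (hgf : ∀ i < P.card, ∀ w ∈ P.cell i, g i ≤ f w + e₁) :
    ∑ i ∈ Finset.range P.card, P.count ν i * g i ≤
      ∫ w, f w ∂ν + e₁ * κ.real (ball 0 2) + e₂ * P.card := by
  have := isFiniteMeasure_of_le h hν
  have h1 : ∀ i ∈ Finset.range P.card, P.count ν i * g i ≤
      ∫ w in P.cell i, f w ∂ν + e₁ * ν.real (P.cell i) + e₂ := by
    intro i hi
    have hi := Finset.mem_range.1 hi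
    have h2 : (P.count ν i : ℝ) ≤ ν.real (P.cell i) := Nat.floor_le measureReal_nonneg
    have h3 : ν.real (P.cell i) < P.count ν i + 1 := Nat.lt_floor_add_one _
    have h4 : ν.real (P.cell i) * g i ≤ ∫ w in P.cell i, f w ∂ν + e₁ * ν.real (P.cell i) := by
      calc ν.real (P.cell i) * g i = ∫ w in P.cell i, g i ∂ν := by simp
        _ ≤ ∫ w in P.cell i, (f w + e₁) ∂ν :=
            setIntegral_mono_on (integrable_const _).integrableOn
              (hf.add (integrable_const _)).integrableOn (P.measurableSet_cell i) (hgf i hi)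
        _ = _ := by
            rw [integral_add hf.integrableOn (integrable_const _)]
            simp [mul_comm]
    have h5 := hg i hi
    nlinarith
  refine (Finset.sum_le_sum h1).trans ?_
  rw [Finset.sum_add_distrib, Finset.sum_add_distrib, ← Finset.mul_sum, P.sum_real_cell hν,
    ← P.integral_eq_sum hν hf, Finset.sum_const, Finset.card_range, nsmul_eq_mul, mul_comm _ e₂]
  have := real_univ_le h hν
  gcongr

theorem integrable_of_le (hν : ν ≤ κ.restrict unitAnnulus) {E : Type*} [NormedAddCommGroup E]
    {f : ℂ → E} (hf : IntegrableOn f unitAnnulus κ) : Integrable f ν :=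
  Integrable.mono_measure hf hν

/-- Bound for `‖P.poly ν z‖` for large `z`. -/
theorem norm_poly_le_far (P : CellPartition d) (h : IsDoublingWith c κ)
    (hν : ν ≤ κ.restrict unitAnnulus) (hd : 0 ≤ d) {z : ℂ} (hz : 8 ≤ ‖z‖) :
    ‖P.poly ν z‖ ≤ Real.exp (∫ w, Real.log ‖1 - z / w‖ ∂ν + 2 * d * κ.real (ball 0 2)) := by
  have hlog : 0 ≤ Real.log ‖z‖ := Real.log_nonneg (by linarith)
  have hne : ∀ w : ℂ, 1 ≤ ‖w‖ → ‖w‖ ≤ 2 → 6 ≤ ‖w - z‖ ∧ w ≠ 0 := fun w h1 h2 => by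
    have := norm_sub_norm_le z w
    rw [norm_sub_rev] at this
    exact ⟨by linarith, norm_pos_iff.1 (by linarith)⟩
  have hl : ∀ w : ℂ, 1 ≤ ‖w‖ → ‖w‖ ≤ 2 →
      Real.log ‖1 - z / w‖ = Real.log ‖w - z‖ - Real.log ‖w‖ := fun w h1 h2 => by
    obtain ⟨h3, h4⟩ := hne w h1 h2
    have e : 1 - z / w = (w - z) / w := by field_simp
    rw [e, norm_div, Real.log_div (by linarith) (by linarith)]
  have key := P.sum_count_mul_le h hν (f := fun w => Real.log ‖1 - z / w‖)
    (integrable_of_le hν (h.integrableOn_log_unitAnnulus z))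
    (fun i => Real.log ‖1 - z / P.pt i‖) (e₁ := 2 * d) (e₂ := 0) (by positivity) le_rfl
    (fun i hi => by
      have := log_norm_le_log_one_sub_div hz (P.one_le_norm i hi) (P.norm_le_two i hi)
      linarith)
    (fun i hi w hw => by
      have hw' := mem_unitAnnulus.1 (P.cell_subset hi hw)
      have ha1 := P.one_le_norm i hi
      have ha2 := P.norm_le_two i hi
      rw [hl w hw'.1 hw'.2.le, hl _ ha1 ha2]
      have hwa := (P.norm_sub_lt i hi w hw).le
      have h6 := (hne w hw'.1 hw'.2.le).1
      have h7 := (hne _ ha1 ha2).1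
      have h8 : Real.log ‖P.pt i - z‖ - Real.log ‖w - z‖ ≤ d := by
        rw [← Real.log_div (by linarith) (by linarith)]
        refine (Real.log_le_sub_one_of_pos (div_pos (by linarith) (by linarith))).trans ?_
        rw [div_sub_one (by linarith), div_le_iff₀ (by linarith)]
        have := norm_sub_le_norm_sub_add_norm_sub (P.pt i) w z
        rw [norm_sub_rev (P.pt i) w] at this
        nlinarith
      have h9 : Real.log ‖w‖ - Real.log ‖P.pt i‖ ≤ d := by
        rw [← Real.log_div (by linarith) (by linarith)]
        refine (Real.log_le_sub_one_of_pos (div_pos (by linarith) (by linarith))).trans ?_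
        rw [div_sub_one (by linarith), div_le_iff₀ (by linarith)]
        have := norm_sub_norm_le w (P.pt i)
        nlinarith
      linarith)
  rw [zero_mul, add_zero] at key
  refine le_trans (le_of_eq ?_) (Real.exp_le_exp.2 key)
  rw [poly, norm_prod, Real.exp_sum]
  refine Finset.prod_congr rfl fun i hi => ?_
  have hi := Finset.mem_range.1 hi
  have := log_norm_le_log_one_sub_div hz (P.one_le_norm i hi) (P.norm_le_two i hi)
  have hpos : 0 < ‖1 - z / P.pt i‖ := by
    have h4 := (hne _ (P.one_le_norm i hi) (P.norm_le_two i hi))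
    have e : 1 - z / P.pt i = (P.pt i - z) / P.pt i := by have := h4.2; field_simp
    rw [e, norm_div]
    exact div_pos (by linarith [h4.1]) (norm_pos_iff.2 h4.2)
  rw [norm_pow, Real.exp_nat_mul, Real.exp_log hpos]

/-- Bound for `‖P.poly ν z‖` for bounded `z`. The error consists of the oscillation over the cells
of the truncated kernel `log (max ‖1 - z / w‖ s)`, of the fractional parts, and of the mass near `z`,
where the kernel has been truncated. -/
theorem norm_poly_le_mid (P : CellPartition d) (h : IsDoublingWith c κ)
    (hν : ν ≤ κ.restrict unitAnnulus) (hd : 0 ≤ d) {m : ℕ} {z : ℂ} (hz : ‖z‖ ≤ 8) :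
    ‖P.poly ν z‖ ≤ Real.exp (∫ w, Real.log ‖1 - z / w‖ ∂ν +
      (8 * d * 2 ^ m + c ^ 7 * revRatio c ^ m) * κ.real (ball 0 2) + m * P.card) := by
  set s : ℝ := 1 / 2 ^ m with hs
  have hc := h.one_le
  have hs0 : 0 < s := by positivity
  have hs1 : s ≤ 1 := by rw [hs, div_le_one (by positivity)]; exact one_le_pow₀ one_le_two
  have hlogs : -(m : ℝ) ≤ Real.log s := by
    rw [hs, one_div, Real.log_inv, Real.log_pow]
    have : Real.log 2 ≤ 1 := by linarith [Real.log_two_lt_d9]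
    have := mul_le_mul_of_nonneg_left this (Nat.cast_nonneg (α := ℝ) m)
    linarith
  have := isFiniteMeasure_of_le h hν
  have hi1 : IntegrableOn (fun w => Real.log (2 * s / ‖w - z‖)) (ball z (2 * s)) κ :=
    h.integrableOn_log_div z (by positivity)
  have hmax : Measurable fun w : ℂ => Real.log (max ‖1 - z / w‖ s) := by fun_prop
  have hle9 : ∀ w ∈ unitAnnulus, ‖1 - z / w‖ ≤ 9 := fun w hw => by
    refine (norm_sub_le _ _).trans ?_
    have := norm_div_le_of_one_le z (mem_unitAnnulus.1 hw).1
    rw [norm_one]; linarith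
  have hf : Integrable (fun w => Real.log (max ‖1 - z / w‖ s)) ν := by
    refine Integrable.of_bound hmax.aestronglyMeasurable (m + 9) ?_
    filter_upwards [ae_mem hν] with w hw
    have h1 : Real.log s ≤ Real.log (max ‖1 - z / w‖ s) :=
      Real.log_le_log hs0 (le_max_right _ _)
    have h2 := Real.log_le_sub_one_of_pos (x := max ‖1 - z / w‖ s) (lt_max_of_lt_right hs0)
    have h3 : max ‖1 - z / w‖ s ≤ 9 := max_le (hle9 w hw) (by linarith)
    rw [Real.norm_eq_abs, abs_le]
    have : (0 : ℝ) ≤ m := Nat.cast_nonneg m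
    constructor <;> linarith
  have key := P.sum_count_mul_le h hν hf
    (fun i => Real.log (max ‖1 - z / P.pt i‖ s)) (e₁ := 8 * d * 2 ^ m) (e₂ := m) (by positivity)
    (by positivity)
    (fun i hi => hlogs.trans (Real.log_le_log hs0 (le_max_right _ _)))
    (fun i hi w hw => by
      have hw' := mem_unitAnnulus.1 (P.cell_subset hi hw)
      have hwa := (P.norm_sub_lt i hi w hw).le
      have h1 : max ‖1 - z / P.pt i‖ s ≤ max ‖1 - z / w‖ s + 8 * d := by
        refine max_le ?_ ((le_max_right _ _).trans (by linarith))
        have h2 := norm_div_sub_div_le z (P.one_le_norm i hi) hw'.1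
        have h3 : ‖1 - z / P.pt i‖ ≤ ‖1 - z / w‖ + ‖z / w - z / P.pt i‖ := by
          refine le_trans (le_of_eq ?_) (norm_add_le _ _); congr 1; ring
        have h4 : ‖z‖ * ‖w - P.pt i‖ ≤ 8 * d := by gcongr
        have := le_max_left ‖1 - z / w‖ s
        linarith
      have hp : 0 < max ‖1 - z / w‖ s := lt_max_of_lt_right hs0
      have hp' : 0 < max ‖1 - z / P.pt i‖ s := lt_max_of_lt_right hs0
      have h5 : Real.log (max ‖1 - z / P.pt i‖ s) - Real.log (max ‖1 - z / w‖ s) ≤ 8 * d * 2 ^ m := by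
        rw [← Real.log_div hp'.ne' hp.ne']
        refine (Real.log_le_sub_one_of_pos (by positivity)).trans ?_
        rw [div_sub_one hp.ne', div_le_iff₀ hp]
        have h6 : s ≤ max ‖1 - z / w‖ s := le_max_right _ _
        have h7 : 8 * d = 8 * d * 2 ^ m * s := by rw [hs]; field_simp
        have h8 : 8 * d * 2 ^ m * s ≤ 8 * d * 2 ^ m * max ‖1 - z / w‖ s := by gcongr
        linarith
      linarith)
  have hcompare : ∫ w, Real.log (max ‖1 - z / w‖ s) ∂ν ≤ ∫ w, Real.log ‖1 - z / w‖ ∂ν +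
      c ^ 7 * revRatio c ^ m * κ.real (ball 0 2) := by
    have hi2 : Integrable ((ball z (2 * s)).indicator fun w => Real.log (2 * s / ‖w - z‖)) ν :=
      ((integrable_indicator_iff measurableSet_ball).2 hi1).mono_measure
        (hν.trans Measure.restrict_le_self)
    have hi3 := integrable_of_le hν (h.integrableOn_log_unitAnnulus z)
    have hnn : ∀ w, 0 ≤ (ball z (2 * s)).indicator (fun w => Real.log (2 * s / ‖w - z‖)) w :=
      fun w => indicator_nonneg (fun w hw => IsDoublingWith.log_div_nonneg hw) w
    have h1 : ∫ w, Real.log (max ‖1 - z / w‖ s) ∂ν ≤ ∫ w, (Real.log ‖1 - z / w‖ +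
        (ball z (2 * s)).indicator (fun w => Real.log (2 * s / ‖w - z‖)) w) ∂ν := by
      refine integral_mono_ae hf (hi3.add hi2) ?_
      filter_upwards [ae_mem hν] with w hw
      have hw' := mem_unitAnnulus.1 hw
      have hw0 : w ≠ 0 := norm_pos_iff.1 (by linarith)
      rcases le_or_gt s ‖1 - z / w‖ with h2 | h2
      · rw [max_eq_left h2]; linarith [hnn w]
      · rw [max_eq_right h2.le]
        have e : 1 - z / w = (w - z) / w := by field_simp
        rw [e, norm_div, div_lt_iff₀ (by linarith)] at h2
        have hmem : w ∈ ball z (2 * s) := by rw [mem_ball, dist_eq_norm]; nlinarith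
        rw [indicator_of_mem hmem]
        rcases eq_or_ne w z with rfl | hne
        · have : Real.log s ≤ 0 := Real.log_nonpos hs0.le hs1
          simpa [div_self hw0] using this
        · have hne' : 0 < ‖w - z‖ := norm_pos_iff.2 (sub_ne_zero.2 hne)
          have hlw : Real.log ‖w‖ ≤ Real.log 2 := Real.log_le_log (by linarith) hw'.2.le
          rw [e, norm_div, Real.log_div hne'.ne' (by linarith), Real.log_div (by positivity) hne'.ne',
            Real.log_mul (by norm_num) hs0.ne']
          linarith
    rw [integral_add hi3 hi2] at h1
    refine h1.trans (add_le_add le_rfl ?_)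
    calc ∫ w, (ball z (2 * s)).indicator (fun w => Real.log (2 * s / ‖w - z‖)) w ∂ν
        ≤ ∫ w, (ball z (2 * s)).indicator (fun w => Real.log (2 * s / ‖w - z‖)) w ∂κ :=
          integral_mono_measure (hν.trans Measure.restrict_le_self)
            (Filter.Eventually.of_forall hnn) ((integrable_indicator_iff measurableSet_ball).2 hi1)
      _ = ∫ w in ball z (2 * s), Real.log (2 * s / ‖w - z‖) ∂κ :=
          integral_indicator measurableSet_ball
      _ ≤ c ^ 3 * κ.real (ball z (2 * s)) := h.integral_log_div_le z (by positivity)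
      _ ≤ c ^ 3 * (revRatio c ^ m * (c ^ 4 * κ.real (ball 0 2))) := by
          have hq := h.revRatio_nonneg
          have h2 := h.real_ball_div_le m z (r := 2) (by norm_num)
          have e : 2 * s = 2 / 2 ^ m := by rw [hs]; ring
          rw [e]
          gcongr
          refine h2.trans ?_
          gcongr
          exact h.le_of_subset 4 (by norm_num) (by rw [dist_zero_right]; norm_num; linarith)
      _ = _ := by ring
  have key2 : ∑ i ∈ Finset.range P.card, P.count ν i * Real.log (max ‖1 - z / P.pt i‖ s) ≤
      ∫ w, Real.log ‖1 - z / w‖ ∂ν +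
      (8 * d * 2 ^ m + c ^ 7 * revRatio c ^ m) * κ.real (ball 0 2) + m * P.card := by
    linarith
  refine le_trans ?_ (Real.exp_le_exp.2 key2)
  rw [poly, norm_prod, Real.exp_sum]
  refine Finset.prod_le_prod (fun _ _ => norm_nonneg _) fun i hi => ?_
  rw [norm_pow, Real.exp_nat_mul, Real.exp_log (lt_max_of_lt_right hs0)]
  exact pow_le_pow_left₀ (norm_nonneg _) (le_max_left _ _) _

/-- Near `0` the polynomial has the size of the exponential of its first moments. -/
theorem norm_poly_le_near (P : CellPartition d) (h : IsDoublingWith c κ)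
    (hν : ν ≤ κ.restrict unitAnnulus) (hd : 0 ≤ d) (p : ℕ) {z : ℂ} (hz : ‖z‖ ≤ 1 / 2) :
    ‖P.poly ν z‖ ≤ Real.exp (∫ w, logRem p (z / w) ∂ν -
      ∑ i ∈ Finset.range P.card, P.count ν i * (logPoly p (z / P.pt i)).re +
      2 * (d * κ.real (ball 0 2) + P.card) * ‖z‖ ^ (p + 1)) := by
  have key := P.sum_count_mul_le h hν (integrable_of_le hν (h.integrableOn_logRem p hz))
    (fun i => logRem p (z / P.pt i)) (e₁ := 2 * ‖z‖ ^ (p + 1) * d) (e₂ := 2 * ‖z‖ ^ (p + 1))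
    (by positivity) (by positivity)
    (fun i hi => by
      have h1 := norm_div_le_of_one_le z (P.one_le_norm i hi)
      have h2 := abs_logRem_le p (h1.trans hz)
      have h3 : ‖z / P.pt i‖ ^ (p + 1) ≤ ‖z‖ ^ (p + 1) := pow_le_pow_left₀ (norm_nonneg _) h1 _
      have := neg_abs_le (logRem p (z / P.pt i))
      linarith)
    (fun i hi w hw => by
      have hw' := mem_unitAnnulus.1 (P.cell_subset hi hw)
      have h1 := abs_logRem_div_sub_le p hz (P.one_le_norm i hi) hw'.1
      have h2 : 2 * ‖z‖ ^ (p + 1) * ‖w - P.pt i‖ ≤ 2 * ‖z‖ ^ (p + 1) * d := by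
        gcongr; exact (P.norm_sub_lt i hi w hw).le
      have := neg_abs_le (logRem p (z / w) - logRem p (z / P.pt i))
      linarith)
  have e : ∑ i ∈ Finset.range P.card, P.count ν i * Real.log ‖1 - z / P.pt i‖ =
      ∑ i ∈ Finset.range P.card, P.count ν i * logRem p (z / P.pt i) -
      ∑ i ∈ Finset.range P.card, P.count ν i * (logPoly p (z / P.pt i)).re := by
    rw [← Finset.sum_sub_distrib]
    refine Finset.sum_congr rfl fun i _ => ?_
    rw [logRem]; ring
  have e2 : ‖P.poly ν z‖ =
      Real.exp (∑ i ∈ Finset.range P.card, P.count ν i * Real.log ‖1 - z / P.pt i‖) := by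
    rw [poly, norm_prod, Real.exp_sum]
    refine Finset.prod_congr rfl fun i hi => ?_
    have hi := Finset.mem_range.1 hi
    have h1 := norm_div_le_of_one_le z (P.one_le_norm i hi)
    have h2 := norm_sub_norm_le (1 : ℂ) (z / P.pt i)
    rw [norm_one] at h2
    rw [norm_pow, Real.exp_nat_mul, Real.exp_log (by linarith)]
  rw [e2, e, Real.exp_le_exp]
  linarith

/-- The negative moments of `ν` and of the zero counting measure are close. -/
theorem norm_moment_sub_le (P : CellPartition d) (h : IsDoublingWith c κ)
    (hν : ν ≤ κ.restrict unitAnnulus) (hd : 0 ≤ d) {j : ℕ} (hj : 0 < j) :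
    ‖∫ w, (w⁻¹) ^ j ∂ν - ∑ i ∈ Finset.range P.card, P.count ν i * ((P.pt i)⁻¹) ^ j‖ ≤
      j * (d * κ.real (ball 0 2) + P.card) := by
  have := isFiniteMeasure_of_le h hν
  have hf := integrable_of_le hν (h.integrableOn_inv_pow j)
  rw [P.integral_eq_sum hν hf, ← Finset.sum_sub_distrib]
  have hj1 : (1 : ℝ) ≤ j := by exact_mod_cast hj
  calc _ ≤ ∑ i ∈ Finset.range P.card, (j * d * ν.real (P.cell i) + 1) := by
        refine norm_sum_le_of_le _ fun i hi => ?_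
        have hi := Finset.mem_range.1 hi
        have h2 : (P.count ν i : ℝ) ≤ ν.real (P.cell i) := Nat.floor_le measureReal_nonneg
        have h3 : ν.real (P.cell i) < P.count ν i + 1 := Nat.lt_floor_add_one _
        have e : ∫ w in P.cell i, (w⁻¹) ^ j ∂ν - P.count ν i * ((P.pt i)⁻¹) ^ j =
            ∫ w in P.cell i, ((w⁻¹) ^ j - ((P.pt i)⁻¹) ^ j) ∂ν +
            ((ν.real (P.cell i) - P.count ν i : ℝ) : ℂ) * ((P.pt i)⁻¹) ^ j := by
          rw [integral_sub hf.integrableOn (integrable_const _)]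
          simp only [integral_const, MeasurableSet.univ, measureReal_restrict_apply, univ_inter,
            Complex.real_smul]
          push_cast; ring
        rw [e]
        refine (norm_add_le _ _).trans (add_le_add ?_ ?_)
        · exact norm_setIntegral_le_of_norm_le_const (measure_lt_top _ _) fun w hw => by
            have hw' := mem_unitAnnulus.1 (P.cell_subset hi hw)
            refine (norm_inv_pow_sub_le (P.one_le_norm i hi) hw'.1 j).trans ?_
            gcongr
            exact (P.norm_sub_lt i hi w hw).le
        · rw [norm_mul, norm_pow, norm_inv, Complex.norm_real, Real.norm_of_nonneg (by linarith)]
          have : (‖P.pt i‖⁻¹) ^ j ≤ 1 :=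
            pow_le_one₀ (by positivity) (inv_le_one_of_one_le₀ (P.one_le_norm i hi))
          nlinarith
    _ = j * d * ν.real univ + P.card := by
        rw [Finset.sum_add_distrib, ← Finset.mul_sum, P.sum_real_cell hν]; simp
    _ ≤ j * d * κ.real (ball 0 2) + j * P.card := by
        have := real_univ_le h hν
        gcongr
        exact le_mul_of_one_le_left (by positivity) hj1
    _ = _ := by ring

end CellPartition

/-! ### Approximation at one scale -/

section Scale

variable {c : ℝ} {κ : Measure ℂ}

theorem IsDoublingWith.integral_logPoly (h : IsDoublingWith c κ) (p : ℕ) (z : ℂ) :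
    IntegrableOn (fun w => logPoly p (z / w)) unitAnnulus κ ∧
    ∫ w in unitAnnulus, logPoly p (z / w) ∂κ = ∑ j ∈ Finset.range p,
      (∫ w in unitAnnulus, (w⁻¹) ^ (j + 1) ∂κ) * (z ^ (j + 1) / (j + 1)) := by
  have e : (fun w => logPoly p (z / w)) = fun w : ℂ => ∑ j ∈ Finset.range p,
      (w⁻¹) ^ (j + 1) * (z ^ (j + 1) / (j + 1)) := by
    funext w
    unfold logPoly
    refine Finset.sum_congr rfl fun j _ => ?_
    rw [div_eq_mul_inv z, mul_pow]; ring
  have hi : ∀ j ∈ Finset.range p, Integrable (fun w : ℂ =>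
      (w⁻¹) ^ (j + 1) * (z ^ (j + 1) / ((j : ℂ) + 1))) (κ.restrict unitAnnulus) :=
    fun j _ => (h.integrableOn_inv_pow (j + 1)).mul_const _
  constructor
  · rw [e]; exact integrable_finsetSum _ hi
  · rw [e, integral_finsetSum _ hi]
    exact Finset.sum_congr rfl fun j _ => integral_mul_const _ _

/-- Choice of the number of vertices of the gain polygon. -/
theorem exists_vertex_number (c : ℝ) (p : ℕ) {b : ℝ} (hb : 0 < b) (C : ℝ) :
    ∃ N : ℕ, p < N ∧ C ≤ N * b ∧ ∀ s r : ℝ, s = 1 / (12 * (N : ℝ) ^ 2) → r = s / (4 * N) →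
      -(Real.log (s / 5) - 2 - (c ^ 6 + 1 - Real.log r)) + C ≤ N * b := by
  have h1 : ∀ᶠ x : ℝ in Filter.atTop, Real.log x ≤ b / 10 * x := by
    filter_upwards [Real.isLittleO_log_id_atTop.bound (show 0 < b / 10 by positivity),
      Filter.eventually_ge_atTop 0] with x hx hx0
    simp only [id, Real.norm_eq_abs, abs_of_nonneg hx0] at hx
    exact (le_abs_self _).trans hx
  have h2 := tendsto_natCast_atTop_atTop (R := ℝ) |>.eventually h1
  have h3 := tendsto_natCast_atTop_atTop (R := ℝ) |>.eventually
    (Filter.eventually_ge_atTop (C / b))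
  have h4 := tendsto_natCast_atTop_atTop (R := ℝ) |>.eventually
    (Filter.eventually_ge_atTop ((Real.log 60 + Real.log 48 + c ^ 6 + 3 + C) / (b / 2)))
  obtain ⟨N, h2, h3, h4, h5⟩ := (h2.and (h3.and (h4.and (Filter.eventually_gt_atTop p)))).exists
  have hN : (0 : ℝ) < N := by exact_mod_cast (by omega : 0 < N)
  rw [div_le_iff₀ hb] at h3
  rw [div_le_iff₀ (by positivity)] at h4
  refine ⟨N, h5, h3, fun s r hs hr => ?_⟩
  have e1 : Real.log (s / 5) = -(Real.log 60 + 2 * Real.log N) := by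
    rw [hs, show 1 / (12 * (N : ℝ) ^ 2) / 5 = (60 * (N : ℝ) ^ 2)⁻¹ by field_simp; norm_num, Real.log_inv,
      Real.log_mul (by norm_num) (by positivity), Real.log_pow]
    norm_num
  have e2 : Real.log r = -(Real.log 48 + 3 * Real.log N) := by
    rw [hr, hs, show 1 / (12 * (N : ℝ) ^ 2) / (4 * N) = (48 * (N : ℝ) ^ 3)⁻¹ by field_simp; norm_num,
      Real.log_inv, Real.log_mul (by norm_num) (by positivity), Real.log_pow]
    norm_num
  rw [e1, e2]
  linarith

set_option maxHeartbeats 2000000 in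
/-- The approximation of the potential of a doubling measure on the annulus `1 ≤ ‖w‖ < 2` by the
logarithm of the modulus of a polynomial, when the measure is sufficiently large. For large `z` the
polynomial is smaller than the potential predicts by a fixed proportion `θ` of the mass, while for
bounded `z` the error is an arbitrarily small fraction `β` of this gain; near `0` the error vanishes
to a given order. -/
theorem exists_scale_approx (hc : 1 ≤ c) (p : ℕ) {β : ℝ} (hβ : 0 < β) :
    ∃ θ > 0, ∃ V₀ : ℝ, ∀ κ : Measure ℂ, IsDoublingWith c κ → V₀ ≤ κ.real (ball 0 2) →
      ∃ F : ℂ → ℂ, Differentiable ℂ F ∧ F 0 = 1 ∧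
      (∀ z, 8 ≤ ‖z‖ → ‖F z‖ ≤ Real.exp (∫ w in unitAnnulus, Real.log ‖1 - z / w‖ ∂κ -
        θ * κ.real (ball 0 2))) ∧
      (∀ z, ‖z‖ ≤ 8 → ‖F z‖ ≤ Real.exp (∫ w in unitAnnulus, Real.log ‖1 - z / w‖ ∂κ +
        β * θ * κ.real (ball 0 2))) ∧
      (∀ z, ‖z‖ ≤ 1 / 4 → ‖F z‖ ≤ Real.exp (∫ w in unitAnnulus, Real.log ‖1 - z / w‖ ∂κ +
        β * θ * κ.real (ball 0 2) * ‖z‖ ^ (p + 1))) := by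
  set Cp := truncConst p with hCp
  have hCp0 : 0 ≤ Cp := truncConst_nonneg p
  set b : ℝ := min (β / 4) (1 / 12) with hb
  have hb0 : 0 < b := by positivity
  obtain ⟨N, hpN, hN1, hN2⟩ := exists_vertex_number c p hb0 (8 + 24 * 2 ^ (p + 1) + 4 * Cp)
  have hN : 0 < N := by omega
  have hNr : (0 : ℝ) < N := by exact_mod_cast hN
  have hNone : (1 : ℝ) ≤ N := by exact_mod_cast hN
  have hbβ : (N : ℝ) * b ≤ N * (β / 4) := by gcongr; exact min_le_left _ _
  have hb12 : (N : ℝ) * b ≤ N * (1 / 12) := by gcongr; exact min_le_right _ _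
  set s : ℝ := 1 / (12 * N ^ 2) with hs
  set r : ℝ := s / (4 * N) with hr
  have hN3 := hN2 s r rfl rfl
  have hs0 : 0 < s := by positivity
  have hs1 : s ≤ 1 := by
    rw [hs, div_le_one (by positivity)]; nlinarith
  have hr0 : 0 < r := by positivity
  have hr4 : r ≤ 1 / 4 := by
    rw [hr, div_le_iff₀ (by positivity)]; linarith
  have hrN : N * r ≤ 1 := by
    rw [hr, mul_div_assoc', div_le_one (by positivity)]; nlinarith
  obtain ⟨k, hk⟩ := pow_unbounded_of_one_lt (4 / r) one_lt_two
  rw [div_lt_iff₀ hr0] at hk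
  set t₀ : ℝ := 1 / (N * c ^ k * N) with ht₀
  have hck : 0 < c ^ k := by positivity
  have ht₀0 : 0 < t₀ := by positivity
  -- the scale of truncation, and the size of the cells
  obtain ⟨m, hm⟩ : ∃ m : ℕ, c ^ 7 * revRatio c ^ m ≤ t₀ := by
    have hq0 : 0 ≤ revRatio c := by
      have : 1 / c ^ 3 ≤ 1 := by rw [div_le_one (by positivity)]; exact one_le_pow₀ hc
      unfold revRatio; linarith
    have hq1 : revRatio c < 1 := by
      have : 0 < 1 / c ^ 3 := by positivity
      unfold revRatio; linarith
    obtain ⟨m, hm⟩ := exists_pow_lt_of_lt_one (show 0 < t₀ / c ^ 7 by positivity) hq1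
    refine ⟨m, ?_⟩
    rw [lt_div_iff₀ (by positivity)] at hm
    linarith
  set d : ℝ := t₀ / (8 * 2 ^ m) with hd
  have hd0 : 0 < d := by positivity
  have hdm : 8 * d * 2 ^ m = t₀ := by rw [hd]; field_simp
  have hdt : d ≤ t₀ := by
    rw [hd]; refine div_le_self ht₀0.le ?_
    have : (1 : ℝ) ≤ 2 ^ m := one_le_pow₀ one_le_two
    linarith
  obtain ⟨P⟩ := nonempty_cellPartition hd0
  refine ⟨N * t₀ / 4, by positivity, (m * P.card + P.card + 1) / t₀, fun κ h hV => ?_⟩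
  set V := κ.real (ball 0 2) with hVdef
  rw [div_le_iff₀ ht₀0] at hV
  set t := t₀ * V with ht
  have hV0 : 0 < V := h.pos 0 2 (by norm_num)
  have ht0 : 0 < t := by positivity
  have hB0 : (0 : ℝ) ≤ P.card := Nat.cast_nonneg _
  have hmB0 : (0 : ℝ) ≤ m * P.card := by positivity
  have hmB : (m * P.card : ℝ) ≤ t := by linarith
  have hB : (P.card : ℝ) ≤ t := by linarith
  have ht1 : 1 ≤ t := by linarith
  have hdV : d * V ≤ t := by rw [ht]; gcongr
  have hballs : ∀ ζ ∈ Polynomial.nthRootsFinset N (1 : ℂ), N * t ≤ κ.real (ball (3 / 2 * ζ) r) := by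
    intro ζ hζ
    have h1 : V ≤ c ^ k * κ.real (ball (3 / 2 * ζ) r) := by
      refine h.le_of_subset k hr0 ?_
      rw [dist_comm, dist_zero_right, norm_vertex hN hζ]; linarith
    calc N * t = V / (c ^ k * N) := by rw [ht, ht₀]; field_simp
      _ ≤ V / c ^ k := by
          refine div_le_div_of_nonneg_left hV0.le hck ?_
          nlinarith
      _ ≤ _ := by rw [div_le_iff₀ hck]; linarith
  set τ := gainMeasure κ N r t with hτdef
  have hτ : τ ≤ κ.restrict unitAnnulus := gainMeasure_le h hN hr0 hr4 hballs
  set ν := κ.restrict unitAnnulus - τ with hνdef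
  have hν : ν ≤ κ.restrict unitAnnulus := Measure.sub_le
  have hτfin : IsFiniteMeasure τ := CellPartition.isFiniteMeasure_of_le h hτ
  have hadd : ν + τ = κ.restrict unitAnnulus := Measure.sub_add_cancel_of_le hτ
  have hsplit : ∀ {E : Type} [NormedAddCommGroup E] [NormedSpace ℝ E] {f : ℂ → E},
      IntegrableOn f unitAnnulus κ → ∫ w in unitAnnulus, f w ∂κ = ∫ w, f w ∂ν + ∫ w, f w ∂τ := by
    intro E _ _ f hf
    rw [← hadd, integral_add_measure (CellPartition.integrable_of_le hν hf)
      (CellPartition.integrable_of_le hτ hf)]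
  -- the moments that remain to be corrected, distributed over `L` factors
  set L : ℕ := ⌈d * V + P.card + t⌉₊ with hL
  have hL1 : d * V + P.card + t ≤ L := Nat.le_ceil _
  have hL2 : (L : ℝ) ≤ 4 * t := by
    have : (L : ℝ) < d * V + P.card + t + 1 := Nat.ceil_lt_add_one (by positivity)
    linarith
  have hL0 : (0 : ℝ) < L := by have : 0 < d * V := by positivity
                               linarith
  have hLC : (L : ℂ) ≠ 0 := by exact_mod_cast hL0.ne'
  set M : ℕ → ℂ := fun j => ∫ w in unitAnnulus, (w⁻¹) ^ j ∂κ -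
    ∑ i ∈ Finset.range P.card, P.count ν i * ((P.pt i)⁻¹) ^ j with hM
  have hMle : ∀ j : ℕ, j < p → ‖M (j + 1)‖ ≤ (j + 1 : ℕ) * L := by
    intro j hj
    have h1 := P.norm_moment_sub_le h hν hd0.le (Nat.succ_pos j)
    have h2 := norm_moment_gainMeasure_le (t := t) h hN (Nat.succ_pos j) (by omega) hr0 hr4 hrN ht0.le
    have e : M (j + 1) = (∫ w, (w⁻¹) ^ (j + 1) ∂ν -
        ∑ i ∈ Finset.range P.card, P.count ν i * ((P.pt i)⁻¹) ^ (j + 1)) +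
        ∫ w, (w⁻¹) ^ (j + 1) ∂τ := by
      rw [hM]; simp only
      rw [hsplit (h.integrableOn_inv_pow (j + 1))]; ring
    rw [e]
    calc _ ≤ _ := norm_add_le _ _
      _ ≤ (j + 1 : ℕ) * (d * V + P.card) + (j + 1 : ℕ) * t := add_le_add h1 h2
      _ = (j + 1 : ℕ) * (d * V + P.card + t) := by ring
      _ ≤ _ := by gcongr
  set e : ℕ → ℂ := fun j => -(M (j + 1) / ((j + 1 : ℕ) * L)) with he
  have hele : ∀ j < p, ‖e j‖ ≤ 1 := by
    intro j hj
    rw [he]; simp only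
    rw [norm_neg, norm_div, norm_mul, Complex.norm_natCast, Complex.norm_natCast,
      div_le_one (by positivity)]
    exact hMle j hj
  have hlin : ∀ z : ℂ, (L : ℂ) * linPoly p e z = -(∫ w in unitAnnulus, logPoly p (z / w) ∂κ) +
      ∑ i ∈ Finset.range P.card, P.count ν i * logPoly p (z / P.pt i) := by
    intro z
    have e1 : ∑ i ∈ Finset.range P.card, P.count ν i * logPoly p (z / P.pt i) =
        ∑ j ∈ Finset.range p, (∑ i ∈ Finset.range P.card,
          P.count ν i * ((P.pt i)⁻¹) ^ (j + 1)) * (z ^ (j + 1) / (j + 1)) := by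
      unfold logPoly
      simp_rw [Finset.mul_sum, Finset.sum_mul]
      rw [Finset.sum_comm]
      refine Finset.sum_congr rfl fun j _ => Finset.sum_congr rfl fun i _ => ?_
      rw [div_eq_mul_inv z, mul_pow]; ring
    rw [(h.integral_logPoly p z).2, e1, ← Finset.sum_neg_distrib, ← Finset.sum_add_distrib, linPoly,
      Finset.mul_sum]
    refine Finset.sum_congr rfl fun j _ => ?_
    have hj : (j : ℂ) + 1 ≠ 0 := Nat.cast_add_one_ne_zero j
    rw [he, hM]; simp only
    push_cast
    field_simp
    ring
  have hfactor : ∀ z, ‖P.poly ν z * truncExp p e z ^ L‖ = ‖P.poly ν z‖ * ‖truncExp p e z‖ ^ L :=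
    fun z => by rw [norm_mul, norm_pow]
  have hθV : (N : ℝ) * t₀ / 4 * V = N * t / 4 := by rw [ht]; ring
  have hβV : β * (N * t₀ / 4) * V = t * (N * (β / 4)) := by rw [ht]; ring
  refine ⟨fun z => P.poly ν z * truncExp p e z ^ L,
    (P.differentiable_poly ν).mul ((differentiable_truncExp p e).pow L), ?_, ?_, ?_, ?_⟩
  · simp only [P.poly_zero, truncExp_zero, one_pow, mul_one]
  · intro z hz
    have h1 := P.norm_poly_le_far h hν hd0.le hz
    have h2 := norm_truncExp_le_far hele hz
    have h3 := hsplit (h.integrableOn_log_unitAnnulus z)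
    have h4 := integral_log_gainMeasure_far h hN hr0 hr4 ht0.le hz
    have h8 : 1 ≤ Real.log ‖z‖ := by
      rw [Real.le_log_iff_exp_le (by linarith)]; linarith [Real.exp_one_lt_d9]
    rw [hfactor, hθV]
    calc _ ≤ Real.exp (∫ w, Real.log ‖1 - z / w‖ ∂ν + 2 * d * V) *
          Real.exp (Cp * Real.log ‖z‖) ^ L := by gcongr
      _ = Real.exp (∫ w, Real.log ‖1 - z / w‖ ∂ν + 2 * d * V + L * (Cp * Real.log ‖z‖)) := by
          rw [← Real.exp_nat_mul, ← Real.exp_add]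
      _ ≤ _ := by
        rw [Real.exp_le_exp, h3]
        have h5 : (L : ℝ) * (Cp * Real.log ‖z‖) ≤ 4 * t * (Cp * Real.log ‖z‖) := by gcongr
        have h6 : 2 * d * V ≤ 2 * t * Real.log ‖z‖ := by nlinarith
        have h7 : t * Real.log ‖z‖ * (2 + 4 * Cp) ≤ t * Real.log ‖z‖ * (N * (1 / 12)) := by
          gcongr
          have : (0 : ℝ) ≤ 24 * 2 ^ (p + 1) := by positivity
          linarith
        have h9 : t * N * 1 ≤ t * N * Real.log ‖z‖ := by gcongr
        linarith
  · intro z hz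
    have h1 := P.norm_poly_le_mid h hν hd0.le (m := m) hz
    have h2 := norm_truncExp_le_const hele hz
    have h3 := hsplit (h.integrableOn_log_unitAnnulus z)
    have h4 := integral_log_gainMeasure_ge h hN ht0.le hs hr z
    rw [hfactor, hβV]
    calc _ ≤ Real.exp (∫ w, Real.log ‖1 - z / w‖ ∂ν +
          (8 * d * 2 ^ m + c ^ 7 * revRatio c ^ m) * V + m * P.card) * Real.exp Cp ^ L := by gcongr
      _ = Real.exp (∫ w, Real.log ‖1 - z / w‖ ∂ν +
          (8 * d * 2 ^ m + c ^ 7 * revRatio c ^ m) * V + m * P.card + L * Cp) := by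
          rw [← Real.exp_nat_mul, ← Real.exp_add]
      _ ≤ _ := by
        rw [Real.exp_le_exp, h3, hdm]
        have h5 : (L : ℝ) * Cp ≤ 4 * t * Cp := by gcongr
        have h6 : (t₀ + c ^ 7 * revRatio c ^ m) * V ≤ (t₀ + t₀) * V := by gcongr
        have h7 := mul_le_mul_of_nonneg_left (hN3.trans hbβ) ht0.le
        have h8 : (0 : ℝ) ≤ t * (24 * 2 ^ (p + 1)) := by positivity
        have h9 : (t₀ + t₀) * V = 2 * t := by rw [ht]; ring
        linarith
  · intro z hz
    have h1 := P.norm_poly_le_near h hν hd0.le p (z := z) (by linarith)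
    have h2 := norm_truncExp_le_exp hele hz
    have h3 := hsplit (h.integrableOn_logRem p (z := z) (by linarith))
    have h4 := integral_logRem_gainMeasure_ge h hN hpN hr0 hr4 hrN ht0.le (z := z) (by linarith)
    have h5 : ∫ w in unitAnnulus, logRem p (z / w) ∂κ = ∫ w in unitAnnulus, Real.log ‖1 - z / w‖ ∂κ +
        (∫ w in unitAnnulus, logPoly p (z / w) ∂κ).re := by
      have hi := (h.integral_logPoly p z).1
      have e1 : (∫ w in unitAnnulus, logPoly p (z / w) ∂κ).re =
          ∫ w in unitAnnulus, (logPoly p (z / w)).re ∂κ := (integral_re hi).symm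
      rw [e1]
      exact integral_add (h.integrableOn_log_unitAnnulus z) hi.re
    have h6 := congrArg Complex.re (hlin z)
    rw [Complex.add_re, Complex.neg_re, Complex.re_sum] at h6
    simp only [← Complex.ofReal_natCast, Complex.re_ofReal_mul] at h6
    rw [hfactor, hβV]
    set Z := ‖z‖ ^ (p + 1) with hZ
    have hZ0 : 0 ≤ Z := by positivity
    calc _ ≤ Real.exp (∫ w, logRem p (z / w) ∂ν -
          ∑ i ∈ Finset.range P.card, P.count ν i * (logPoly p (z / P.pt i)).re +
          2 * (d * V + P.card) * Z) * Real.exp ((linPoly p e z).re + 6 * 2 ^ (p + 1) * Z) ^ L := by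
          gcongr
      _ = Real.exp (∫ w, logRem p (z / w) ∂ν -
          ∑ i ∈ Finset.range P.card, P.count ν i * (logPoly p (z / P.pt i)).re +
          2 * (d * V + P.card) * Z + L * ((linPoly p e z).re + 6 * 2 ^ (p + 1) * Z)) := by
          rw [← Real.exp_nat_mul, ← Real.exp_add]
      _ ≤ _ := by
        rw [Real.exp_le_exp, mul_add (L : ℝ), h6]
        have h7 : (L : ℝ) * (6 * 2 ^ (p + 1) * Z) ≤ 4 * t * (6 * 2 ^ (p + 1) * Z) := by gcongr
        have h8 : 2 * (d * V + P.card) * Z ≤ 2 * (t + t) * Z := by gcongr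
        have h9 : (t * Z) * (8 + 24 * 2 ^ (p + 1) + 4 * Cp) ≤ (t * Z) * (N * (β / 4)) := by
          gcongr; linarith
        have h10 : 0 ≤ t * Z * (4 * Cp) := by positivity
        linarith

end Scale

/-! ### Entire functions dominated by potentials -/

section Affine

variable {c : ℝ} {κ : Measure ℂ}

theorem measurable_affine (a : ℂ) (R : ℝ) : Measurable fun w : ℂ => (w - a) / R := by fun_prop

theorem preimage_affine_ball (a : ℂ) {R : ℝ} (hR : 0 < R) (z : ℂ) (r : ℝ) :
    (fun w : ℂ => (w - a) / R) ⁻¹' ball z r = ball (a + R * z) (R * r) := by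
  ext w
  have hR' : (R : ℂ) ≠ 0 := by exact_mod_cast hR.ne'
  have e : (w - a) / R - z = (w - (a + R * z)) / R := by field_simp; ring
  rw [mem_preimage, mem_ball, mem_ball, dist_eq_norm, dist_eq_norm, e, norm_div, Complex.norm_real,
    Real.norm_of_nonneg hR.le, div_lt_iff₀ hR, mul_comm R r]

theorem map_affine_ball (κ : Measure ℂ) (a : ℂ) {R : ℝ} (hR : 0 < R) (z : ℂ) (r : ℝ) :
    κ.map (fun w : ℂ => (w - a) / R) (ball z r) = κ (ball (a + R * z) (R * r)) := by
  rw [Measure.map_apply (measurable_affine a R) measurableSet_ball, preimage_affine_ball a hR]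

theorem map_affine_real_ball (κ : Measure ℂ) (a : ℂ) {R : ℝ} (hR : 0 < R) (z : ℂ) (r : ℝ) :
    (κ.map (fun w : ℂ => (w - a) / R)).real (ball z r) = κ.real (ball (a + R * z) (R * r)) := by
  rw [measureReal_def, map_affine_ball κ a hR, measureReal_def]

/-- The doubling condition is invariant under dilations and translations. -/
theorem IsDoublingWith.map_affine (h : IsDoublingWith c κ) (a : ℂ) {R : ℝ} (hR : 0 < R) :
    IsDoublingWith c (κ.map fun w : ℂ => (w - a) / R) where
  lt_top z r := by rw [map_affine_ball κ a hR]; exact h.lt_top _ _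
  pos z r hr := by rw [map_affine_real_ball κ a hR]; exact h.pos _ _ (by positivity)
  le z r hr := by
    rw [map_affine_real_ball κ a hR, map_affine_real_ball κ a hR,
      show R * (2 * r) = 2 * (R * r) by ring]
    exact h.le _ _ (by positivity)

theorem IsDoublingWith.smul (h : IsDoublingWith c κ) {b : ℝ} (hb : 0 < b) :
    IsDoublingWith c (ENNReal.ofReal b • κ) := by
  have e : ∀ s, (ENNReal.ofReal b • κ).real s = b * κ.real s := fun s => by
    rw [measureReal_ennreal_smul_apply, ENNReal.toReal_ofReal hb.le]
  refine ⟨fun z r => ?_, fun z r hr => ?_, fun z r hr => ?_⟩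
  · rw [Measure.smul_apply, smul_eq_mul]
    exact ENNReal.mul_lt_top ENNReal.ofReal_lt_top (h.lt_top z r)
  · rw [e]; have := h.pos z r hr; positivity
  · rw [e, e]
    have := mul_le_mul_of_nonneg_left (h.le z r hr) hb.le
    linarith

end Affine

section Core

variable {c : ℝ} {κ : Measure ℂ}

theorem setIntegral_dyadic (κ : Measure ℂ) (z : ℂ) (k : ℕ) :
    ∫ w in unitAnnulus, Real.log ‖1 - z / (2 ^ k : ℝ) / w‖
      ∂(κ.map fun w : ℂ => (w - 0) / (2 ^ k : ℝ)) =
    ∫ w in ball 0 (2 ^ (k + 1)) \ ball 0 (2 ^ k), Real.log ‖1 - z / w‖ ∂κ := by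
  have hR : (0 : ℝ) < 2 ^ k := by positivity
  rw [setIntegral_map measurableSet_unitAnnulus
    (by fun_prop : Measurable fun w : ℂ => Real.log ‖1 - z / (2 ^ k : ℝ) / w‖).aestronglyMeasurable
    (measurable_affine 0 _).aemeasurable, unitAnnulus, preimage_sdiff, preimage_affine_ball 0 hR,
    preimage_affine_ball 0 hR]
  simp only [sub_zero, mul_zero, add_zero, mul_one]
  rw [← pow_succ]
  refine setIntegral_congr_fun (measurableSet_ball.diff measurableSet_ball) fun w _ => ?_
  congr 3
  have : ((2 ^ k : ℝ) : ℂ) ≠ 0 := by exact_mod_cast hR.ne'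
  rcases eq_or_ne w 0 with rfl | hw
  · simp
  · field_simp

/-- The potential of the part of a doubling measure in `ball 0 (2 ^ n)`, normalised to vanish at
the origin. -/
noncomputable def pot (κ : Measure ℂ) (n : ℕ) (z : ℂ) : ℝ :=
  ∫ w in ball 0 (2 ^ n), Real.log ‖1 - z / w‖ ∂κ

theorem pot_succ (h : IsDoublingWith c κ) (n : ℕ) (z : ℂ) :
    pot κ (n + 1) z = pot κ n z +
      ∫ w in ball 0 (2 ^ (n + 1)) \ ball 0 (2 ^ n), Real.log ‖1 - z / w‖ ∂κ := by
  have hsub : ball (0 : ℂ) (2 ^ n) ⊆ ball 0 (2 ^ (n + 1)) :=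
    ball_subset_ball (pow_le_pow_right₀ one_le_two (by omega))
  have hi := h.integrableOn_log_one_sub_div z 0 (2 ^ (n + 1))
  rw [pot, pot, ← setIntegral_union disjoint_sdiff_right (measurableSet_ball.diff measurableSet_ball)
    (hi.mono_set hsub) (hi.mono_set sdiff_subset), union_sdiff_cancel hsub]

theorem pot_eq_sum (h : IsDoublingWith c κ) {k n : ℕ} (hkn : k ≤ n) (z : ℂ) :
    pot κ n z = pot κ k z + ∑ i ∈ Finset.Ico k n,
      ∫ w in ball 0 (2 ^ (i + 1)) \ ball 0 (2 ^ i), Real.log ‖1 - z / w‖ ∂κ := by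
  induction n, hkn using Nat.le_induction with
  | base => simp
  | succ n hkn ih => rw [pot_succ h, ih, Finset.sum_Ico_succ_top hkn, add_assoc]

/-- A lower bound for the potential of a bounded part of the measure. It takes care of the finitely
many scales at which the masses are too small for the construction on an annulus. -/
theorem pot_ge (h : IsDoublingWith c κ) (n : ℕ) (z : ℂ) :
    -((c ^ 3 * c ^ (n + 2) + n * c ^ n) * κ.real (ball 0 1)) ≤ pot κ n z := by
  have hc := h.one_le
  set S := ball (0 : ℂ) (2 ^ n) with hS
  have hi1 := h.integrableOn_log_norm_sub z 0 (2 ^ n)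
  have hi2 := h.integrableOn_log_norm_sub 0 0 (2 ^ n)
  have h2 : ∀ᵐ w ∂κ, w ≠ z := by
    rw [ae_iff]; simpa using h.measure_singleton z
  have h3 : ∀ᵐ w ∂κ, w ≠ 0 := by
    rw [ae_iff]; simpa using h.measure_singleton 0
  have e : pot κ n z = ∫ w in S, (Real.log ‖w - z‖ - Real.log ‖w - 0‖) ∂κ := by
    refine integral_congr_ae ?_
    filter_upwards [ae_restrict_of_ae h2, ae_restrict_of_ae h3] with w hz h0
    have e : 1 - z / w = (w - z) / w := by field_simp
    rw [e, norm_div, Real.log_div (norm_ne_zero_iff.2 (sub_ne_zero.2 hz)) (norm_ne_zero_iff.2 h0)]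
    simp
  have hVn : κ.real S ≤ c ^ n * κ.real (ball 0 1) := by
    have := h.two_pow_le n 0 one_pos
    rwa [mul_one] at this
  have hb : 0 ≤ κ.real (ball 0 1) := measureReal_nonneg
  rw [e, integral_sub hi1 hi2]
  have h4 : ∫ w in S, Real.log ‖w - 0‖ ∂κ ≤ n * c ^ n * κ.real (ball 0 1) := by
    calc ∫ w in S, Real.log ‖w - 0‖ ∂κ ≤ ∫ w in S, (n : ℝ) ∂κ := by
          refine setIntegral_mono_on hi2 (integrableOn_const (h.lt_top _ _).ne) measurableSet_ball
            fun w hw => ?_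
          rw [hS, mem_ball, dist_zero_right] at hw
          rw [sub_zero]
          rcases eq_or_ne w 0 with rfl | h0
          · simp
          calc Real.log ‖w‖ ≤ Real.log (2 ^ n) := Real.log_le_log (norm_pos_iff.2 h0) hw.le
            _ = n * Real.log 2 := Real.log_pow _ _
            _ ≤ n * 1 := by gcongr; linarith [Real.log_two_lt_d9]
            _ = n := mul_one _
      _ = κ.real S * n := by simp
      _ ≤ c ^ n * κ.real (ball 0 1) * n := by gcongr
      _ = _ := by ring
  have h5 : -(c ^ 3 * c ^ (n + 2) * κ.real (ball 0 1)) ≤ ∫ w in S, Real.log ‖w - z‖ ∂κ := by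
    have hi3 : IntegrableOn (fun w => Real.log (1 / ‖w - z‖)) (ball z 1) κ :=
      h.integrableOn_log_div z one_pos
    have hnn : ∀ w, 0 ≤ (ball z 1).indicator (fun w => Real.log (1 / ‖w - z‖)) w :=
      fun w => indicator_nonneg (fun w hw => IsDoublingWith.log_div_nonneg hw) w
    have h6 : ∫ w in S, -(ball z 1).indicator (fun w => Real.log (1 / ‖w - z‖)) w ∂κ ≤
        ∫ w in S, Real.log ‖w - z‖ ∂κ := by
      refine setIntegral_mono_on ((integrable_indicator_iff measurableSet_ball).2
        hi3).neg.integrableOn hi1 measurableSet_ball fun w _ => ?_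
      by_cases hw : w ∈ ball z 1
      · rw [indicator_of_mem hw, one_div, Real.log_inv, neg_neg]
      · rw [indicator_of_notMem hw, neg_zero]
        rw [mem_ball, dist_eq_norm, not_lt] at hw
        exact Real.log_nonneg hw
    refine le_trans ?_ h6
    rw [integral_neg, neg_le_neg_iff, setIntegral_indicator measurableSet_ball]
    rcases le_or_gt ‖z‖ (2 ^ n + 1) with hz | hz
    · calc ∫ w in S ∩ ball z 1, Real.log (1 / ‖w - z‖) ∂κ
          ≤ ∫ w in ball z 1, Real.log (1 / ‖w - z‖) ∂κ := by
            refine setIntegral_mono_set hi3 ?_ inter_subset_right.eventuallyLE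
            filter_upwards [ae_restrict_mem measurableSet_ball] with w hw
              using IsDoublingWith.log_div_nonneg hw
        _ ≤ c ^ 3 * κ.real (ball z 1) := h.integral_log_div_le z one_pos
        _ ≤ c ^ 3 * (c ^ (n + 2) * κ.real (ball 0 1)) := by
            gcongr
            refine h.le_of_subset (n + 2) one_pos ?_
            rw [dist_zero_right, pow_add]
            have : (1 : ℝ) ≤ 2 ^ n := one_le_pow₀ one_le_two
            linarith
        _ = _ := by ring
    · have : S ∩ ball z 1 = ∅ := by
        rw [← disjoint_iff_inter_eq_empty]
        exact ball_disjoint_ball (by rw [dist_zero_left]; exact hz.le)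
      rw [this]
      simp only [Measure.restrict_empty, integral_zero_measure]
      positivity
  linarith

/-- An exponential sequence dominates a linear one up to a constant. -/
theorem exists_linear_le_exp {A x : ℝ} (hA : 1 < A) (hx : 0 < x) (M : ℕ) :
    ∃ C : ℝ, ∀ j : ℕ, (M : ℝ) * (j + 5) ≤ x * A ^ j + C := by
  have h1 := tendsto_pow_const_div_const_pow_of_one_lt 1 hA
  have h2 := h1.eventually (gt_mem_nhds (show (0 : ℝ) < x / (M + 1) by positivity))
  obtain ⟨J, hJ⟩ := Filter.eventually_atTop.1 h2
  refine ⟨M * (J + 5), fun j => ?_⟩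
  have hA0 : 0 < A ^ j := by positivity
  rcases le_or_gt J j with hj | hj
  · have h3 := hJ j hj
    rw [pow_one, div_lt_div_iff₀ hA0 (by positivity)] at h3
    have : (0 : ℝ) ≤ j := Nat.cast_nonneg j
    have : (0 : ℝ) ≤ (M : ℝ) * J := by positivity
    linarith
  · have : (j : ℝ) ≤ J := by exact_mod_cast hj.le
    have h3 : (M : ℝ) * (j + 5) ≤ M * (J + 5) := by gcongr
    have : 0 < x * A ^ j := by positivity
    linarith

/-- Entire functions dominated by the potential of a doubling measure, with a gain of `M` powers of
`1 + ‖z‖`. Only `‖z‖ < 2 ^ n` matters, because `pot κ n` ignores the measure outside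
`ball 0 (2 ^ n)`; the constants depend on `κ` only through `c` and the mass of the unit disk, and
not on `n`. For `8 * 2 ^ j ≤ ‖z‖ < 16 * 2 ^ j`
the annulus of index `j` contributes the gain `θ V`, with `V` the mass of `ball 0 (2 ^ (j + 1))`, and
the errors of the larger annuli, summable by the order of vanishing at the origin, cost at most half
of it. -/
theorem exists_entire_le_exp_pot (hc : 1 ≤ c) {b : ℝ} (hb : 0 < b) (M : ℕ) :
    ∃ C : ℝ, ∃ k₀ : ℕ, ∀ κ : Measure ℂ, IsDoublingWith c κ → κ.real (ball 0 1) = b → ∀ n, k₀ ≤ n →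
      ∃ F : ℂ → ℂ, Differentiable ℂ F ∧ F 0 = 1 ∧
        ∀ z, ‖z‖ < 2 ^ n → ‖F z‖ * (1 + ‖z‖) ^ M ≤ Real.exp (pot κ n z + C) := by
  obtain ⟨p, hp⟩ := pow_unbounded_of_one_lt c one_lt_two
  set β : ℝ := 1 / (2 * 64 ^ (p + 1)) with hβ
  have hβ0 : 0 < β := by positivity
  obtain ⟨θ, hθ, V₀, hscale⟩ := exists_scale_approx hc p hβ0
  -- growth of the masses
  set A : ℝ := 1 + 1 / c ^ 3 with hA
  have hA1 : 1 < A := by have : 0 < 1 / c ^ 3 := by positivity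
                         linarith
  obtain ⟨k₀, hk₀⟩ := pow_unbounded_of_one_lt (V₀ / b) hA1
  rw [div_lt_iff₀ hb] at hk₀
  obtain ⟨C₁, hC₁⟩ := exists_linear_le_exp hA1 (show 0 < θ * b / 2 by positivity) M
  set C₂ : ℝ := (c ^ 3 * c ^ (k₀ + 2) + k₀ * c ^ k₀) * b with hC₂
  have hC₂0 : 0 ≤ C₂ := by positivity
  set C₃ : ℝ := θ * (c ^ (k₀ + 1) * b) + M * (k₀ + 5) with hC₃
  have hC₃0 : 0 ≤ C₃ := by positivity
  refine ⟨C₂ + C₃ + |C₁|, k₀, fun κ h hκb n hn => ?_⟩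
  set V : ℕ → ℝ := fun k => κ.real (ball 0 (2 ^ (k + 1))) with hV
  have hVpos : ∀ k, 0 < V k := fun k => h.pos 0 _ (by positivity)
  have hVmul : ∀ k i, V (k + i) ≤ c ^ i * V k := by
    intro k i
    have := h.two_pow_le i 0 (r := 2 ^ (k + 1)) (by positivity)
    rw [← pow_add] at this
    rw [hV]; simp only
    rwa [show k + i + 1 = i + (k + 1) by ring]
  have hVge : ∀ k, b * A ^ k ≤ V k := by
    intro k
    induction k with
    | zero =>
      rw [pow_zero, mul_one, ← hκb]
      exact h.real_mono (ball_subset_ball (by norm_num))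
    | succ k ih =>
      have h1 := h.real_ball_le 0 (r := 2 ^ (k + 1)) (by positivity)
      rw [← pow_succ'] at h1
      change V k ≤ revRatio c * V (k + 1) at h1
      have h2 : V k * A ≤ V (k + 1) := by
        have hx0 : 0 < 1 / c ^ 3 := by positivity
        calc V k * A ≤ (revRatio c * V (k + 1)) * A := by gcongr
          _ = V (k + 1) - (1 / c ^ 3) ^ 2 * V (k + 1) := by rw [hA]; unfold revRatio; ring
          _ ≤ V (k + 1) := by have := hVpos (k + 1); nlinarith [sq_nonneg (1 / c ^ 3)]
      calc b * A ^ (k + 1) = (b * A ^ k) * A := by ring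
        _ ≤ V k * A := by gcongr
        _ ≤ _ := h2
  have hVk₀ : V k₀ ≤ c ^ (k₀ + 1) * b := by
    have := h.two_pow_le (k₀ + 1) 0 one_pos
    rwa [mul_one, hκb] at this
  -- the functions at the different scales
  have hF : ∀ k, k₀ ≤ k → ∃ F : ℂ → ℂ, Differentiable ℂ F ∧ F 0 = 1 ∧
      (∀ z, 8 * 2 ^ k ≤ ‖z‖ → ‖F z‖ ≤ Real.exp
        (∫ w in ball 0 (2 ^ (k + 1)) \ ball 0 (2 ^ k), Real.log ‖1 - z / w‖ ∂κ - θ * V k)) ∧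
      (∀ z, ∀ j ≤ k, ‖z‖ < 16 * 2 ^ j → ‖F z‖ ≤ Real.exp
        (∫ w in ball 0 (2 ^ (k + 1)) \ ball 0 (2 ^ k), Real.log ‖1 - z / w‖ ∂κ +
          θ / 2 * V j * (1 / 2) ^ (k - j))) := by
    intro k hk
    have hR : (0 : ℝ) < 2 ^ k := by positivity
    have hm := map_affine_real_ball κ 0 hR 0 2
    rw [mul_zero, add_zero, ← pow_succ] at hm
    have hVk : V₀ ≤ V k := by
      refine le_trans ?_ (hVge k)
      refine hk₀.le.trans ?_
      rw [mul_comm]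
      gcongr
      exact hA1.le
    obtain ⟨F, hFd, hF0, hF1, hF2, hF3⟩ := hscale (κ.map fun w : ℂ => (w - 0) / (2 ^ k : ℝ))
      (h.map_affine 0 hR) (by rw [hm]; exact hVk)
    rw [hm] at hF1 hF2 hF3
    have hnorm : ∀ z : ℂ, ‖z / (2 ^ k : ℝ)‖ = ‖z‖ / 2 ^ k := fun z => by
      rw [norm_div, Complex.norm_real, Real.norm_of_nonneg hR.le]
    refine ⟨fun z => F (z / (2 ^ k : ℝ)), hFd.comp (differentiable_id.div_const _), ?_, ?_, ?_⟩
    · simpa using hF0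
    · intro z hz
      have := hF1 (z / (2 ^ k : ℝ)) (by rw [hnorm, le_div_iff₀ hR]; exact hz)
      rwa [setIntegral_dyadic] at this
    · intro z j hj hz
      have hVj : V k ≤ c ^ (k - j) * V j := by
        have := hVmul j (k - j)
        rwa [Nat.add_sub_cancel' hj] at this
      have hx : ‖z‖ / 2 ^ k ≤ 16 * (1 / 2) ^ (k - j) := by
        rw [div_le_iff₀ hR]
        refine hz.le.trans (le_of_eq ?_)
        have : (2 : ℝ) ^ k = 2 ^ (k - j) * 2 ^ j := by rw [← pow_add, Nat.sub_add_cancel hj]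
        rw [this, one_div, inv_pow]
        field_simp
      -- the growth of the masses is compensated by the order of vanishing
      have hsum : β * θ * V k * (64 * (1 / 2) ^ (k - j)) ^ (p + 1) ≤
          θ / 2 * V j * (1 / 2) ^ (k - j) := by
        have h1 : c ^ (k - j) * ((1 / 2 : ℝ) ^ (k - j)) ^ p ≤ 1 := by
          rw [← pow_mul, mul_comm (k - j) p, pow_mul, ← mul_pow]
          refine pow_le_one₀ (by positivity) ?_
          rw [one_div, inv_pow, ← div_eq_mul_inv, div_le_one (by positivity)]
          exact hp.le
        calc β * θ * V k * (64 * (1 / 2) ^ (k - j)) ^ (p + 1)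
            ≤ β * θ * (c ^ (k - j) * V j) * (64 * (1 / 2) ^ (k - j)) ^ (p + 1) := by gcongr
          _ = (c ^ (k - j) * ((1 / 2 : ℝ) ^ (k - j)) ^ p) * (θ / 2 * V j * (1 / 2) ^ (k - j)) := by
              rw [mul_pow, pow_succ _ p, pow_succ _ p, hβ, pow_succ]; field_simp
          _ ≤ 1 * (θ / 2 * V j * (1 / 2) ^ (k - j)) := by
              have := hVpos j
              gcongr
          _ = _ := one_mul _
      have hVk0 := hVpos k
      have key : ‖F (z / (2 ^ k : ℝ))‖ ≤ Real.exp (∫ w in unitAnnulus,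
          Real.log ‖1 - z / (2 ^ k : ℝ) / w‖ ∂(κ.map fun w : ℂ => (w - 0) / (2 ^ k : ℝ)) +
          β * θ * V k * (64 * (1 / 2) ^ (k - j)) ^ (p + 1)) := by
        rcases le_or_gt (‖z‖ / 2 ^ k) (1 / 4) with h4 | h4
        · refine (hF3 (z / (2 ^ k : ℝ)) (by rw [hnorm]; exact h4)).trans ?_
          rw [Real.exp_le_exp, hnorm]
          gcongr
          refine hx.trans ?_
          gcongr; norm_num
        · have h1 : (1 : ℝ) ≤ (64 * (1 / 2) ^ (k - j)) ^ (p + 1) := one_le_pow₀ (by linarith)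
          rcases le_or_gt (‖z‖ / 2 ^ k) 8 with h8 | h8
          · refine (hF2 (z / (2 ^ k : ℝ)) (by rw [hnorm]; exact h8)).trans ?_
            rw [Real.exp_le_exp]
            have : β * θ * V k * 1 ≤ β * θ * V k * (64 * (1 / 2) ^ (k - j)) ^ (p + 1) := by gcongr
            change _ + β * θ * V k ≤ _
            linarith
          · refine (hF1 (z / (2 ^ k : ℝ)) (by rw [hnorm]; exact h8.le)).trans ?_
            rw [Real.exp_le_exp]
            have : 0 ≤ β * θ * V k * (64 * (1 / 2) ^ (k - j)) ^ (p + 1) := by positivity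
            have : 0 ≤ θ * V k := by positivity
            change _ - θ * V k ≤ _
            linarith
      rw [setIntegral_dyadic] at key
      refine key.trans ?_
      rw [Real.exp_le_exp]
      linarith
  choose! F hFd hF0 hFfar hFnear using hF
  refine ⟨fun z => ∏ k ∈ Finset.Ico k₀ n, F k z, ?_, ?_, ?_⟩
  · exact Differentiable.fun_finsetProd fun k hk => hFd k (Finset.mem_Ico.1 hk).1
  · exact Finset.prod_eq_one fun k hk => hF0 k (Finset.mem_Ico.1 hk).1
  intro z hz
  set I : ℕ → ℝ := fun k => ∫ w in ball 0 (2 ^ (k + 1)) \ ball 0 (2 ^ k), Real.log ‖1 - z / w‖ ∂κ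
    with hI
  -- the total error of the scales from `j` on
  have hgeom : ∀ j, ∑ k ∈ Finset.Ico (j + 1) n, (1 / 2 : ℝ) ^ (k - j) ≤ 1 := by
    intro j
    rw [Finset.sum_Ico_eq_sum_range]
    have h1 : ∀ i, (1 / 2 : ℝ) ^ (j + 1 + i - j) = 1 / 2 * (1 / 2) ^ i := fun i => by
      rw [show j + 1 + i - j = i + 1 by omega, pow_succ]; ring
    simp_rw [h1]
    rw [← Finset.mul_sum]
    have := (summable_geometric_two).sum_le_tsum (Finset.range (n - (j + 1)))
      (fun _ _ => by positivity)
    rw [tsum_geometric_two] at this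
    linarith
  have htail : ∀ j, k₀ ≤ j → ‖z‖ < 16 * 2 ^ j →
      ∏ k ∈ Finset.Ico (j + 1) n, ‖F k z‖ ≤
        Real.exp (∑ k ∈ Finset.Ico (j + 1) n, I k + θ / 2 * V j) := by
    intro j hj hzj
    calc ∏ k ∈ Finset.Ico (j + 1) n, ‖F k z‖
        ≤ ∏ k ∈ Finset.Ico (j + 1) n, Real.exp (I k + θ / 2 * V j * (1 / 2) ^ (k - j)) := by
          refine Finset.prod_le_prod (fun _ _ => norm_nonneg _) fun k hk => ?_
          have := Finset.mem_Ico.1 hk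
          exact hFnear k (by omega) z j (by omega) hzj
      _ = Real.exp (∑ k ∈ Finset.Ico (j + 1) n, I k +
          θ / 2 * V j * ∑ k ∈ Finset.Ico (j + 1) n, (1 / 2) ^ (k - j)) := by
          rw [← Real.exp_sum, Finset.sum_add_distrib, ← Finset.mul_sum]
      _ ≤ _ := by
          rw [Real.exp_le_exp]
          have h1 : 0 ≤ θ / 2 * V j := by have := hVpos j; positivity
          have := mul_le_mul_of_nonneg_left (hgeom j) h1
          linarith
  have hpow : ∀ j : ℕ, ‖z‖ < 16 * 2 ^ j → (1 + ‖z‖) ^ M ≤ Real.exp (M * (j + 5)) := by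
    intro j hj
    have h1 : 1 + ‖z‖ ≤ Real.exp (j + 5) := by
      have h2 : (1 : ℝ) ≤ 2 ^ j := one_le_pow₀ one_le_two
      calc 1 + ‖z‖ ≤ 2 ^ (j + 5) := by rw [pow_add]; linarith
        _ ≤ Real.exp 1 ^ (j + 5) := by gcongr; linarith [Real.exp_one_gt_d9]
        _ = _ := by rw [← Real.exp_nat_mul]; push_cast; ring_nf
    calc (1 + ‖z‖) ^ M ≤ Real.exp (j + 5) ^ M := by gcongr
      _ = _ := by rw [← Real.exp_nat_mul]
  have hpot := pot_eq_sum h hn z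
  have hlow := pot_ge h k₀ z
  rw [hκb] at hlow
  rw [norm_prod]
  rcases lt_or_ge ‖z‖ (8 * 2 ^ k₀) with hsmall | hlarge
  · have hzk : ‖z‖ < 16 * 2 ^ k₀ := by
      have : (0 : ℝ) < 2 ^ k₀ := by positivity
      linarith
    have hall : ∏ k ∈ Finset.Ico k₀ n, ‖F k z‖ ≤
        Real.exp (∑ k ∈ Finset.Ico k₀ n, I k + θ * V k₀) := by
      rcases hn.eq_or_lt with heq | hlt
      · rw [heq]; simp only [Finset.Ico_self, Finset.prod_empty, Finset.sum_empty, zero_add]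
        exact Real.one_le_exp (by have := hVpos n; positivity)
      rw [Finset.prod_eq_prod_Ico_succ_bot hlt, Finset.sum_eq_sum_Ico_succ_bot hlt]
      have h1 := hFnear k₀ le_rfl z k₀ le_rfl hzk
      rw [Nat.sub_self, pow_zero, mul_one] at h1
      calc _ ≤ Real.exp (I k₀ + θ / 2 * V k₀) *
            Real.exp (∑ k ∈ Finset.Ico (k₀ + 1) n, I k + θ / 2 * V k₀) := by
            gcongr; exact htail k₀ le_rfl hzk
        _ = _ := by rw [← Real.exp_add]; ring_nf
    calc _ ≤ Real.exp (∑ k ∈ Finset.Ico k₀ n, I k + θ * V k₀) * Real.exp (M * (k₀ + 5)) := by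
          gcongr
          exact hpow k₀ hzk
      _ = Real.exp (∑ k ∈ Finset.Ico k₀ n, I k + θ * V k₀ + M * (k₀ + 5)) := by
          rw [← Real.exp_add]
      _ ≤ _ := by
          rw [Real.exp_le_exp, hpot]
          have h1 : θ * V k₀ ≤ θ * (c ^ (k₀ + 1) * b) := by gcongr
          have := abs_nonneg C₁
          linarith
  · obtain ⟨i, hi1, hi2⟩ := exists_nat_pow_near (x := ‖z‖ / (8 * 2 ^ k₀)) (y := 2)
      ((one_le_div (by positivity)).2 hlarge) one_lt_two
    rw [le_div_iff₀ (by positivity)] at hi1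
    rw [div_lt_iff₀ (by positivity)] at hi2
    set j := k₀ + i with hj
    have hj1 : 8 * 2 ^ j ≤ ‖z‖ := by rw [hj, pow_add]; linarith
    have hj2 : ‖z‖ < 16 * 2 ^ j := by rw [hj, pow_add]; rw [pow_succ] at hi2; linarith
    have hjn : j < n := by
      have h1 : (2 : ℝ) ^ j < 2 ^ n := by
        have : (0 : ℝ) < 2 ^ j := by positivity
        linarith
      exact (pow_lt_pow_iff_right₀ one_lt_two).1 h1
    have hjk : k₀ ≤ j := by omega
    have hhead : ∏ k ∈ Finset.Ico k₀ j, ‖F k z‖ ≤ Real.exp (∑ k ∈ Finset.Ico k₀ j, I k) := by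
      rw [Real.exp_sum]
      refine Finset.prod_le_prod (fun _ _ => norm_nonneg _) fun k hk => ?_
      obtain ⟨hk1, hk2⟩ := Finset.mem_Ico.1 hk
      have h1 : (2 : ℝ) ^ k ≤ 2 ^ j := pow_le_pow_right₀ one_le_two hk2.le
      refine (hFfar k hk1 z (by linarith)).trans ?_
      rw [Real.exp_le_exp]
      have : 0 ≤ θ * V k := by have := hVpos k; positivity
      change I k - θ * V k ≤ I k
      linarith
    have hmid : ‖F j z‖ ≤ Real.exp (I j - θ * V j) := hFfar j hjk z hj1
    have htl := htail j hjk hj2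
    have e1 : ∏ k ∈ Finset.Ico k₀ n, ‖F k z‖ = (∏ k ∈ Finset.Ico k₀ j, ‖F k z‖) *
        (‖F j z‖ * ∏ k ∈ Finset.Ico (j + 1) n, ‖F k z‖) := by
      rw [← Finset.prod_eq_prod_Ico_succ_bot hjn (fun k => ‖F k z‖),
        Finset.prod_Ico_consecutive _ hjk hjn.le]
    have e2 : ∑ k ∈ Finset.Ico k₀ n, I k = ∑ k ∈ Finset.Ico k₀ j, I k +
        (I j + ∑ k ∈ Finset.Ico (j + 1) n, I k) := by
      rw [← Finset.sum_eq_sum_Ico_succ_bot hjn (fun k => I k),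
        Finset.sum_Ico_consecutive _ hjk hjn.le]
    rw [e1]
    calc _ ≤ (Real.exp (∑ k ∈ Finset.Ico k₀ j, I k) * (Real.exp (I j - θ * V j) *
          Real.exp (∑ k ∈ Finset.Ico (j + 1) n, I k + θ / 2 * V j))) * Real.exp (M * (j + 5)) := by
          gcongr
          exact hpow j hj2
      _ = Real.exp (∑ k ∈ Finset.Ico k₀ n, I k - θ / 2 * V j + M * (j + 5)) := by
          rw [← Real.exp_add, ← Real.exp_add, ← Real.exp_add, e2]; ring_nf
      _ ≤ _ := by
          rw [Real.exp_le_exp, hpot]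
          have h1 := hC₁ j
          have h2 := mul_le_mul_of_nonneg_left (hVge j) (show 0 ≤ θ / 2 by positivity)
          have := le_abs_self C₁
          linarith

end Core

/-! ### The Laplacian of convolutions and the fundamental solution -/

section Laplacian

open scoped ContDiff

theorem two_le_infty : (2 : WithTop ℕ∞) ≤ ((⊤ : ℕ∞) : WithTop ℕ∞) :=
  ENat.LEInfty.out

theorem laplacian_eq_fderiv {f : ℂ → ℝ} (hf : ContDiff ℝ 2 f) : Laplacian.laplacian f = fun z =>
  fderiv ℝ (fun x => fderiv ℝ f x 1) z 1 + fderiv ℝ (fun x => fderiv ℝ f x Complex.I) z Complex.I := by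
  rw [InnerProductSpace.laplacian_eq_iteratedFDeriv_complexPlane]
  have h1 : Differentiable ℝ (fderiv ℝ f) := (hf.fderiv_right (m := 1) (by norm_num)).differentiable (by norm_num)
  funext z
  simp only [iteratedFDeriv_two_apply]
  rw [fderiv_clm_apply (h1 z) (differentiableAt_const _), fderiv_clm_apply (h1 z) (differentiableAt_const _)]
  simp

/-- Green's formula. -/
theorem integral_mul_laplacian_comm {f g : ℂ → ℝ} (hf : ContDiff ℝ 2 f) (hg : ContDiff ℝ 2 g)
    (hgc : HasCompactSupport g) :
    ∫ z, f z * Laplacian.laplacian g z = ∫ z, Laplacian.laplacian f z * g z := by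
  have key : ∀ v : ℂ, Integrable (fun z => f z * fderiv ℝ (fun x => fderiv ℝ g x v) z v) ∧
      Integrable (fun z => fderiv ℝ (fun x => fderiv ℝ f x v) z v * g z) ∧
      ∫ z, f z * fderiv ℝ (fun x => fderiv ℝ g x v) z v =
        ∫ z, fderiv ℝ (fun x => fderiv ℝ f x v) z v * g z := by
    intro v
    have d1 : ∀ {h : ℂ → ℝ}, ContDiff ℝ 2 h → ContDiff ℝ 1 fun x => fderiv ℝ h x v := fun hh =>
      (hh.fderiv_right (m := 1) (by norm_num)).clm_apply contDiff_const
    have d2 : ∀ {h : ℂ → ℝ}, ContDiff ℝ 1 h → Continuous fun x => fderiv ℝ h x v := fun hh =>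
      (hh.continuous_fderiv (by norm_num)).clm_apply continuous_const
    have c1 : HasCompactSupport fun x => fderiv ℝ g x v := hgc.fderiv_apply (𝕜 := ℝ) v
    have c2 : HasCompactSupport fun z => fderiv ℝ (fun x => fderiv ℝ g x v) z v :=
      c1.fderiv_apply (𝕜 := ℝ) v
    have i1 : Integrable (fun z => f z * fderiv ℝ (fun x => fderiv ℝ g x v) z v) :=
      (hf.continuous.mul (d2 (d1 hg))).integrable_of_hasCompactSupport c2.mul_left
    have i2 : Integrable (fun z => fderiv ℝ f z v * fderiv ℝ g z v) :=
      ((d1 hf).continuous.mul (d1 hg).continuous).integrable_of_hasCompactSupport c1.mul_left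
    have i3 : Integrable (fun z => f z * fderiv ℝ g z v) :=
      (hf.continuous.mul (d1 hg).continuous).integrable_of_hasCompactSupport c1.mul_left
    have i4 : Integrable (fun z => fderiv ℝ (fun x => fderiv ℝ f x v) z v * g z) :=
      ((d2 (d1 hf)).mul hg.continuous).integrable_of_hasCompactSupport hgc.mul_left
    have i5 : Integrable (fun z => fderiv ℝ f z v * g z) :=
      ((d1 hf).continuous.mul hg.continuous).integrable_of_hasCompactSupport hgc.mul_left
    refine ⟨i1, i4, ?_⟩
    rw [integral_mul_fderiv_eq_neg_fderiv_mul_of_integrable i2 i1 i3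
      (fun x _ => (hf.differentiable (by norm_num)).differentiableAt)
      (fun x _ => ((d1 hg).differentiable (by norm_num)).differentiableAt),
      integral_mul_fderiv_eq_neg_fderiv_mul_of_integrable i4 i2 i5
      (fun x _ => ((d1 hf).differentiable (by norm_num)).differentiableAt)
      (fun x _ => (hg.differentiable (by norm_num)).differentiableAt), neg_neg]
  obtain ⟨a1, a2, a3⟩ := key 1
  obtain ⟨b1, b2, b3⟩ := key Complex.I
  rw [laplacian_eq_fderiv hf, laplacian_eq_fderiv hg]
  simp only [mul_add, add_mul]
  rw [integral_add a1 b1, integral_add a2 b2, a3, b3]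

theorem contDiff_laplacian {f : ℂ → ℝ} (hf : ContDiff ℝ ∞ f) :
    ContDiff ℝ ∞ (Laplacian.laplacian f) := by
  rw [laplacian_eq_fderiv (hf.of_le two_le_infty)]
  have d : ∀ {h : ℂ → ℝ} (v : ℂ), ContDiff ℝ ∞ h → ContDiff ℝ ∞ fun x => fderiv ℝ h x v :=
    fun v hh => (hh.fderiv_right (m := ∞) (by norm_num)).clm_apply contDiff_const
  exact (d 1 (d 1 hf)).add (d Complex.I (d Complex.I hf))

theorem HasCompactSupport.laplacian {f : ℂ → ℝ} (hf : ContDiff ℝ 2 f) (hfc : HasCompactSupport f) :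
    HasCompactSupport (Laplacian.laplacian f) := by
  rw [laplacian_eq_fderiv hf]
  exact ((hfc.fderiv_apply (𝕜 := ℝ) 1).fderiv_apply (𝕜 := ℝ) 1).add
    ((hfc.fderiv_apply (𝕜 := ℝ) Complex.I).fderiv_apply (𝕜 := ℝ) Complex.I)

theorem laplacian_comp_sub_left {f : ℂ → ℝ} (hf : ContDiff ℝ 2 f) (a z : ℂ) :
    Laplacian.laplacian (fun x => f (a - x)) z = Laplacian.laplacian f (a - z) := by
  have d : ∀ {h : ℂ → ℝ} (v x : ℂ), Differentiable ℝ h →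
      fderiv ℝ (fun x => h (a - x)) x v = -fderiv ℝ h (a - x) v := by
    intro h v x hh
    have h1 : HasFDerivAt (fun x : ℂ => a - x) (-ContinuousLinearMap.id ℝ ℂ) x :=
      (hasFDerivAt_id x).const_sub a
    have := ((hh (a - x)).hasFDerivAt.comp x h1).fderiv
    simp only [Function.comp_def] at this
    rw [this]; simp
  have d1 : ∀ v : ℂ, Differentiable ℝ fun x => fderiv ℝ f x v := fun v =>
    ((hf.fderiv_right (m := 1) (by norm_num)).clm_apply contDiff_const).differentiable (by norm_num)
  rw [laplacian_eq_fderiv hf,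
    laplacian_eq_fderiv (f := fun x => f (a - x)) (hf.comp (contDiff_const.sub contDiff_id))]
  simp only [d _ _ (hf.differentiable (by norm_num)), fderiv_fun_neg, neg_apply, d _ _ (d1 _), neg_neg]

theorem fderiv_integral_mul_sub {ν : Measure ℂ} {f g : ℂ → ℝ} (hf : LocallyIntegrable f ν)
    (hg : ContDiff ℝ 1 g) (hgc : HasCompactSupport g) (z v : ℂ) :
    fderiv ℝ (fun z => ∫ w, f w * g (z - w) ∂ν) z v = ∫ w, f w * fderiv ℝ g (z - w) v ∂ν := by
  have h := hasFDerivAt_convolution_right_with_param (ContinuousLinearMap.mul ℝ ℝ)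
    (g := fun _ : ℝ => g) (s := univ) (k := tsupport g) (μ := ν) (f := f) isOpen_univ hgc
    (fun p x _ hx => image_eq_zero_of_notMem_tsupport hx) hf
    (by exact (hg.comp contDiff_snd).contDiffOn) (0, z) (mem_univ _)
  have h1 : HasFDerivAt (fun z : ℂ => ((0 : ℝ), z)) (ContinuousLinearMap.inr ℝ ℝ ℂ) z :=
    hasFDerivAt_prodMk_right 0 z
  have h2 := (h.comp z h1).fderiv
  have h3 : ∀ x v : ℂ, fderiv ℝ (↿(fun _ : ℝ => g)) ((0 : ℝ), x) ((0 : ℝ), v) = fderiv ℝ g x v := by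
    intro x v
    have h4 : HasFDerivAt (↿(fun _ : ℝ => g)) ((fderiv ℝ g x).comp (ContinuousLinearMap.snd ℝ ℝ ℂ))
        ((0 : ℝ), x) :=
      HasFDerivAt.comp (g := g) (f := Prod.snd) ((0 : ℝ), x)
        ((hg.differentiable (by norm_num)) x).hasFDerivAt hasFDerivAt_snd
    rw [h4.fderiv]; simp
  have h5 : ContDiff ℝ 1 (↿(fun _ : ℝ => g)) := hg.comp contDiff_snd
  have h6 : Continuous fun x : ℂ => fderiv ℝ (↿(fun _ : ℝ => g)) ((0 : ℝ), x) :=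
    (h5.continuous_fderiv (by norm_num)).comp (by fun_prop)
  have h7 : HasCompactSupport fun x : ℂ => fderiv ℝ (↿(fun _ : ℝ => g)) ((0 : ℝ), x) := by
    refine HasCompactSupport.intro hgc fun x hx => ?_
    have h4 : HasFDerivAt (↿(fun _ : ℝ => g)) ((fderiv ℝ g x).comp (ContinuousLinearMap.snd ℝ ℝ ℂ))
        ((0 : ℝ), x) :=
      HasFDerivAt.comp (g := g) (f := Prod.snd) ((0 : ℝ), x)
        ((hg.differentiable (by norm_num)) x).hasFDerivAt hasFDerivAt_snd
    rw [h4.fderiv, fderiv_of_notMem_tsupport ℝ hx]; simp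
  have h8 := convolution_precompR_apply (ContinuousLinearMap.mul ℝ ℝ) hf h7 h6 z ((0 : ℝ), v)
  have h9 : (fun z => ∫ w, f w * g (z - w) ∂ν) =
    ((fun q : ℝ × ℂ => (convolution f ((fun _ : ℝ => g) q.1) (ContinuousLinearMap.mul ℝ ℝ) ν) q.2) ∘
      fun z => ((0 : ℝ), z)) := by
    funext z; rfl
  rw [h9, h2]
  refine Eq.trans ?_ (h8.trans ?_)
  · simp
  · simp only [h3]; rfl

theorem contDiff_integral_mul_sub {ν : Measure ℂ} {f g : ℂ → ℝ} (hf : LocallyIntegrable f ν)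
    (hg : ContDiff ℝ ∞ g) (hgc : HasCompactSupport g) :
    ContDiff ℝ ∞ (fun z => ∫ w, f w * g (z - w) ∂ν) :=
  hgc.contDiff_convolution_right (ContinuousLinearMap.mul ℝ ℝ) hf hg

theorem laplacian_integral_mul_sub {ν : Measure ℂ} {f g : ℂ → ℝ} (hf : LocallyIntegrable f ν)
    (hg : ContDiff ℝ ∞ g) (hgc : HasCompactSupport g) (z : ℂ) :
    Laplacian.laplacian (fun z => ∫ w, f w * g (z - w) ∂ν) z =
      ∫ w, f w * Laplacian.laplacian g (z - w) ∂ν := by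
  have d1 : ∀ v : ℂ, ContDiff ℝ 1 fun x => fderiv ℝ g x v := fun v =>
    ((hg.of_le two_le_infty).fderiv_right (m := 1) (n := 2) (by norm_num)).clm_apply contDiff_const
  have c1 : ∀ v : ℂ, HasCompactSupport fun x => fderiv ℝ g x v := fun v => hgc.fderiv_apply (𝕜 := ℝ) v
  have i : ∀ v : ℂ, Integrable (fun w => f w * fderiv ℝ (fun x => fderiv ℝ g x v) (z - w) v) ν := by
    intro v
    have hcont : Continuous fun w => fderiv ℝ (fun x => fderiv ℝ g x v) (z - w) v :=
      (((d1 v).continuous_fderiv (by norm_num)).clm_apply continuous_const).comp (by fun_prop)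
    have hcs : HasCompactSupport fun w => fderiv ℝ (fun x => fderiv ℝ g x v) (z - w) v :=
      ((c1 v).fderiv_apply (𝕜 := ℝ) v).comp_homeomorph (Homeomorph.subLeft z)
    exact hf.integrable_smul_right_of_hasCompactSupport hcont hcs
  have hg1 : ContDiff ℝ 1 g := hg.of_le (mod_cast le_top)
  rw [laplacian_eq_fderiv (contDiff_integral_mul_sub hf hg hgc |>.of_le two_le_infty),
    laplacian_eq_fderiv (hg.of_le two_le_infty)]
  simp only [fderiv_integral_mul_sub hf hg1 hgc, fderiv_integral_mul_sub hf (d1 _) (c1 _), mul_add]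
  rw [integral_add (i 1) (i Complex.I)]

theorem isDoublingWith_volume : IsDoublingWith 4 (volume : Measure ℂ) where
  lt_top z r := measure_ball_lt_top
  pos z r hr := ENNReal.toReal_pos (measure_ball_pos _ _ hr).ne' measure_ball_lt_top.ne
  le z r hr := by
    rw [measureReal_def, measureReal_def, Complex.volume_ball, Complex.volume_ball]
    simp only [ENNReal.toReal_mul, ENNReal.toReal_pow, ENNReal.toReal_ofReal hr.le,
      ENNReal.toReal_ofReal (show 0 ≤ 2 * r by positivity)]
    exact le_of_eq (by ring)

theorem IsDoublingWith.locallyIntegrable_log {c : ℝ} {κ : Measure ℂ} (h : IsDoublingWith c κ) (z : ℂ) :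
    LocallyIntegrable (fun w => Real.log ‖w - z‖) κ :=
  fun x => ⟨ball x 1, ball_mem_nhds x one_pos, h.integrableOn_log_norm_sub z x 1⟩

end Laplacian

section FundamentalSolution

open scoped ContDiff RealInnerProductSpace Topology
open Filter

/-- The regularisation `½ log (|z|² + s²)` of the logarithm of the modulus. -/
noncomputable def smoothLog (s : ℝ) (z : ℂ) : ℝ := Real.log (‖z‖ ^ 2 + s ^ 2) / 2

theorem contDiff_smoothLog {s : ℝ} (hs : s ≠ 0) : ContDiff ℝ ∞ (smoothLog s) :=
  (((contDiff_norm_sq ℝ).add contDiff_const).log fun x => by positivity).div_const 2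

theorem fderiv_smoothLog {s : ℝ} (hs : s ≠ 0) (z v : ℂ) :
    fderiv ℝ (smoothLog s) z v = ⟪z, v⟫ / (‖z‖ ^ 2 + s ^ 2) := by
  have h1 : HasFDerivAt (fun x : ℂ => ‖x‖ ^ 2 + s ^ 2) (2 • innerSL ℝ z) z :=
    (hasStrictFDerivAt_norm_sq z).hasFDerivAt.add_const _
  have h2 := (h1.log (by positivity)).mul_const (2⁻¹ : ℝ)
  have e : smoothLog s = fun x : ℂ => Real.log (‖x‖ ^ 2 + s ^ 2) * 2⁻¹ := by
    funext x; rw [smoothLog, div_eq_mul_inv]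
  rw [e, h2.fderiv]
  simp only [smul_apply, innerSL_apply_apply, smul_eq_mul, nsmul_eq_mul]
  push_cast
  ring

theorem fderiv_fderiv_smoothLog {s : ℝ} (hs : s ≠ 0) (z : ℂ) {v : ℂ} (hv : ‖v‖ = 1) :
    fderiv ℝ (fun x => fderiv ℝ (smoothLog s) x v) z v =
      1 / (‖z‖ ^ 2 + s ^ 2) - 2 * ⟪z, v⟫ ^ 2 / (‖z‖ ^ 2 + s ^ 2) ^ 2 := by
  have hd : DifferentiableAt ℝ (fun x => fderiv ℝ (smoothLog s) x v) z :=
    ((((contDiff_smoothLog hs).of_le two_le_infty).fderiv_right (m := 1) (n := 2)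
      (by norm_num)).clm_apply contDiff_const).differentiable (by norm_num) z
  rw [← hd.lineDeriv_eq_fderiv, lineDeriv]
  simp only [fderiv_smoothLog hs]
  have e1 : ∀ t : ℝ, ⟪z + t • v, v⟫ = ⟪z, v⟫ + t := fun t => by
    rw [inner_add_left, real_inner_smul_left, real_inner_self_eq_norm_sq, hv]; ring
  have e2 : ∀ t : ℝ, ‖z + t • v‖ ^ 2 = ‖z‖ ^ 2 + 2 * t * ⟪z, v⟫ + t ^ 2 := fun t => by
    rw [norm_add_sq_real, real_inner_smul_right, norm_smul, hv, mul_one, Real.norm_eq_abs, sq_abs]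
    ring
  simp only [e1, e2]
  have hq : ‖z‖ ^ 2 + s ^ 2 ≠ 0 := by positivity
  have h1 : HasDerivAt (fun t : ℝ => ⟪z, v⟫ + t) 1 0 := (hasDerivAt_id 0).const_add _
  have h2 : HasDerivAt (fun t : ℝ => ‖z‖ ^ 2 + 2 * t * ⟪z, v⟫ + t ^ 2 + s ^ 2) (2 * ⟪z, v⟫) 0 := by
    have h3 : HasDerivAt (fun t : ℝ => 2 * t * ⟪z, v⟫) (2 * ⟪z, v⟫) 0 := by
      have := ((hasDerivAt_id (0 : ℝ)).const_mul 2).mul_const ⟪z, v⟫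
      simpa using this
    have h4 : HasDerivAt (fun t : ℝ => t ^ 2) 0 0 := by simpa using hasDerivAt_pow 2 (0 : ℝ)
    simpa using ((h3.const_add (‖z‖ ^ 2)).add h4).add_const (s ^ 2)
  have h5 := h1.fun_div h2 (by simpa using hq)
  rw [h5.deriv]
  simp only [mul_zero, zero_mul, add_zero, ne_eq, OfNat.ofNat_ne_zero, not_false_eq_true, zero_pow]
  field_simp

theorem laplacian_smoothLog {s : ℝ} (hs : s ≠ 0) (z : ℂ) :
    Laplacian.laplacian (smoothLog s) z = 2 * s ^ 2 / (‖z‖ ^ 2 + s ^ 2) ^ 2 := by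
  have hq : ‖z‖ ^ 2 + s ^ 2 ≠ 0 := by positivity
  rw [laplacian_eq_fderiv ((contDiff_smoothLog hs).of_le two_le_infty)]
  simp only
  rw [fderiv_fderiv_smoothLog hs z norm_one, fderiv_fderiv_smoothLog hs z Complex.norm_I]
  have h1 : ⟪z, (1 : ℂ)⟫ ^ 2 + ⟪z, Complex.I⟫ ^ 2 = ‖z‖ ^ 2 := by
    rw [Complex.inner, Complex.inner, Complex.sq_norm, Complex.normSq_apply]
    simp; ring
  have h2 : 2 * ⟪z, (1 : ℂ)⟫ ^ 2 / (‖z‖ ^ 2 + s ^ 2) ^ 2 + 2 * ⟪z, Complex.I⟫ ^ 2 /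
      (‖z‖ ^ 2 + s ^ 2) ^ 2 = 2 * ‖z‖ ^ 2 / (‖z‖ ^ 2 + s ^ 2) ^ 2 := by rw [← h1]; ring
  calc _ = 2 / (‖z‖ ^ 2 + s ^ 2) - (2 * ⟪z, (1 : ℂ)⟫ ^ 2 / (‖z‖ ^ 2 + s ^ 2) ^ 2 +
        2 * ⟪z, Complex.I⟫ ^ 2 / (‖z‖ ^ 2 + s ^ 2) ^ 2) := by ring
    _ = _ := by rw [h2]; field_simp; ring

theorem abs_smoothLog_le {s : ℝ} (hs0 : 0 < s) (hs1 : s ≤ 1) {z : ℂ} (hz : z ≠ 0) :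
    |smoothLog s z| ≤ |Real.log ‖z‖| + 1 := by
  have hz' : 0 < ‖z‖ := norm_pos_iff.2 hz
  have h1 : Real.log ‖z‖ ≤ smoothLog s z := by
    rw [smoothLog, le_div_iff₀ two_pos]
    calc Real.log ‖z‖ * 2 = Real.log (‖z‖ ^ 2) := by rw [Real.log_pow]; push_cast; ring
      _ ≤ _ := Real.log_le_log (by positivity) (by nlinarith)
  have h2 : smoothLog s z ≤ |Real.log ‖z‖| + 1 := by
    rw [smoothLog, div_le_iff₀ two_pos]
    have h3 : ‖z‖ ≤ Real.exp |Real.log ‖z‖| := by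
      rw [← Real.log_le_iff_le_exp hz']; exact le_abs_self _
    have h4 : (1 : ℝ) ≤ Real.exp |Real.log ‖z‖| := Real.one_le_exp (abs_nonneg _)
    rw [Real.log_le_iff_le_exp (by positivity)]
    calc ‖z‖ ^ 2 + s ^ 2 ≤ Real.exp |Real.log ‖z‖| ^ 2 + Real.exp |Real.log ‖z‖| ^ 2 := by
          gcongr; linarith
      _ = 2 * Real.exp |Real.log ‖z‖| ^ 2 := by ring
      _ ≤ Real.exp 1 ^ 2 * Real.exp |Real.log ‖z‖| ^ 2 := by
          gcongr; nlinarith [Real.exp_one_gt_d9]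
      _ = _ := by rw [← mul_pow, ← Real.exp_add, ← Real.exp_nat_mul]; push_cast; ring_nf
  rw [abs_le]
  exact ⟨by linarith [neg_abs_le (Real.log ‖z‖)], h2⟩

theorem integrable_two_div_sq : Integrable fun z : ℂ => 2 / (‖z‖ ^ 2 + 1) ^ 2 := by
  have h := (integrable_rpow_neg_one_add_norm_sq (E := ℂ) (μ := volume) (r := 4)
    (by rw [Complex.finrank_real_complex]; norm_num)).const_mul 2
  refine h.congr (Eventually.of_forall fun z => ?_)
  simp only
  rw [show (-4 / 2 : ℝ) = -(2 : ℕ) by norm_num, Real.rpow_neg (by positivity), Real.rpow_natCast,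
    add_comm, div_eq_mul_inv]

theorem integral_two_div_sq : ∫ z : ℂ, 2 / (‖z‖ ^ 2 + 1) ^ 2 = 2 * Real.pi := by
  rw [← Complex.integral_comp_polarCoord_symm, polarCoord_target]
  have e : ∀ p ∈ Ioi (0 : ℝ) ×ˢ Ioo (-Real.pi) Real.pi,
      p.1 • (2 / (‖Complex.polarCoord.symm p‖ ^ 2 + 1) ^ 2) =
        (2 * p.1 / (p.1 ^ 2 + 1) ^ 2) * 1 := by
    intro p hp
    rw [Complex.norm_polarCoord_symm, sq_abs, smul_eq_mul]; ring
  rw [setIntegral_congr_fun (measurableSet_Ioi.prod measurableSet_Ioo) e, Measure.volume_eq_prod,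
    setIntegral_prod_mul (fun r : ℝ => 2 * r / (r ^ 2 + 1) ^ 2) (fun _ : ℝ => (1 : ℝ))]
  have h1 : ∫ r in Ioi (0 : ℝ), 2 * r / (r ^ 2 + 1) ^ 2 = 1 := by
    have hd : ∀ x ∈ Ici (0 : ℝ), HasDerivAt (fun r : ℝ => -(r ^ 2 + 1)⁻¹)
        (2 * x / (x ^ 2 + 1) ^ 2) x := by
      intro x _
      have h2 : HasDerivAt (fun r : ℝ => r ^ 2 + 1) (2 * x) x := by
        simpa using (hasDerivAt_pow 2 x).add_const 1
      exact ((h2.fun_inv (by positivity)).fun_neg).congr_deriv (by ring)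
    have ht : Tendsto (fun r : ℝ => -(r ^ 2 + 1)⁻¹) atTop (𝓝 0) := by
      rw [← neg_zero]
      exact (tendsto_inv_atTop_zero.comp
        (tendsto_atTop_add_const_right _ _ (tendsto_pow_atTop two_ne_zero))).neg
    have := integral_Ioi_of_hasDerivAt_of_nonneg' hd (fun x hx => by
      have : 0 < x := hx
      positivity) ht
    rw [this]; norm_num
  have h2 : (0 : ℝ) ≤ Real.pi - -Real.pi := by linarith [Real.pi_pos]
  rw [h1, setIntegral_const, Real.volume_real_Ioo_of_le (by linarith), smul_eq_mul]
  ring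

/-- The function `log |z| / 2π` is a fundamental solution of the Laplacian of the plane. -/
theorem integral_log_mul_laplacian {f : ℂ → ℝ} (hf : ContDiff ℝ ∞ f) (hfc : HasCompactSupport f)
    (w : ℂ) : ∫ z, Real.log ‖z - w‖ * Laplacian.laplacian f z = 2 * Real.pi * f w := by
  have hf2 := hf.of_le two_le_infty
  have hL := (contDiff_laplacian hf).continuous
  have hLc := HasCompactSupport.laplacian hf2 hfc
  obtain ⟨B, hB⟩ := hfc.exists_bound_of_continuous hf.continuous
  have hlog : Integrable fun z => Real.log ‖z - w‖ * Laplacian.laplacian f z :=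
    (isDoublingWith_volume.locallyIntegrable_log w).integrable_smul_right_of_hasCompactSupport hL hLc
  have hLi : Integrable (Laplacian.laplacian f) := hL.integrable_of_hasCompactSupport hLc
  set s : ℕ → ℝ := fun n => 1 / ((n : ℝ) + 1) with hs
  have hs0 : ∀ n, 0 < s n := fun n => by positivity
  have hs1 : ∀ n, s n ≤ 1 := fun n => by
    rw [hs]; simp only; rw [div_le_one (by positivity)]; linarith [(Nat.cast_nonneg n : (0 : ℝ) ≤ n)]
  have hslim : Tendsto s atTop (𝓝 0) := tendsto_one_div_add_atTop_nhds_zero_nat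
  have hne : ∀ᵐ z : ℂ, z ≠ w := by rw [ae_iff]; simp
  -- the regularised identities, written in two ways
  have hlhs : Tendsto (fun n => ∫ z, smoothLog (s n) (z - w) * Laplacian.laplacian f z) atTop
      (𝓝 (∫ z, Real.log ‖z - w‖ * Laplacian.laplacian f z)) := by
    refine tendsto_integral_of_dominated_convergence
      (fun z => ‖Real.log ‖z - w‖ * Laplacian.laplacian f z‖ + ‖Laplacian.laplacian f z‖)
      (fun n => ?_) (hlog.norm.add hLi.norm) (fun n => ?_) ?_
    · exact (((contDiff_smoothLog (hs0 n).ne').continuous.comp (continuous_sub_right w)).mul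
        hL).aestronglyMeasurable
    · filter_upwards [hne] with z hz
      have := abs_smoothLog_le (hs0 n) (hs1 n) (sub_ne_zero.2 hz)
      rw [norm_mul, norm_mul, Real.norm_eq_abs, Real.norm_eq_abs (Real.log _)]
      have := mul_le_mul_of_nonneg_right this (norm_nonneg (Laplacian.laplacian f z))
      linarith
    · filter_upwards [hne] with z hz
      refine Tendsto.mul_const _ ?_
      have hz' : 0 < ‖z - w‖ := norm_pos_iff.2 (sub_ne_zero.2 hz)
      have h1 : Tendsto (fun n => ‖z - w‖ ^ 2 + s n ^ 2) atTop (𝓝 (‖z - w‖ ^ 2)) := by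
        simpa using tendsto_const_nhds.add (hslim.pow 2)
      have h2 := ((Real.continuousAt_log (by positivity)).tendsto.comp h1).div_const 2
      rw [Real.log_pow] at h2
      simpa [smoothLog, Function.comp_def] using h2
  have hrhs : Tendsto (fun n => ∫ y : ℂ, 2 / (‖y‖ ^ 2 + 1) ^ 2 * f (s n • y + w)) atTop
      (𝓝 (∫ y : ℂ, 2 / (‖y‖ ^ 2 + 1) ^ 2 * f w)) := by
    refine tendsto_integral_of_dominated_convergence (fun y => 2 / (‖y‖ ^ 2 + 1) ^ 2 * B)
      (fun n => ?_) (integrable_two_div_sq.mul_const B) (fun n => ?_) ?_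
    · refine integrable_two_div_sq.aestronglyMeasurable.mul ?_
      exact (hf.continuous.comp (by fun_prop)).aestronglyMeasurable
    · refine Eventually.of_forall fun y => ?_
      rw [norm_mul, Real.norm_of_nonneg (by positivity)]
      gcongr
      exact hB _
    · refine Eventually.of_forall fun y => Tendsto.const_mul _ ?_
      have h1 : Tendsto (fun n => s n • y + w) atTop (𝓝 w) := by
        simpa using (hslim.smul_const y).add_const w
      exact (hf.continuous.tendsto w).comp h1
  have heq : ∀ n, ∫ z, smoothLog (s n) (z - w) * Laplacian.laplacian f z =
      ∫ y : ℂ, 2 / (‖y‖ ^ 2 + 1) ^ 2 * f (s n • y + w) := by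
    intro n
    have hsn := hs0 n
    have h1 : ∫ z, smoothLog (s n) (z - w) * Laplacian.laplacian f z =
        ∫ z, smoothLog (s n) z * Laplacian.laplacian (fun x => f (x + w)) z := by
      rw [← integral_add_right_eq_self _ w]
      refine integral_congr_ae (Eventually.of_forall fun z => ?_)
      simp only [add_sub_cancel_right]
      rw [laplacian_eq_fderiv hf2, laplacian_eq_fderiv (f := fun x => f (x + w))
        (hf2.comp (contDiff_id.add contDiff_const))]
      simp only [fderiv_comp_add_right]
      rw [← fderiv_comp_add_right (f := fun x => fderiv ℝ f x 1),
        ← fderiv_comp_add_right (f := fun x => fderiv ℝ f x Complex.I)]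
    have h2 : HasCompactSupport fun x => f (x + w) := hfc.comp_homeomorph (Homeomorph.addRight w)
    rw [h1, integral_mul_laplacian_comm ((contDiff_smoothLog hsn.ne').of_le two_le_infty)
      (g := fun x => f (x + w)) (hf2.comp (contDiff_id.add contDiff_const)) h2]
    have h3 := Measure.integral_comp_smul (volume : Measure ℂ)
      (fun z => Laplacian.laplacian (smoothLog (s n)) z * f (z + w)) (s n)
    rw [Complex.finrank_real_complex, abs_of_pos (by positivity), smul_eq_mul,
      eq_comm, inv_mul_eq_iff_eq_mul₀ (by positivity)] at h3
    rw [h3, ← integral_const_mul]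
    refine integral_congr_ae (Eventually.of_forall fun y => ?_)
    simp only [laplacian_smoothLog hsn.ne', norm_smul, Real.norm_of_nonneg hsn.le]
    have : ((s n * ‖y‖) ^ 2 + s n ^ 2) ^ 2 = s n ^ 4 * (‖y‖ ^ 2 + 1) ^ 2 := by ring
    rw [this]
    field_simp
  simp_rw [heq] at hlhs
  rw [tendsto_nhds_unique hlhs hrhs, integral_mul_const, integral_two_div_sq]

end FundamentalSolution

section Kernels

open scoped ContDiff Topology
open Filter

/-- The logarithm of the modulus, cut off away from the origin by a bump function. -/
noncomputable def cutLog (ξ : ContDiffBump (0 : ℂ)) (x : ℂ) : ℝ := ξ x * Real.log ‖x‖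

/-- The logarithm of the modulus, cut off near the origin by a bump function. -/
noncomputable def farLog (ξ : ContDiffBump (0 : ℂ)) (x : ℂ) : ℝ := (1 - ξ x) * Real.log ‖x‖

variable (ξ ξ₀ : ContDiffBump (0 : ℂ))

theorem cutLog_neg (x : ℂ) : cutLog ξ (-x) = cutLog ξ x := by
  rw [cutLog, cutLog, ξ.neg, norm_neg]

theorem farLog_neg (x : ℂ) : farLog ξ (-x) = farLog ξ x := by
  rw [farLog, farLog, ξ.neg, norm_neg]

theorem cutLog_add_farLog (x : ℂ) : cutLog ξ x + farLog ξ x = Real.log ‖x‖ := by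
  rw [cutLog, farLog]; ring

variable {ξ} in
theorem cutLog_of_norm_le {x : ℂ} (hx : ‖x‖ ≤ ξ.rIn) : cutLog ξ x = Real.log ‖x‖ := by
  rw [cutLog, ξ.one_of_mem_closedBall (by simpa using hx), one_mul]

variable {ξ} in
theorem cutLog_of_le_norm {x : ℂ} (hx : ξ.rOut ≤ ‖x‖) : cutLog ξ x = 0 := by
  rw [cutLog, ξ.zero_of_le_dist (by simpa using hx), zero_mul]

variable {ξ} in
theorem farLog_of_norm_le {x : ℂ} (hx : ‖x‖ ≤ ξ.rIn) : farLog ξ x = 0 := by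
  rw [farLog, ξ.one_of_mem_closedBall (by simpa using hx), sub_self, zero_mul]

variable {ξ} in
theorem farLog_of_le_norm {x : ℂ} (hx : ξ.rOut ≤ ‖x‖) : farLog ξ x = Real.log ‖x‖ := by
  rw [farLog, ξ.zero_of_le_dist (by simpa using hx), sub_zero, one_mul]

theorem measurable_cutLog : Measurable (cutLog ξ) :=
  ξ.continuous.measurable.mul (Real.measurable_log.comp measurable_norm)

theorem contDiffAt_log_norm {x : ℂ} (hx : x ≠ 0) : ContDiffAt ℝ ∞ (fun x : ℂ => Real.log ‖x‖) x :=
  (contDiffAt_norm ℝ hx).log (norm_ne_zero_iff.2 hx)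

theorem contDiff_farLog : ContDiff ℝ ∞ (farLog ξ) := by
  rw [contDiff_iff_contDiffAt]
  intro x
  rcases eq_or_ne x 0 with rfl | hx
  · refine (contDiffAt_const (c := (0 : ℝ))).congr_of_eventuallyEq ?_
    filter_upwards [ball_mem_nhds (0 : ℂ) ξ.rIn_pos] with y hy
    exact farLog_of_norm_le (by simpa using (mem_ball.1 hy).le)
  · exact (contDiffAt_const.sub ξ.contDiffAt).mul (contDiffAt_log_norm hx)

theorem laplacian_log_norm {x : ℂ} (hx : x ≠ 0) :
    Laplacian.laplacian (fun x : ℂ => Real.log ‖x‖) x = 0 :=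
  (analyticAt_id.harmonicAt_log_norm (f := id) hx).2.self_of_nhds

/-- The defect of `cutLog` from being a fundamental solution of the Laplacian. -/
noncomputable def defectKernel : ℂ → ℝ := Laplacian.laplacian (farLog ξ)

theorem contDiff_defectKernel : ContDiff ℝ ∞ (defectKernel ξ) := contDiff_laplacian (contDiff_farLog ξ)

variable {ξ} in
theorem defectKernel_of_norm_lt {x : ℂ} (hx : ‖x‖ < ξ.rIn) : defectKernel ξ x = 0 := by
  have : farLog ξ =ᶠ[𝓝 x] fun _ => (0 : ℝ) := by
    filter_upwards [(isOpen_lt continuous_norm continuous_const).mem_nhds hx] with y hy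
    exact farLog_of_norm_le (le_of_lt hy)
  rw [defectKernel, (InnerProductSpace.laplacian_congr_nhds this).self_of_nhds]
  exact congrFun InnerProductSpace.laplacian_const x

variable {ξ} in
theorem defectKernel_of_lt_norm {x : ℂ} (hx : ξ.rOut < ‖x‖) : defectKernel ξ x = 0 := by
  have : farLog ξ =ᶠ[𝓝 x] fun y => Real.log ‖y‖ := by
    filter_upwards [(isOpen_lt continuous_const continuous_norm).mem_nhds hx] with y hy
    exact farLog_of_le_norm (le_of_lt hy)
  rw [defectKernel, (InnerProductSpace.laplacian_congr_nhds this).self_of_nhds,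
    laplacian_log_norm (norm_pos_iff.1 (ξ.rOut_pos.trans hx))]

theorem hasCompactSupport_defectKernel : HasCompactSupport (defectKernel ξ) :=
  HasCompactSupport.intro (isCompact_closedBall (0 : ℂ) ξ.rOut) fun x hx =>
    defectKernel_of_lt_norm (by simpa using hx)

theorem defectKernel_neg (x : ℂ) : defectKernel ξ (-x) = defectKernel ξ x := by
  have h := laplacian_comp_sub_left ((contDiff_farLog ξ).of_le two_le_infty) 0 x
  simp only [zero_sub, farLog_neg] at h
  exact h.symm

/-- The part of `cutLog` away from the origin. -/
noncomputable def ringLog (x : ℂ) : ℝ := ξ x * farLog ξ₀ x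

theorem contDiff_ringLog : ContDiff ℝ ∞ (ringLog ξ ξ₀) := ξ.contDiff.mul (contDiff_farLog ξ₀)

theorem hasCompactSupport_ringLog : HasCompactSupport (ringLog ξ ξ₀) := ξ.hasCompactSupport.mul_right

variable {ξ ξ₀} in
theorem ringLog_of_le_norm {x : ℂ} (hx : ξ₀.rOut ≤ ‖x‖) : ringLog ξ ξ₀ x = cutLog ξ x := by
  rw [ringLog, farLog_of_le_norm hx, cutLog]

variable {ξ ξ₀} in
theorem laplacian_ringLog {x : ℂ} (hx : ξ₀.rOut < ‖x‖) :
    Laplacian.laplacian (ringLog ξ ξ₀) x = -defectKernel ξ x := by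
  have hx0 : x ≠ 0 := norm_pos_iff.1 (ξ₀.rOut_pos.trans hx)
  have : ringLog ξ ξ₀ =ᶠ[𝓝 x] (fun y => Real.log ‖y‖) - farLog ξ := by
    filter_upwards [(isOpen_lt continuous_const continuous_norm).mem_nhds hx] with y hy
    rw [ringLog_of_le_norm (le_of_lt hy), Pi.sub_apply, ← cutLog_add_farLog ξ y]; ring
  rw [(InnerProductSpace.laplacian_congr_nhds this).self_of_nhds,
    ((contDiffAt_log_norm hx0).of_le two_le_infty).laplacian_sub
      ((contDiff_farLog ξ).of_le two_le_infty).contDiffAt, laplacian_log_norm hx0, zero_sub, defectKernel]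

theorem integrable_cutLog_sub {c : ℝ} {κ : Measure ℂ} (h : IsDoublingWith c κ) (z : ℂ) :
    Integrable (fun w => cutLog ξ (w - z)) κ := by
  have h1 : HasCompactSupport fun w => ξ (w - z) :=
    ξ.hasCompactSupport.comp_homeomorph (Homeomorph.subRight z)
  have := (h.locallyIntegrable_log z).integrable_smul_left_of_hasCompactSupport
    (g := fun w => ξ (w - z)) (ξ.continuous.comp (continuous_sub_right z)) h1
  simpa [cutLog] using this

theorem integral_cutLog_mul_laplacian {f : ℂ → ℝ} (hf : ContDiff ℝ ∞ f) (hfc : HasCompactSupport f)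
    (w : ℂ) : ∫ z, cutLog ξ (w - z) * Laplacian.laplacian f z =
      2 * Real.pi * f w - ∫ z, defectKernel ξ (w - z) * f z := by
  have hf2 := hf.of_le two_le_infty
  have hL := (contDiff_laplacian hf).continuous
  have hLc := HasCompactSupport.laplacian hf2 hfc
  have hfar : ContDiff ℝ ∞ fun z => farLog ξ (w - z) :=
    (contDiff_farLog ξ).comp (contDiff_const.sub contDiff_id)
  have h1 := integral_log_mul_laplacian hf hfc w
  have h2 := integral_mul_laplacian_comm (hfar.of_le two_le_infty) hf2 hfc
  simp only [laplacian_comp_sub_left ((contDiff_farLog ξ).of_le two_le_infty)] at h2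
  have i1 : Integrable fun z => Real.log ‖z - w‖ * Laplacian.laplacian f z :=
    (isDoublingWith_volume.locallyIntegrable_log w).integrable_smul_right_of_hasCompactSupport hL hLc
  have i2 : Integrable fun z => farLog ξ (w - z) * Laplacian.laplacian f z :=
    (hfar.continuous.mul hL).integrable_of_hasCompactSupport hLc.mul_left
  rw [← h1, defectKernel, ← h2, ← integral_sub i1 i2]
  refine integral_congr_ae (Eventually.of_forall fun z => ?_)
  simp only
  rw [← norm_neg (z - w), neg_sub, ← cutLog_add_farLog ξ]; ring

end Kernels

/-! ### Local representation of a subharmonic function -/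

section Representation

open scoped ContDiff Topology
open Filter

variable {c : ℝ} {κ μ : Measure ℂ} {φ : ℂ → EReal}

theorem IsDoublingWith.isLocallyFiniteMeasure (h : IsDoublingWith c κ) : IsLocallyFiniteMeasure κ :=
  ⟨fun x => ⟨ball x 1, ball_mem_nhds x one_pos, h.lt_top x 1⟩⟩

/-- The logarithmic potential of the part of a doubling measure in a disk is continuous: it is a
locally uniform limit of integrals of truncated logarithms. -/
theorem IsDoublingWith.continuous_integral_log (h : IsDoublingWith c κ) (p : ℂ) (T : ℝ) :
    Continuous fun z => ∫ w in ball p T, Real.log ‖w - z‖ ∂κ := by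
  have hfin : IsFiniteMeasure (κ.restrict (ball p T)) :=
    ⟨by rw [Measure.restrict_apply_univ]; exact h.lt_top p T⟩
  -- truncation at the radius `2⁻ⁿ`
  set g : ℕ → ℂ → ℝ := fun n z => ∫ w in ball p T, Real.log (max ‖w - z‖ (1 / 2 ^ n)) ∂κ with hg
  have hcont : ∀ n, Continuous (g n) := by
    intro n
    have hpos : ∀ x : ℝ, 0 < max x (1 / 2 ^ n) := fun x => lt_max_of_lt_right (by positivity)
    have hc2 : ∀ z : ℂ, Continuous fun w : ℂ => Real.log (max ‖w - z‖ (1 / 2 ^ n)) := fun z =>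
      Continuous.log (by fun_prop) fun w => (hpos _).ne'
    rw [continuous_iff_continuousAt]
    intro z₀
    refine continuousAt_of_dominated (bound := fun _ => |Real.log (|T| + ‖p‖ + ‖z₀‖ + 2)| +
      |Real.log (1 / 2 ^ n)|) (Eventually.of_forall fun z => (hc2 z).aestronglyMeasurable) ?_
      (integrable_const _) (Eventually.of_forall fun w => ?_)
    · filter_upwards [ball_mem_nhds z₀ one_pos] with z hz
      filter_upwards [ae_restrict_mem measurableSet_ball] with w hw
      have h1 : ‖w - z‖ ≤ |T| + ‖p‖ + ‖z₀‖ + 2 := by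
        rw [mem_ball, dist_eq_norm] at hw hz
        have e : w - z = (w - p) + p - z₀ - (z - z₀) := by ring
        have h2 := norm_sub_le ((w - p) + p - z₀) (z - z₀)
        have h3 := norm_sub_le ((w - p) + p) z₀
        have h4 := norm_add_le (w - p) p
        rw [e]; linarith [le_abs_self T]
      have h5 : (1 : ℝ) / 2 ^ n ≤ |T| + ‖p‖ + ‖z₀‖ + 2 := by
        have : (1 : ℝ) / 2 ^ n ≤ 1 := by
          rw [div_le_one (by positivity)]; exact one_le_pow₀ one_le_two
        have := abs_nonneg T
        have := norm_nonneg p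
        have := norm_nonneg z₀
        linarith
      rw [Real.norm_eq_abs, abs_le]
      constructor
      · have h6 : Real.log (1 / 2 ^ n) ≤ Real.log (max ‖w - z‖ (1 / 2 ^ n)) :=
          Real.log_le_log (by positivity) (le_max_right _ _)
        have := neg_abs_le (Real.log (1 / 2 ^ n))
        have := abs_nonneg (Real.log (|T| + ‖p‖ + ‖z₀‖ + 2))
        linarith
      · have h6 := Real.log_le_log (hpos _) (max_le h1 h5)
        have := le_abs_self (Real.log (|T| + ‖p‖ + ‖z₀‖ + 2))
        have := abs_nonneg (Real.log (1 / 2 ^ n))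
        linarith
    · exact (Continuous.log (by fun_prop) fun z => (hpos _).ne').continuousAt
  rw [continuous_iff_continuousAt]
  intro z₀
  have hK0 : 0 ≤ c ^ 3 * κ.real (ball z₀ 2) := by
    have := h.one_le
    positivity
  have hunif : TendstoUniformlyOn g (fun z => ∫ w in ball p T, Real.log ‖w - z‖ ∂κ) atTop
      (ball z₀ 1) := by
    rw [Metric.tendstoUniformlyOn_iff]
    intro ε hε
    obtain ⟨n₀, hn₀⟩ := exists_pow_lt_of_lt_one
      (show 0 < ε / (c ^ 3 * κ.real (ball z₀ 2) + 1) by positivity) (h.revRatio_lt_one)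
    rw [lt_div_iff₀ (by positivity)] at hn₀
    filter_upwards [eventually_ge_atTop n₀] with n hn z hz
    have hr : (0 : ℝ) < 1 / 2 ^ n := by positivity
    have hi := h.integrableOn_log_norm_sub z p T
    have hi2 : IntegrableOn (fun w => Real.log ((1 / 2 ^ n) / ‖w - z‖)) (ball z (1 / 2 ^ n)) κ :=
      h.integrableOn_log_div z hr
    have hi3 := (integrable_indicator_iff measurableSet_ball).2 hi2
    have hne : ∀ᵐ w ∂κ, w ≠ z := by rw [ae_iff]; simpa using h.measure_singleton z
    have e1 : g n z = ∫ w in ball p T, (Real.log ‖w - z‖ +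
        (ball z (1 / 2 ^ n)).indicator (fun w => Real.log ((1 / 2 ^ n) / ‖w - z‖)) w) ∂κ := by
      refine integral_congr_ae ?_
      filter_upwards [ae_restrict_of_ae hne] with w hw
      have hw' : 0 < ‖w - z‖ := norm_pos_iff.2 (sub_ne_zero.2 hw)
      by_cases hwz : w ∈ ball z (1 / 2 ^ n)
      · rw [indicator_of_mem hwz, Real.log_div hr.ne' hw'.ne', max_eq_right]
        · ring
        · rw [mem_ball, dist_eq_norm] at hwz; exact hwz.le
      · rw [indicator_of_notMem hwz, add_zero, max_eq_left]
        rw [mem_ball, dist_eq_norm, not_lt] at hwz; exact hwz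
    rw [e1, integral_add hi hi3.integrableOn, dist_eq_norm, sub_add_cancel_left, norm_neg]
    have hnn : ∀ w, 0 ≤ (ball z (1 / 2 ^ n)).indicator
        (fun w => Real.log ((1 / 2 ^ n) / ‖w - z‖)) w := fun w =>
      indicator_nonneg (fun w hw => IsDoublingWith.log_div_nonneg hw) w
    rw [Real.norm_of_nonneg (setIntegral_nonneg measurableSet_ball fun w _ => hnn w)]
    calc ∫ w in ball p T, (ball z (1 / 2 ^ n)).indicator
          (fun w => Real.log ((1 / 2 ^ n) / ‖w - z‖)) w ∂κ
        ≤ ∫ w, (ball z (1 / 2 ^ n)).indicator (fun w => Real.log ((1 / 2 ^ n) / ‖w - z‖)) w ∂κ :=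
          setIntegral_le_integral hi3 (Eventually.of_forall hnn)
      _ = ∫ w in ball z (1 / 2 ^ n), Real.log ((1 / 2 ^ n) / ‖w - z‖) ∂κ :=
          integral_indicator measurableSet_ball
      _ ≤ c ^ 3 * κ.real (ball z (1 / 2 ^ n)) := h.integral_log_div_le z hr
      _ ≤ c ^ 3 * (revRatio c ^ n * κ.real (ball z 1)) := by
          have := h.one_le
          gcongr
          exact h.real_ball_div_le n z one_pos
      _ ≤ c ^ 3 * (revRatio c ^ n₀ * κ.real (ball z₀ 2)) := by
          have := h.one_le
          have h0 := h.revRatio_nonneg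
          have h2 : κ.real (ball z 1) ≤ κ.real (ball z₀ 2) := by
            refine h.real_mono (ball_subset_ball' ?_)
            rw [mem_ball] at hz
            linarith
          exact mul_le_mul_of_nonneg_left (mul_le_mul
            (pow_le_pow_of_le_one h0 h.revRatio_lt_one.le hn) h2 measureReal_nonneg (by positivity))
            (by positivity)
      _ ≤ revRatio c ^ n₀ * (c ^ 3 * κ.real (ball z₀ 2) + 1) := by
          have h0 := pow_nonneg h.revRatio_nonneg n₀
          linarith
      _ < ε := hn₀
  exact (hunif.continuousOn (Eventually.of_forall fun n => (hcont n).continuousOn).frequently).continuousAt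
    (ball_mem_nhds z₀ one_pos)

theorem IsLaplacian.locallyIntegrable (hφ : IsLaplacian φ μ) :
    LocallyIntegrable fun z => (φ z).toReal := by
  intro x
  refine ⟨closedBall x 1, closedBall_mem_nhds x one_pos, ?_⟩
  refine ⟨(measurable_ereal_toReal.comp_aemeasurable hφ.aemeasurable).aestronglyMeasurable.restrict,
    lt_of_le_of_lt (lintegral_mono fun z => ?_)
      (hφ.lintegral_abs_lt_top _ (isCompact_closedBall x 1))⟩
  induction hz : φ z with
  | bot => simp [hz]
  | top => simp [hz]
  | coe r => simp only [hz]; rw [EReal.toReal_coe, EReal.abs_def, Real.enorm_eq_ofReal_abs]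

theorem measurable_abs_ereal : Measurable EReal.abs := by
  refine EReal.measurable_of_measurable_real ?_
  simp only [EReal.abs_def]
  fun_prop

theorem IsLaplacian.ae_ne_bot (hφ : IsLaplacian φ μ) : ∀ᵐ z, φ z ≠ ⊥ := by
  have h1 : ∀ n : ℕ, ∀ᵐ z ∂volume.restrict (closedBall (0 : ℂ) n), φ z ≠ ⊥ := by
    intro n
    have hm : AEMeasurable (fun z => (φ z).abs) (volume.restrict (closedBall (0 : ℂ) n)) :=
      measurable_abs_ereal.comp_aemeasurable hφ.aemeasurable.restrict
    filter_upwards [ae_lt_top' hm (hφ.lintegral_abs_lt_top _ (isCompact_closedBall 0 n)).ne] with z hz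
    rintro h
    simp [h] at hz
  have h2 := (ae_restrict_iUnion_iff (μ := volume) (fun n : ℕ => closedBall (0 : ℂ) n)
    (fun z => φ z ≠ ⊥)).2 h1
  rwa [iUnion_closedBall_nat, Measure.restrict_univ] at h2

theorem exists_forall_norm_le_of_hasCompactSupport {f : ℂ → ℝ} (hf : HasCompactSupport f) :
    ∃ T : ℝ, ∀ x, f x ≠ 0 → ‖x‖ ≤ T := by
  obtain ⟨T, hT⟩ := hf.isBounded.exists_norm_le
  exact ⟨T, fun x hx => hT x (subset_tsupport f hx)⟩

theorem integrable_prod_kernel {u k f : ℂ → ℝ} (hu : LocallyIntegrable u)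
    (hk : Continuous k) (hkc : HasCompactSupport k) (hf : Continuous f) (hfc : HasCompactSupport f) :
    Integrable (fun q : ℂ × ℂ => u q.1 * (k (q.1 - q.2) * f q.2)) ((volume : Measure ℂ).prod (volume : Measure ℂ)) := by
  obtain ⟨T₁, hT₁⟩ := exists_forall_norm_le_of_hasCompactSupport hkc
  obtain ⟨T₂, hT₂⟩ := exists_forall_norm_le_of_hasCompactSupport hfc
  obtain ⟨B, hB⟩ := hkc.exists_bound_of_continuous hk
  set K := closedBall (0 : ℂ) (T₁ + T₂) with hK
  have i1 : Integrable (K.indicator u) :=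
    (integrable_indicator_iff measurableSet_closedBall).2
      (hu.integrableOn_isCompact (isCompact_closedBall _ _))
  have i2 := (i1.mul_prod (hf.integrable_of_hasCompactSupport (μ := (volume : Measure ℂ)) hfc)).bdd_mul
    (f := fun q : ℂ × ℂ => k (q.1 - q.2)) (c := B)
    (hk.comp (by fun_prop)).aestronglyMeasurable (Eventually.of_forall fun q => hB _)
  refine i2.congr (Eventually.of_forall fun q => ?_)
  simp only
  by_cases h1 : k (q.1 - q.2) = 0
  · rw [h1]; ring
  by_cases h2 : f q.2 = 0
  · rw [h2]; ring
  have h3 : q.1 ∈ K := by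
    rw [hK, mem_closedBall, dist_zero_right]
    have := norm_add_le (q.1 - q.2) q.2
    rw [sub_add_cancel] at this
    linarith [hT₁ _ h1, hT₂ _ h2]
  rw [indicator_of_mem h3]; ring

/-- The integrability behind Fubini's theorem for the convolution of `μ` with a cut-off
logarithm. -/
theorem integrable_prod_cutLog (ξ : ContDiffBump (0 : ℂ)) (h : IsDoublingWith c μ) {f : ℂ → ℝ}
    (hf : Continuous f) (hfc : HasCompactSupport f) :
    Integrable (fun q : ℂ × ℂ => cutLog ξ (q.1 - q.2) * f q.2) (μ.prod volume) := by
  have := h.isLocallyFiniteMeasure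
  obtain ⟨T, hT⟩ := exists_forall_norm_le_of_hasCompactSupport hfc
  obtain ⟨B, hB⟩ := hfc.exists_bound_of_continuous hf
  have hi : ∀ w : ℂ, Integrable fun z => cutLog ξ (w - z) := fun w => by
    have := integrable_cutLog_sub ξ isDoublingWith_volume w
    refine this.congr (Eventually.of_forall fun z => ?_)
    simp only
    rw [← cutLog_neg, neg_sub]
  have hmeas : AEStronglyMeasurable (fun q : ℂ × ℂ => cutLog ξ (q.1 - q.2) * f q.2)
      (μ.prod volume) :=
    (((measurable_cutLog ξ).comp (by fun_prop)).mul
      (hf.measurable.comp measurable_snd)).aestronglyMeasurable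
  rw [integrable_prod_iff hmeas]
  constructor
  · exact Eventually.of_forall fun w => (hi w).mul_bdd (c := B) hf.aestronglyMeasurable
      (Eventually.of_forall hB)
  · set K := closedBall (0 : ℂ) (ξ.rOut + T) with hK
    set J := (∫ z, ‖cutLog ξ z‖) * B with hJ
    have i1 : Integrable (K.indicator fun _ => J) μ :=
      (integrable_indicator_iff measurableSet_closedBall).2
        (integrableOn_const (isCompact_closedBall _ _).measure_lt_top.ne)
    refine i1.mono' hmeas.norm.integral_prod_right' (Eventually.of_forall fun w => ?_)
    rw [Real.norm_of_nonneg (integral_nonneg fun z => norm_nonneg _)]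
    by_cases hw : w ∈ K
    · rw [indicator_of_mem hw, hJ]
      calc ∫ z, ‖cutLog ξ (w - z) * f z‖ ≤ ∫ z, ‖cutLog ξ (w - z)‖ * B := by
            refine integral_mono_of_nonneg (Eventually.of_forall fun _ => norm_nonneg _)
              ((hi w).norm.mul_const B) (Eventually.of_forall fun z => ?_)
            simp only [norm_mul]
            gcongr
            exact hB z
        _ = (∫ z, ‖cutLog ξ z‖) * B := by
            rw [integral_mul_const, integral_sub_left_eq_self (fun z => ‖cutLog ξ z‖)]
    · rw [indicator_of_notMem hw]
      refine le_of_eq (integral_eq_zero_of_ae (Eventually.of_forall fun z => ?_))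
      simp only [Pi.zero_apply, norm_eq_zero]
      by_contra hne
      obtain ⟨h1, h2⟩ := mul_ne_zero_iff.1 hne
      refine hw ?_
      rw [hK, mem_closedBall, dist_zero_right]
      have h3 : ‖w - z‖ < ξ.rOut := lt_of_not_ge fun h4 => h1 (cutLog_of_le_norm h4)
      have := norm_add_le (w - z) z
      rw [sub_add_cancel] at this
      linarith [hT _ h2]

end Representation

section Representation

open scoped ContDiff Topology
open Filter

variable {c : ℝ} {κ μ : Measure ℂ} {φ : ℂ → EReal}

/-- The weak form of the identity `2πφ = φ ⋆ defectKernel + μ ⋆ cutLog`. -/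
theorem IsLaplacian.integral_mul_eq (hφ : IsLaplacian φ μ) (h : IsDoublingWith c μ)
    (ξ : ContDiffBump (0 : ℂ)) {f : ℂ → ℝ} (hf : ContDiff ℝ ∞ f) (hfc : HasCompactSupport f) :
    2 * Real.pi * ∫ z, f z * (φ z).toReal =
      (∫ z, f z * ∫ w, (φ w).toReal * defectKernel ξ (z - w)) +
      ∫ z, f z * (∫ w, cutLog ξ (w - z) ∂μ) := by
  have := h.isLocallyFiniteMeasure
  set u : ℂ → ℝ := fun z => (φ z).toReal with hu
  have hul : LocallyIntegrable u := hφ.locallyIntegrable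
  have hcut : LocallyIntegrable (cutLog ξ) := by
    have := integrable_cutLog_sub ξ isDoublingWith_volume 0
    simp only [sub_zero] at this
    exact this.locallyIntegrable
  set ψ : ℂ → ℝ := fun w => ∫ x, cutLog ξ x * f (w - x) with hψ
  have hψd : ContDiff ℝ ∞ ψ := contDiff_integral_mul_sub hcut hf hfc
  have hcutc : HasCompactSupport (cutLog ξ) := ξ.hasCompactSupport.mul_right
  have hψc : HasCompactSupport ψ := hcutc.convolution (ContinuousLinearMap.mul ℝ ℝ) hfc
  have hsub : ∀ (g : ℂ → ℝ) (w : ℂ), ∫ x, cutLog ξ x * g (w - x) = ∫ z, cutLog ξ (w - z) * g z := by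
    intro g w
    rw [← integral_sub_left_eq_self (fun x => cutLog ξ x * g (w - x)) volume w]
    simp only [sub_sub_cancel]
  have hΔ : ∀ w, Laplacian.laplacian ψ w =
      2 * Real.pi * f w - ∫ z, defectKernel ξ (w - z) * f z := by
    intro w
    rw [laplacian_integral_mul_sub hcut hf hfc, hsub, integral_cutLog_mul_laplacian ξ hf hfc]
  have key := hφ.integral_mul_laplacian ψ hψd hψc
  have hdk := contDiff_defectKernel ξ
  have hdkc := hasCompactSupport_defectKernel ξ
  have i1 := integrable_prod_kernel hul hdk.continuous hdkc hf.continuous hfc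
  have i2 := integrable_prod_cutLog ξ h hf.continuous hfc
  have i3 : Integrable fun w => u w * f w :=
    hul.integrable_smul_right_of_hasCompactSupport hf.continuous hfc
  have i4 : Integrable fun w => ∫ z, u w * (defectKernel ξ (w - z) * f z) := i1.integral_prod_left
  have e1 : ∫ w, u w * Laplacian.laplacian ψ w =
      2 * Real.pi * (∫ z, f z * u z) - ∫ z, f z * ∫ w, u w * defectKernel ξ (z - w) := by
    have : ∀ w, u w * Laplacian.laplacian ψ w = 2 * Real.pi * (u w * f w) -
        ∫ z, u w * (defectKernel ξ (w - z) * f z) := fun w => by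
      rw [hΔ, integral_const_mul]; ring
    simp only [this]
    rw [integral_sub (i3.const_mul _) i4, integral_const_mul, integral_integral_swap i1]
    congr 2
    · simp only [mul_comm]
    · funext z
      rw [← integral_const_mul]
      refine integral_congr_ae (Eventually.of_forall fun w => ?_)
      simp only
      rw [← defectKernel_neg, neg_sub]; ring
  have e2 : ∫ w, ψ w ∂μ = ∫ z, f z * (∫ w, cutLog ξ (w - z) ∂μ) := by
    simp only [hψ, hsub]
    rw [integral_integral_swap i2]
    refine integral_congr_ae (Eventually.of_forall fun z => ?_)
    simp only
    rw [integral_mul_const, mul_comm]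
  rw [e1, e2] at key
  linarith

/-- On a disk, a function with doubling Laplacian agrees almost everywhere with the sum of a harmonic
function and the logarithmic potential of the restriction of its Laplacian to a larger disk. -/
theorem IsLaplacian.exists_harmonic_ae (hφ : IsLaplacian φ μ) (h : IsDoublingWith c μ) (η : ℂ)
    {R : ℝ} (hR : 0 < R) : ∃ H : ℂ → ℝ, InnerProductSpace.HarmonicOnNhd H (ball η R) ∧
      ∀ᵐ z, z ∈ ball η R → 2 * Real.pi * (φ z).toReal =
        H z + ∫ w in ball η (R + 2), Real.log ‖w - z‖ ∂μ := by
  have := h.isLocallyFiniteMeasure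
  let ξ : ContDiffBump (0 : ℂ) := ⟨2 * R + 4, 2 * R + 5, by linarith, by linarith⟩
  let ξ₀ : ContDiffBump (0 : ℂ) := ⟨1, 2, one_pos, one_lt_two⟩
  set u : ℂ → ℝ := fun z => (φ z).toReal with hu
  have hul : LocallyIntegrable u := hφ.locallyIntegrable
  set B := ball η (R + 2) with hB
  have hdk := contDiff_defectKernel ξ
  have hdkc := hasCompactSupport_defectKernel ξ
  have hrl := contDiff_ringLog ξ ξ₀
  have hrlc := hasCompactSupport_ringLog ξ ξ₀
  have hone : LocallyIntegrable (fun _ : ℂ => (1 : ℝ)) (μ.restrict Bᶜ) := locallyIntegrable_const 1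
  set H₁ : ℂ → ℝ := fun z => ∫ w, u w * defectKernel ξ (z - w) with hH₁
  set H₂ : ℂ → ℝ := fun z => ∫ w in Bᶜ, 1 * ringLog ξ ξ₀ (z - w) ∂μ with hH₂
  have hH₁d : ContDiff ℝ ∞ H₁ := contDiff_integral_mul_sub hul hdk hdkc
  have hH₂d : ContDiff ℝ ∞ H₂ := contDiff_integral_mul_sub hone hrl hrlc
  have hin : ∀ z ∈ ball η R, ∀ w ∈ B, ‖w - z‖ < 2 * R + 4 := by
    intro z hz w hw
    rw [hB, mem_ball] at hw
    rw [mem_ball] at hz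
    rw [← dist_eq_norm]
    have := dist_triangle_right w z η
    linarith
  have hout : ∀ z ∈ ball η R, ∀ w ∈ Bᶜ, 2 < ‖z - w‖ := by
    intro z hz w hw
    rw [hB, mem_compl_iff, mem_ball, not_lt] at hw
    rw [mem_ball] at hz
    rw [← dist_eq_norm, dist_comm z w]
    have := dist_triangle w z η
    linarith
  refine ⟨fun z => H₁ z + H₂ z, fun z hz => ⟨?_, ?_⟩, ?_⟩
  · exact ((hH₁d.add hH₂d).of_le two_le_infty).contDiffAt
  · filter_upwards [isOpen_ball.mem_nhds hz] with z hz
    have e := (hH₁d.of_le two_le_infty).contDiffAt.laplacian_add (x := z)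
      (hH₂d.of_le two_le_infty).contDiffAt
    change Laplacian.laplacian (H₁ + H₂) z = 0
    rw [e, hH₁, hH₂, laplacian_integral_mul_sub hul hdk hdkc, laplacian_integral_mul_sub hone hrl hrlc]
    have e1 : ∫ w, u w * Laplacian.laplacian (defectKernel ξ) (z - w) =
        ∫ w, defectKernel ξ (z - w) ∂μ := by
      have := hφ.integral_mul_laplacian (fun w => defectKernel ξ (z - w))
        (hdk.comp (contDiff_const.sub contDiff_id)) (hdkc.comp_homeomorph (Homeomorph.subLeft z))
      simpa only [laplacian_comp_sub_left (hdk.of_le two_le_infty)] using this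
    have e2 : ∫ w in Bᶜ, 1 * Laplacian.laplacian (ringLog ξ ξ₀) (z - w) ∂μ =
        -∫ w in Bᶜ, defectKernel ξ (z - w) ∂μ := by
      rw [← integral_neg]
      refine setIntegral_congr_fun measurableSet_ball.compl fun w hw => ?_
      simp only [one_mul]
      exact laplacian_ringLog (hout z hz w hw)
    have e3 : ∫ w in B, defectKernel ξ (z - w) ∂μ = 0 := by
      refine setIntegral_eq_zero_of_forall_eq_zero fun w hw => defectKernel_of_norm_lt ?_
      rw [← neg_sub, norm_neg]
      exact hin z hz w hw
    have hi : Integrable (fun w => defectKernel ξ (z - w)) μ :=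
      (hdk.continuous.comp (by fun_prop)).integrable_of_hasCompactSupport
        (hdkc.comp_homeomorph (Homeomorph.subLeft z))
    rw [e1, e2, ← integral_add_compl measurableSet_ball hi, e3]
    ring
  · have hV := h.continuous_integral_log η (R + 2)
    set V : ℂ → ℝ := fun z => ∫ w in B, Real.log ‖w - z‖ ∂μ with hVdef
    have hsplit : ∀ z ∈ ball η R, ∫ w, cutLog ξ (w - z) ∂μ = V z + H₂ z := by
      intro z hz
      rw [← integral_add_compl measurableSet_ball (integrable_cutLog_sub ξ h z)]
      congr 1
      · refine setIntegral_congr_fun measurableSet_ball fun w hw => ?_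
        exact cutLog_of_norm_le (hin z hz w hw).le
      · refine setIntegral_congr_fun measurableSet_ball.compl fun w hw => ?_
        simp only [one_mul]
        rw [ringLog_of_le_norm (hout z hz w hw).le, ← cutLog_neg, neg_sub]
    have hl : LocallyIntegrableOn (fun z => 2 * Real.pi * u z - (H₁ z + H₂ z + V z)) (ball η R) := by
      refine LocallyIntegrable.locallyIntegrableOn ?_ _
      exact (hul.smul (2 * Real.pi)).sub
        ((hH₁d.continuous.add hH₂d.continuous).add hV).locallyIntegrable
    have := isOpen_ball.ae_eq_zero_of_integral_contDiff_smul_eq_zero hl ?_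
    · filter_upwards [this] with z hz hzR
      have := hz hzR
      linarith
    · intro f hf hfc hfs
      have key := hφ.integral_mul_eq h ξ hf hfc
      have e1 : ∫ z, f z * (∫ w, cutLog ξ (w - z) ∂μ) = ∫ z, f z * (V z + H₂ z) := by
        refine integral_congr_ae (Eventually.of_forall fun z => ?_)
        simp only
        by_cases hz : f z = 0
        · rw [hz, zero_mul, zero_mul]
        · rw [hsplit z (hfs (subset_tsupport f hz))]
      have hI : ∀ {g : ℂ → ℝ}, Continuous g → Integrable fun z => f z * g z := fun hg =>
        (hf.continuous.mul hg).integrable_of_hasCompactSupport hfc.mul_right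
      have i3 : Integrable fun w => f w * u w :=
        hul.integrable_smul_left_of_hasCompactSupport hf.continuous hfc
      have e2 : ∀ z, f z • (2 * Real.pi * u z - (H₁ z + H₂ z + V z)) =
          2 * Real.pi * (f z * u z) - (f z * H₁ z + f z * (V z + H₂ z)) := fun z => by
        rw [smul_eq_mul]; ring
      simp only [e2]
      have i4 : Integrable fun z => f z * H₁ z := hI hH₁d.continuous
      have i5 : Integrable fun z => f z * (V z + H₂ z) := hI (hV.add hH₂d.continuous)
      have i6 : Integrable fun z => f z * H₁ z + f z * (V z + H₂ z) := i4.add i5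
      rw [integral_sub (i3.const_mul _) i6, integral_const_mul, integral_add i4 i5, key, e1]
      ring

end Representation

section Everywhere

open scoped Topology
open Filter

variable {c : ℝ} {μ : Measure ℂ} {φ : ℂ → EReal}

/-- A property that holds almost everywhere in the plane holds almost everywhere on almost every
circle about a given point. -/
theorem ae_ae_circleMap {P : ℂ → Prop} (hP : ∀ᵐ z, P z) (z₀ : ℂ) :
    ∀ᵐ r ∂volume.restrict (Ioi (0 : ℝ)), ∀ᵐ θ ∂volume.restrict (Ioc (0 : ℝ) (2 * Real.pi)),
      P (circleMap z₀ r θ) := by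
  set t := toMeasurable volume {z | ¬P z} with ht
  have htm : MeasurableSet t := measurableSet_toMeasurable _ _
  have ht0 : volume t = 0 := by rw [ht, measure_toMeasurable]; exact hP
  have htP : ∀ z, z ∉ t → P z := fun z hz => by
    by_contra h
    exact hz (subset_toMeasurable _ _ h)
  -- the reflection about `z₀` moves the interval `(-π, π)` of polar angles to `(0, 2π)`
  have h1 : ∀ᵐ z : ℂ, z₀ - z ∉ t :=
    (Measure.measurePreserving_sub_left volume z₀).quasiMeasurePreserving.ae (measure_eq_zero_iff_ae_notMem.1 ht0)
  have hf : Measurable fun z : ℂ => t.indicator (fun _ => (1 : ℝ≥0∞)) (z₀ - z) :=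
    (measurable_const.indicator htm).comp (measurable_const.sub measurable_id)
  have h2 : ∫⁻ z : ℂ, t.indicator (fun _ => (1 : ℝ≥0∞)) (z₀ - z) = 0 := by
    rw [lintegral_eq_zero_iff hf]
    filter_upwards [h1] with z hz
    simp [hz]
  have hsymm : Measurable fun p : ℝ × ℝ => Complex.polarCoord.symm p := by
    simp only [Complex.polarCoord_symm_apply]
    fun_prop
  rw [← Complex.lintegral_comp_polarCoord_symm, lintegral_eq_zero_iff (by fun_prop),
    polarCoord_target, Measure.volume_eq_prod, ← Measure.prod_restrict] at h2
  filter_upwards [Measure.ae_ae_of_ae_prod h2, ae_restrict_mem measurableSet_Ioi] with r hr hr0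
  have hr0 : 0 < r := hr0
  replace hr := (ae_restrict_iff' measurableSet_Ioo).1 hr
  have h3 := (measurePreserving_sub_right volume Real.pi).quasiMeasurePreserving.ae hr
  have h4 : ∀ᵐ θ : ℝ, θ ≠ 2 * Real.pi := by rw [ae_iff]; simp
  rw [ae_restrict_iff' measurableSet_Ioc]
  filter_upwards [h3, h4] with θ h5 h6 h7
  refine htP _ fun hmem => ?_
  have h8 : θ - Real.pi ∈ Ioo (-Real.pi) Real.pi :=
    ⟨by linarith [h7.1], by linarith [lt_of_le_of_ne h7.2 h6]⟩
  have h9 := h5 h8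
  have e : z₀ - Complex.polarCoord.symm (r, θ - Real.pi) = circleMap z₀ r θ := by
    rw [Complex.polarCoord_symm_apply, circleMap, Complex.exp_mul_I, Real.cos_sub_pi,
      Real.sin_sub_pi]
    push_cast
    ring
  simp only [e, indicator_of_mem hmem, Pi.zero_apply, smul_eq_mul, mul_one, ENNReal.ofReal_eq_zero] at h9
  linarith

theorem circleMean_le {z₀ : ℂ} {r a : ℝ}
    (h : ∀ᵐ θ ∂volume.restrict (Ioc (0 : ℝ) (2 * Real.pi)), φ (circleMap z₀ r θ) ≤ a) :
    circleMean φ z₀ r ≤ a := by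
  set ν := volume.restrict (Ioc (0 : ℝ) (2 * Real.pi)) with hν
  have hne : NeZero ν := ⟨by
    rw [hν, Ne, Measure.restrict_eq_zero, Real.volume_Ioc]
    simp [Real.pi_pos]⟩
  have h1 : laverage ν (fun θ => (φ (circleMap z₀ r θ)).toENNReal) ≤ ENNReal.ofReal a := by
    rw [← laverage_const ν (ENNReal.ofReal a), laverage_eq, laverage_eq]
    gcongr 1
    refine lintegral_mono_ae ?_
    filter_upwards [h] with θ hθ
    simpa using EReal.toENNReal_le_toENNReal hθ
  have h2 : ENNReal.ofReal (-a) ≤ laverage ν (fun θ => (-φ (circleMap z₀ r θ)).toENNReal) := by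
    rw [← laverage_const ν (ENNReal.ofReal (-a)), laverage_eq, laverage_eq]
    gcongr 1
    refine lintegral_mono_ae ?_
    filter_upwards [h] with θ hθ
    have := EReal.toENNReal_le_toENNReal (EReal.neg_le_neg_iff.2 hθ)
    rwa [← EReal.coe_neg, EReal.toENNReal_of_ne_top (EReal.coe_ne_top _), EReal.toReal_coe] at this
  have h3 : circleMean φ z₀ r ≤ ((ENNReal.ofReal a : ℝ≥0∞) : EReal) - (ENNReal.ofReal (-a) : ℝ≥0∞) :=
    EReal.sub_le_sub (EReal.coe_ennreal_le_coe_ennreal_iff.2 h1)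
      (EReal.coe_ennreal_le_coe_ennreal_iff.2 h2)
  refine h3.trans (le_of_eq ?_)
  rw [EReal.coe_ennreal_ofReal, EReal.coe_ennreal_ofReal, ← EReal.coe_sub]
  congr 1
  rcases le_total 0 a with ha | ha
  · rw [max_eq_left ha, max_eq_right (by linarith)]; ring
  · rw [max_eq_right ha, max_eq_left (by linarith)]; ring

/-- A subharmonic function that agrees almost everywhere with a continuous function on an open set
agrees with it everywhere there. -/
theorem IsSubharmonic.eq_of_ae_eq (hφ : IsSubharmonic φ) {U : Set ℂ} (hU : IsOpen U) {v : ℂ → ℝ}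
    (hv : ContinuousOn v U) (h : ∀ᵐ z, z ∈ U → φ z = v z) {z₀ : ℂ} (hz₀ : z₀ ∈ U) :
    φ z₀ = v z₀ := by
  have hvc : ContinuousAt v z₀ := hv.continuousAt (hU.mem_nhds hz₀)
  refine le_antisymm ?_ ?_
  · refine EReal.le_of_forall_lt_iff_le.1 fun a ha => ?_
    have ha' : v z₀ < a := EReal.coe_lt_coe_iff.1 ha
    obtain ⟨δ, hδ, hball⟩ := Metric.mem_nhds_iff.1
      (Filter.inter_mem (hU.mem_nhds hz₀) (hvc.eventually (gt_mem_nhds ha')))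
    have h1 := ae_ae_circleMap h z₀
    rw [ae_restrict_iff' measurableSet_Ioi] at h1
    have h2 : ∃ r ∈ Ioo 0 δ, ∀ᵐ θ ∂volume.restrict (Ioc (0 : ℝ) (2 * Real.pi)),
        circleMap z₀ r θ ∈ U → φ (circleMap z₀ r θ) = v (circleMap z₀ r θ) := by
      by_contra hcon
      have h3 : Ioo 0 δ ⊆ {r | ¬(r ∈ Ioi (0 : ℝ) →
          ∀ᵐ θ ∂volume.restrict (Ioc (0 : ℝ) (2 * Real.pi)),
          circleMap z₀ r θ ∈ U → φ (circleMap z₀ r θ) = v (circleMap z₀ r θ))} :=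
        fun r hr hr2 => hcon ⟨r, hr, hr2 hr.1⟩
      have h4 := measure_mono_null h3 h1
      rw [Real.volume_Ioo] at h4
      simp at h4
      linarith
    obtain ⟨r, hr, h3⟩ := h2
    refine (hφ.le_circleMean z₀ r hr.1).trans (circleMean_le ?_)
    filter_upwards [h3] with θ hθ
    have hmem : circleMap z₀ r θ ∈ ball z₀ δ := by
      rw [mem_ball, dist_eq_norm, circleMap_sub_center, norm_circleMap_zero, abs_of_pos hr.1]
      exact hr.2
    obtain ⟨h5, h6⟩ := hball hmem
    rw [hθ h5]
    exact EReal.coe_le_coe_iff.2 (le_of_lt h6)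
  · by_contra! hlt
    obtain ⟨a, ha1, ha2⟩ := EReal.lt_iff_exists_real_btwn.1 hlt
    have ha2' : a < v z₀ := EReal.coe_lt_coe_iff.1 ha2
    have h1 : ∀ᶠ z in 𝓝 z₀, z ∈ U ∧ a < v z ∧ φ z < a :=
      Filter.Eventually.and (hU.mem_nhds hz₀)
        ((hvc.eventually (lt_mem_nhds ha2')).and (hφ.upperSemicontinuous z₀ a ha1))
    obtain ⟨W, hW, hWo, hzW⟩ := _root_.eventually_nhds_iff.1 h1
    have h2 : W ⊆ {z | ¬(z ∈ U → φ z = v z)} := by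
      intro z hz hz2
      obtain ⟨h3, h4, h5⟩ := hW z hz
      rw [hz2 h3, EReal.coe_lt_coe_iff] at h5
      linarith
    exact (hWo.measure_pos volume ⟨z₀, hzW⟩).ne' (measure_mono_null h2 h)

/-- On a disk, a subharmonic function with doubling Laplacian is the sum of the real part of an
analytic function and the logarithmic potential of the restriction of its Laplacian to a larger
disk; in particular it is finite. -/
theorem IsSubharmonic.exists_analytic (hφ : IsSubharmonic φ) (hφμ : IsLaplacian φ μ)
    (h : IsDoublingWith c μ) (η : ℂ) {R : ℝ} (hR : 0 < R) :
    ∃ G : ℂ → ℂ, DifferentiableOn ℂ G (ball η R) ∧ ∀ z ∈ ball η R, φ z ≠ ⊥ ∧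
      (φ z).toReal = (G z).re +
        1 / (2 * Real.pi) * ∫ w in ball η (R + 2), Real.log ‖w - z‖ ∂μ := by
  obtain ⟨H, hH, hae⟩ := hφμ.exists_harmonic_ae h η hR
  obtain ⟨G, hG, hGH⟩ := hH.exists_analyticOnNhd_ball_re_eq
  have hpi : (2 * Real.pi : ℝ) ≠ 0 := by positivity
  set v : ℂ → ℝ := fun z => 1 / (2 * Real.pi) * (H z + ∫ w in ball η (R + 2), Real.log ‖w - z‖ ∂μ)
    with hv
  have hvc : ContinuousOn v (ball η R) := by
    refine continuousOn_const.mul (ContinuousOn.add (fun z hz => ?_)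
      (h.continuous_integral_log η (R + 2)).continuousOn)
    exact (hH z hz).1.continuousAt.continuousWithinAt
  have heq : ∀ᵐ z, z ∈ ball η R → φ z = v z := by
    filter_upwards [hae, hφμ.ae_ne_bot] with z hz hb hzR
    rw [← EReal.coe_toReal (hφ.ne_top z) hb, hv]
    simp only
    rw [← hz hzR]
    congr 1
    field_simp
  refine ⟨fun z => 1 / (2 * Real.pi) * G z, fun z hz =>
    ((hG z hz).differentiableAt.const_mul _).differentiableWithinAt, fun z hz => ?_⟩
  have h1 := hφ.eq_of_ae_eq isOpen_ball hvc heq hz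
  refine ⟨by rw [h1]; exact EReal.coe_ne_bot _, ?_⟩
  have h2 : (G z).re = H z := hGH hz
  have h3 : ((1 / (2 * Real.pi) : ℂ) * G z).re = 1 / (2 * Real.pi) * (G z).re := by
    rw [← Complex.re_ofReal_mul]; push_cast; rfl
  rw [h1, EReal.toReal_coe, h3, h2, hv]
  ring

end Everywhere

/-! ### The function `ρ` and the distance `d_φ` -/

section Rho

open scoped Topology
open Filter

variable {c : ℝ} {μ : Measure ℂ}

theorem IsDoubling.exists_isDoublingWith (hμ : IsDoubling μ) (hμ0 : μ ≠ 0)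
    (hfin : ∀ K : Set ℂ, IsCompact K → μ K < ⊤) : ∃ c, IsDoublingWith c μ := by
  obtain ⟨C, hC⟩ := hμ
  have hlt : ∀ z r, μ (ball z r) < ⊤ := fun z r =>
    (measure_mono ball_subset_closedBall).trans_lt (hfin _ (isCompact_closedBall z r))
  refine ⟨C, hlt, fun z r hr => ?_, fun z r hr => ?_⟩
  · refine ENNReal.toReal_pos (fun h0 => hμ0 ?_) (hlt z r).ne
    have h1 : ∀ n : ℕ, μ (ball z (2 ^ n * r)) = 0 := by
      intro n
      induction n with
      | zero => simpa using h0
      | succ n ih =>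
        have := hC z (2 ^ n * r) (by positivity)
        rw [ih, mul_zero] at this
        rw [pow_succ', mul_assoc]
        exact le_antisymm this zero_le
    rw [← Measure.measure_univ_eq_zero]
    refine measure_mono_null (fun w _ => ?_) (measure_iUnion_null h1)
    obtain ⟨n, hn⟩ := pow_unbounded_of_one_lt (dist w z / r) one_lt_two
    rw [div_lt_iff₀ hr] at hn
    exact mem_iUnion.2 ⟨n, hn⟩
  · rw [measureReal_def, measureReal_def]
    have := ENNReal.toReal_mono (ENNReal.mul_ne_top ENNReal.coe_ne_top (hlt z r).ne) (hC z r hr)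
    rwa [ENNReal.toReal_mul, ENNReal.coe_toReal] at this

theorem IsDoublingWith.isUnifLocDoublingMeasure (h : IsDoublingWith c μ) :
    IsUnifLocDoublingMeasure μ := by
  have hc := h.one_le
  refine ⟨⟨(c ^ 2).toNNReal, ?_⟩⟩
  filter_upwards [self_mem_nhdsWithin] with ε hε x
  have hε : 0 < ε := hε
  have h1 : μ.real (ball x (2 ^ 2 * ε)) ≤ c ^ 2 * μ.real (ball x ε) := h.two_pow_le 2 x hε
  have h2 : μ (ball x (2 ^ 2 * ε)) ≤ (c ^ 2).toNNReal * μ (ball x ε) := by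
    rw [← ENNReal.ofReal_toReal (h.lt_top x (2 ^ 2 * ε)).ne, ← ENNReal.ofReal_toReal (h.lt_top x ε).ne]
    refine (ENNReal.ofReal_le_ofReal h1).trans (le_of_eq ?_)
    rw [ENNReal.ofReal_mul (by positivity)]
    rfl
  calc μ (closedBall x (2 * ε)) ≤ μ (ball x (2 ^ 2 * ε)) :=
        measure_mono (closedBall_subset_ball (by linarith))
    _ ≤ _ := h2
    _ ≤ _ := by gcongr; exact ball_subset_closedBall

/-- Circles are null sets for doubling measures: at a density point of the circle, disks touching
it from inside would have to meet the circle in a set of nearly full measure. -/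
theorem IsDoublingWith.measure_sphere (h : IsDoublingWith c μ) (η : ℂ) {r : ℝ} (hr : 0 < r) :
    μ (sphere η r) = 0 := by
  have := h.isUnifLocDoublingMeasure
  have := h.isLocallyFiniteMeasure
  by_contra hne
  have h1 := IsUnifLocDoublingMeasure.ae_tendsto_measure_inter_div μ (sphere η r) 2
  have hnb : (ae (μ.restrict (sphere η r))).NeBot := by
    rw [ae_neBot, Ne, Measure.restrict_eq_zero]; exact hne
  obtain ⟨x, hx, hxS⟩ := (h1.and (ae_restrict_mem isClosed_sphere.measurableSet)).exists
  have hx' : ‖x - η‖ = r := by rwa [mem_sphere, dist_eq_norm] at hxS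
  have h2 := hx (l := 𝓝[>] (0 : ℝ)) (fun δ => x + ((2 * δ / r : ℝ) : ℂ) * (η - x)) id tendsto_id (by
    filter_upwards [self_mem_nhdsWithin] with δ hδ
    have hδ : 0 < δ := hδ
    rw [mem_closedBall, dist_eq_norm, sub_add_cancel_left, norm_neg, norm_mul, Complex.norm_real,
      norm_sub_rev, hx', Real.norm_of_nonneg (by positivity), id]
    field_simp
    rfl)
  have h3 : Tendsto (fun j : ℝ => μ (sphere η r ∩
      closedBall (x + ((2 * j / r : ℝ) : ℂ) * (η - x)) (id j)) /
      μ (closedBall (x + ((2 * j / r : ℝ) : ℂ) * (η - x)) (id j))) (𝓝[>] (0 : ℝ)) (𝓝 0) := by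
    refine tendsto_const_nhds.congr' ?_
    filter_upwards [Ioo_mem_nhdsGT (show 0 < r / 2 by positivity)] with δ hδ
    have : sphere η r ∩ closedBall (x + ((2 * δ / r : ℝ) : ℂ) * (η - x)) (id δ) = ∅ := by
      rw [eq_empty_iff_forall_notMem]
      rintro y ⟨hy1, hy2⟩
      rw [mem_sphere] at hy1
      rw [mem_closedBall, id] at hy2
      have h4 : dist (x + ((2 * δ / r : ℝ) : ℂ) * (η - x)) η = r - 2 * δ := by
        rw [dist_eq_norm, show x + ((2 * δ / r : ℝ) : ℂ) * (η - x) - η =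
          ((1 - 2 * δ / r : ℝ) : ℂ) * (x - η) by push_cast; ring, norm_mul, Complex.norm_real, hx',
          Real.norm_of_nonneg]
        · field_simp
        · rw [sub_nonneg, div_le_one hr]; linarith [hδ.2]
      have := dist_triangle y (x + ((2 * δ / r : ℝ) : ℂ) * (η - x)) η
      linarith [hδ.1]
    rw [this, measure_empty, ENNReal.zero_div]
  exact zero_ne_one (tendsto_nhds_unique h3 h2)

theorem IsDoublingWith.continuousOn_real_ball (h : IsDoublingWith c μ) (η : ℂ) :
    ContinuousOn (fun r => μ.real (ball η r)) (Ioi 0) := by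
  intro r₀ hr₀
  refine ContinuousAt.continuousWithinAt ?_
  have e : (fun r => μ.real (ball η r)) =
      fun r => ∫ w, (ball η r).indicator (fun _ => (1 : ℝ)) w ∂μ := by
    funext r
    rw [integral_indicator_const _ measurableSet_ball, smul_eq_mul, mul_one]
  rw [e]
  refine continuousAt_of_dominated (bound := (ball η (r₀ + 1)).indicator fun _ => (1 : ℝ))
    (Eventually.of_forall fun r => ?_) ?_ ?_ ?_
  · exact (measurable_const.indicator measurableSet_ball).aestronglyMeasurable
  · filter_upwards [gt_mem_nhds (show r₀ < r₀ + 1 by linarith)] with r hr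
    refine Eventually.of_forall fun w => ?_
    rw [norm_indicator_eq_indicator_norm]
    simp only [norm_one]
    exact indicator_le_indicator_of_subset (ball_subset_ball hr.le) (fun _ => zero_le_one) w
  · exact (integrable_indicator_iff measurableSet_ball).2
      (integrableOn_const (h.lt_top _ _).ne)
  · have h1 : ∀ᵐ w ∂μ, w ∉ sphere η r₀ := measure_eq_zero_iff_ae_notMem.1 (h.measure_sphere η hr₀)
    filter_upwards [h1] with w hw
    rw [mem_sphere] at hw
    rcases lt_or_gt_of_ne hw with hlt | hgt
    · refine (continuousAt_const (y := (1 : ℝ))).congr ?_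
      filter_upwards [lt_mem_nhds hlt] with r hr
      rw [indicator_of_mem (mem_ball.2 hr)]
    · refine (continuousAt_const (y := (0 : ℝ))).congr ?_
      filter_upwards [gt_mem_nhds hgt] with r hr
      rw [indicator_of_notMem]
      rw [mem_ball, not_lt]; exact hr.le

theorem IsDoublingWith.real_ball_lt (h : IsDoublingWith c μ) (η : ℂ) {r r' : ℝ} (hr : 0 < r)
    (hrr' : r < r') : μ.real (ball η r) < μ.real (ball η r') := by
  set p : ℂ := η + ((r + r') / 2 : ℝ) with hp
  have hpη : dist p η = (r + r') / 2 := by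
    rw [dist_eq_norm, hp, add_sub_cancel_left, Complex.norm_real, Real.norm_of_nonneg (by linarith)]
  have hd : Disjoint (ball η r) (ball p ((r' - r) / 2)) :=
    ball_disjoint_ball (by rw [dist_comm, hpη]; linarith)
  have h1 := h.pos p ((r' - r) / 2) (by linarith)
  have h2 := measureReal_union hd measurableSet_ball (μ := μ) (h₁ := (h.lt_top _ _).ne)
    (h₂ := (h.lt_top _ _).ne)
  have h3 : μ.real (ball η r ∪ ball p ((r' - r) / 2)) ≤ μ.real (ball η r') := by
    refine measureReal_mono (union_subset (ball_subset_ball hrr'.le) (ball_subset_ball' ?_))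
      (h.lt_top _ _).ne
    rw [hpη]; linarith
  linarith

/-- The radius `rho μ η` is attained: circles have measure zero for a doubling measure, so
`r ↦ μ (ball η r)` is continuous, strictly increasing, and takes values below and above `1`. -/
theorem IsDoublingWith.rho_spec (h : IsDoublingWith c μ) (η : ℂ) :
    0 < rho μ η ∧ μ.real (ball η (rho μ η)) = 1 := by
  have hV := h.pos η 1 one_pos
  obtain ⟨n, hn⟩ := exists_pow_lt_of_lt_one
    (show 0 < min (μ.real (ball η 1)) (1 / μ.real (ball η 1)) by positivity) h.revRatio_lt_one
  have h1 : μ.real (ball η (1 / 2 ^ n)) ≤ 1 := by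
    refine (h.real_ball_div_le n η one_pos).trans ?_
    have := hn.trans_le (min_le_right _ _)
    rw [lt_div_iff₀ hV] at this
    exact this.le
  have h2 : 1 ≤ μ.real (ball η (2 ^ n)) := by
    have h3 := h.real_ball_div_le n η (show (0 : ℝ) < 2 ^ n by positivity)
    rw [div_self (by positivity)] at h3
    have h4 := hn.trans_le (min_le_left _ _)
    by_contra! hlt
    have := mul_le_mul_of_nonneg_left hlt.le (pow_nonneg h.revRatio_nonneg n)
    linarith
  have hle : (1 : ℝ) / 2 ^ n ≤ 2 ^ n := by
    have : (1 : ℝ) ≤ 2 ^ n := one_le_pow₀ one_le_two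
    rw [div_le_iff₀ (by positivity)]; nlinarith
  obtain ⟨r, hr, hr1⟩ := intermediate_value_Icc hle ((h.continuousOn_real_ball η).mono
    fun x hx => lt_of_lt_of_le (by positivity) hx.1) ⟨h1, h2⟩
  have hr0 : 0 < r := lt_of_lt_of_le (by positivity) hr.1
  have hiff : ∀ s, μ (ball η s) = 1 ↔ μ.real (ball η s) = 1 := fun s => by
    rw [measureReal_def, ENNReal.toReal_eq_one_iff]
  have e : {s : ℝ | 0 < s ∧ μ (ball η s) = 1} = {r} := by
    ext s
    simp only [mem_ofPred_eq, mem_singleton_iff, hiff]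
    constructor
    · rintro ⟨hs, hs1⟩
      rcases lt_trichotomy s r with hlt | heq | hgt
      · have := h.real_ball_lt η hs hlt
        simp only at hr1
        linarith
      · exact heq
      · have := h.real_ball_lt η hr0 hgt
        simp only at hr1
        linarith
    · rintro rfl
      exact ⟨hr0, hr1⟩
  rw [rho, e, csInf_singleton]
  exact ⟨hr0, hr1⟩

/-- The function `ρ` varies at most polynomially. -/
theorem IsDoublingWith.exists_rho_le (h : IsDoublingWith c μ) : ∃ a : ℕ, ∀ η w : ℂ,
    rho μ η ≤ rho μ w * (2 * (1 + ‖w - η‖ / rho μ η)) ^ a := by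
  have hc := h.one_le
  obtain ⟨a, ha⟩ := exists_pow_lt_of_lt_one (show 0 < 1 / c by positivity) h.revRatio_lt_one
  rw [lt_div_iff₀ (by linarith)] at ha
  refine ⟨a, fun η w => ?_⟩
  obtain ⟨hr, hr1⟩ := h.rho_spec η
  obtain ⟨hs, hs1⟩ := h.rho_spec w
  set r := rho μ η
  set x := 1 + ‖w - η‖ / r with hx
  have hx1 : 1 ≤ x := by
    have : 0 ≤ ‖w - η‖ / r := by positivity
    linarith
  obtain ⟨j, hj1, hj2⟩ := exists_nat_pow_near hx1 (one_lt_two : (1 : ℝ) < 2)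
  have h1 : μ.real (ball w r) ≤ c ^ (j + 1) := by
    have := h.le_of_subset (j + 1) hr (z := η) (z' := w) (r' := r) (by
      rw [dist_eq_norm]
      calc ‖w - η‖ + r = x * r := by rw [hx]; field_simp; ring
        _ ≤ _ := by gcongr)
    rwa [hr1, mul_one] at this
  have h2 : μ.real (ball w (r / 2 ^ (a * (j + 1)))) < 1 := by
    calc _ ≤ revRatio c ^ (a * (j + 1)) * μ.real (ball w r) := h.real_ball_div_le _ w hr
      _ ≤ revRatio c ^ (a * (j + 1)) * c ^ (j + 1) := by
          have := pow_nonneg h.revRatio_nonneg (a * (j + 1))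
          gcongr
      _ = (revRatio c ^ a * c) ^ (j + 1) := by rw [pow_mul, mul_pow]
      _ < 1 := pow_lt_one₀ (mul_nonneg (pow_nonneg h.revRatio_nonneg a) (by linarith)) ha (by omega)
  have h3 : r / 2 ^ (a * (j + 1)) ≤ rho μ w := by
    by_contra! hlt
    have := h.real_mono (ball_subset_ball (x := w) hlt.le)
    linarith
  rw [div_le_iff₀ (by positivity)] at h3
  refine h3.trans ?_
  gcongr
  rw [mul_comm a, pow_mul]
  gcongr
  rw [pow_succ]
  linarith

theorem rho_nonneg (μ : Measure ℂ) (z : ℂ) : 0 ≤ rho μ z := Real.sInf_nonneg fun _ hr => hr.1.le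

theorem rhoLength_nonneg (μ : Measure ℂ) (γ : ℝ → ℂ) : 0 ≤ rhoLength μ γ :=
  intervalIntegral.integral_nonneg zero_le_one fun _ _ => div_nonneg (norm_nonneg _) (rho_nonneg _ _)

theorem rhoDist_nonneg (μ : Measure ℂ) (z ζ : ℂ) : 0 ≤ rhoDist μ z ζ :=
  Real.sInf_nonneg fun _ ⟨γ, _, _, _, hL⟩ => hL ▸ rhoLength_nonneg μ γ

/-- The distance `d_φ` is polynomially bounded; the line segment is a good enough competitor. -/
theorem IsDoublingWith.exists_rhoDist_le (h : IsDoublingWith c μ) : ∃ C : ℝ, 1 ≤ C ∧ ∃ k : ℕ,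
    ∀ z η : ℂ, rhoDist μ z η ≤ C * (1 + ‖z - η‖ / rho μ η) ^ k := by
  obtain ⟨a, ha⟩ := h.exists_rho_le
  refine ⟨2 ^ a, one_le_pow₀ one_le_two, a + 1, fun z η => ?_⟩
  obtain ⟨hr, -⟩ := h.rho_spec η
  set r := rho μ η with hrdef
  set x := 1 + ‖z - η‖ / r with hx
  have hx0 : 0 ≤ ‖z - η‖ / r := by positivity
  set γ : ℝ → ℂ := fun t => z + t * (η - z) with hγ
  have hγd : ContDiff ℝ 1 γ :=
    contDiff_const.add (Complex.ofRealCLM.contDiff.mul contDiff_const)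
  have hγ' : ∀ t, deriv γ t = η - z := by
    intro t
    have h1 : HasDerivAt (fun t : ℝ => (t : ℂ)) 1 t := Complex.ofRealCLM.hasDerivAt
    exact ((h1.mul_const (η - z)).const_add z).deriv.trans (one_mul _)
  have hpc : IsPiecewiseC1 γ :=
    ⟨hγd.continuous.continuousOn, 1, fun i => i, Nat.mono_cast, by simp, by simp,
      fun i _ => hγd.contDiffOn⟩
  have hmem : rhoLength μ γ ∈ {L : ℝ | ∃ γ : ℝ → ℂ, IsPiecewiseC1 γ ∧ γ 0 = z ∧ γ 1 = η ∧
      L = rhoLength μ γ} := ⟨γ, hpc, by simp [hγ], by simp [hγ], rfl⟩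
  have hbdd : BddBelow {L : ℝ | ∃ γ : ℝ → ℂ, IsPiecewiseC1 γ ∧ γ 0 = z ∧ γ 1 = η ∧
      L = rhoLength μ γ} := ⟨0, fun L ⟨γ, _, _, _, hL⟩ => hL ▸ rhoLength_nonneg μ γ⟩
  refine (csInf_le hbdd hmem).trans ((le_abs_self _).trans ?_)
  have hbound : ∀ t ∈ uIoc (0 : ℝ) 1, ‖‖deriv γ t‖ / rho μ (γ t)‖ ≤ 2 ^ a * x ^ (a + 1) := by
    intro t ht
    rw [uIoc_of_le zero_le_one] at ht
    obtain ⟨hs, -⟩ := h.rho_spec (γ t)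
    rw [Real.norm_of_nonneg (by positivity), hγ', norm_sub_rev, div_le_iff₀ hs]
    have h1 := ha η (γ t)
    have h2 : ‖γ t - η‖ ≤ ‖z - η‖ := by
      rw [show γ t - η = ((1 - t : ℝ) : ℂ) * (z - η) by rw [hγ]; push_cast; ring, norm_mul,
        Complex.norm_real, Real.norm_of_nonneg (by linarith [ht.2])]
      exact mul_le_of_le_one_left (norm_nonneg _) (by linarith [ht.1])
    calc ‖z - η‖ = (‖z - η‖ / r) * r := by field_simp
      _ ≤ x * (rho μ (γ t) * (2 * x) ^ a) := by
          gcongr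
          · linarith
          · refine h1.trans ?_
            rw [hx]
            gcongr
      _ = _ := by rw [mul_pow]; ring
  have := intervalIntegral.norm_integral_le_of_norm_le_const hbound
  simpa [rhoLength] using this

end Rho

/-! ### Passage to the limit -/

section Limit

open scoped Topology
open Filter

/-- A normal families argument: a locally bounded sequence of functions that are holomorphic on
disks exhausting the plane converges pointwise along an ultrafilter to an entire function. -/
theorem exists_entire_tendsto {η : ℂ} {f : ℕ → ℂ → ℂ} {R : ℕ → ℝ} (hR : Tendsto R atTop atTop)
    (hf : ∀ n, DifferentiableOn ℂ (f n) (ball η (R n)))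
    (hb : ∀ T, ∃ B, ∀ n, ∀ z ∈ ball η (R n), ‖z - η‖ ≤ T → ‖f n z‖ ≤ B) :
    ∃ F : ℂ → ℂ, Differentiable ℂ F ∧ ∀ z, Tendsto (fun n => f n z) (hyperfilter ℕ) (𝓝 (F z)) := by
  have hle : (hyperfilter ℕ : Filter ℕ) ≤ atTop := by
    rw [← Nat.cofinite_eq_atTop]; exact hyperfilter_le_cofinite
  choose B hB using hb
  set a : ℕ → ℕ → ℂ := fun n k => ((k.factorial : ℂ)⁻¹) * iteratedDeriv k (f n) η with ha
  -- Cauchy estimates for the Taylor coefficients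
  have hcoef : ∀ T, 0 < T → ∀ᶠ n in (hyperfilter ℕ : Filter ℕ), ∀ k, ‖a n k‖ ≤ B T / T ^ k := by
    intro T hT
    filter_upwards [hle (hR.eventually_gt_atTop T)] with n hn k
    have hn : T < R n := hn
    have h1 := Complex.norm_iteratedDeriv_le_of_forall_mem_sphere_norm_le k hT
      (((hf n).mono (closedBall_subset_ball hn)).diffContOnCl_ball subset_rfl)
      (fun z hz => hB T n z (by
        rw [mem_sphere] at hz
        rw [mem_ball]; linarith) (by rw [mem_sphere, dist_eq_norm] at hz; exact hz.le))
    have hk : (0 : ℝ) < k.factorial := by positivity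
    rw [ha]
    simp only [norm_mul, norm_inv, Complex.norm_natCast]
    rw [inv_mul_le_iff₀ hk]
    refine h1.trans (le_of_eq ?_)
    ring
  have hlim : ∀ k, ∃ b : ℂ, Tendsto (fun n => a n k) (hyperfilter ℕ) (𝓝 b) := by
    intro k
    have h1 : ∀ᶠ n in (hyperfilter ℕ : Filter ℕ), a n k ∈ closedBall (0 : ℂ) (B 1 / 1 ^ k) := by
      filter_upwards [hcoef 1 one_pos] with n hn
      simpa using hn k
    obtain ⟨b, -, hb⟩ := (isCompact_closedBall (0 : ℂ) (B 1 / 1 ^ k)).ultrafilter_le_nhds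
      ((hyperfilter ℕ).map fun n => a n k) (le_principal_iff.2 h1)
    exact ⟨b, hb⟩
  choose b hb using hlim
  have hbT : ∀ T, 0 < T → ∀ k, ‖b k‖ ≤ B T / T ^ k := fun T hT k =>
    le_of_tendsto (hb k).norm ((hcoef T hT).mono fun n hn => hn k)
  have hgeom : ∀ s T : ℝ, 0 ≤ s → 0 < T → s ≤ T / 2 → ∀ x w : ℂ, ∀ k : ℕ, ‖x‖ ≤ s →
      ‖w‖ ≤ B T / T ^ k → ‖x ^ k * w‖ ≤ |B T| * (1 / 2) ^ k := by
    intro s T hs hT hsT x w k hx hw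
    rw [norm_mul, norm_pow]
    calc ‖x‖ ^ k * ‖w‖ ≤ (T / 2) ^ k * (|B T| / T ^ k) := by
          gcongr
          · exact hx.trans hsT
          · refine hw.trans ?_
            gcongr
            exact le_abs_self _
      _ = _ := by rw [div_pow, div_pow, one_pow]; field_simp
  have hsummable : ∀ T, Summable fun k : ℕ => |B T| * (1 / 2 : ℝ) ^ k := fun T =>
    summable_geometric_two.mul_left _
  refine ⟨fun z => ∑' k, (z - η) ^ k * b k, ?_, fun z => ?_⟩
  · intro z
    have hT : 0 < 2 * (‖z - η‖ + 1) := by positivity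
    have h1 := Complex.differentiableOn_tsum_of_summable_norm
      (F := fun (k : ℕ) z => (z - η) ^ k * b k) (U := ball η (‖z - η‖ + 1))
      (hsummable (2 * (‖z - η‖ + 1))) (fun k => by fun_prop) isOpen_ball fun k w hw => by
        rw [mem_ball, dist_eq_norm] at hw
        exact hgeom (‖z - η‖ + 1) _ (by positivity) hT (by linarith) _ _ k hw.le (hbT _ hT k)
    exact h1.differentiableAt (isOpen_ball.mem_nhds (by rw [mem_ball, dist_eq_norm]; linarith))
  · have hT : 0 < 2 * (‖z - η‖ + 1) := by positivity
    have h1 : Tendsto (fun n => ∑' k, (z - η) ^ k * a n k) (hyperfilter ℕ)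
        (𝓝 (∑' k, (z - η) ^ k * b k)) := by
      refine tendsto_tsum_of_dominated_convergence (hsummable (2 * (‖z - η‖ + 1)))
        (fun k => (hb k).const_mul _) ?_
      filter_upwards [hcoef _ hT] with n hn k
      exact hgeom (‖z - η‖ + 1) _ (by positivity) hT (by linarith) _ _ k (by linarith) (hn k)
    refine h1.congr' ?_
    filter_upwards [hle (hR.eventually_gt_atTop ‖z - η‖)] with n hn
    have hn : ‖z - η‖ < R n := hn
    rw [← Complex.taylorSeries_eq_on_ball (hf n) (z := z) (by rwa [mem_ball, dist_eq_norm])]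
    refine tsum_congr fun k => ?_
    rw [ha]
    simp only [smul_eq_mul]
    ring

variable {c : ℝ} {μ : Measure ℂ} {φ : ℂ → EReal}

theorem IsSubharmonic.bddAbove_toReal (hφ : IsSubharmonic φ) (hbot : ∀ z, φ z ≠ ⊥) (η : ℂ) (T : ℝ) :
    ∃ B : ℝ, ∀ z, ‖z - η‖ ≤ T → (φ z).toReal ≤ B := by
  rcases lt_or_ge T 0 with hT | hT
  · exact ⟨0, fun z hz => absurd (norm_nonneg (z - η)) (by linarith)⟩
  obtain ⟨x, -, hx⟩ := (hφ.upperSemicontinuous.upperSemicontinuousOn _).exists_isMaxOn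
    ⟨η, mem_closedBall_self hT⟩ (isCompact_closedBall η T)
  refine ⟨(φ x).toReal, fun z hz => EReal.toReal_le_toReal ?_ (hbot z) (hφ.ne_top x)⟩
  exact hx (by rwa [mem_closedBall, dist_eq_norm])

theorem IsSubharmonic.ne_bot (hφ : IsSubharmonic φ) (hφμ : IsLaplacian φ μ)
    (h : IsDoublingWith c μ) (z : ℂ) : φ z ≠ ⊥ := by
  obtain ⟨G, -, hG⟩ := hφ.exists_analytic hφμ h z one_pos
  exact (hG z (mem_ball_self one_pos)).1

/-- The potential of the rescaled measure in terms of logarithmic potentials. -/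
theorem IsDoublingWith.pot_map_affine (h : IsDoublingWith c μ) (η : ℂ) {r b : ℝ} (hr : 0 < r)
    (hb : 0 < b) (n : ℕ) (z : ℂ) :
    pot (ENNReal.ofReal b • μ.map fun w : ℂ => (w - η) / r) n ((z - η) / r) =
      b * (∫ w in ball η (r * 2 ^ n), Real.log ‖w - z‖ ∂μ -
        ∫ w in ball η (r * 2 ^ n), Real.log ‖w - η‖ ∂μ) := by
  have hr' : (r : ℂ) ≠ 0 := by exact_mod_cast hr.ne'
  have h2 : ∀ᵐ w ∂μ, w ≠ z := by rw [ae_iff]; simpa using h.measure_singleton z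
  have h3 : ∀ᵐ w ∂μ, w ≠ η := by rw [ae_iff]; simpa using h.measure_singleton η
  rw [pot, Measure.restrict_smul, integral_smul_measure, ENNReal.toReal_ofReal hb.le, smul_eq_mul,
    setIntegral_map measurableSet_ball
      (by fun_prop : Measurable fun w : ℂ => Real.log ‖1 - (z - η) / r / w‖).aestronglyMeasurable
      (measurable_affine η r).aemeasurable, preimage_affine_ball η hr, mul_zero, add_zero,
    ← integral_sub (h.integrableOn_log_norm_sub z η _) (h.integrableOn_log_norm_sub η η _)]
  congr 1
  refine integral_congr_ae ?_
  filter_upwards [ae_restrict_of_ae h2, ae_restrict_of_ae h3] with w hz hη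
  have hη' : w - η ≠ 0 := sub_ne_zero.2 hη
  have e : 1 - (z - η) / r / ((w - η) / r) = (w - z) / (w - η) := by field_simp; ring
  rw [e, norm_div, Real.log_div (norm_ne_zero_iff.2 (sub_ne_zero.2 hz)) (norm_ne_zero_iff.2 hη')]

/-- Peak functions with polynomial decay in the scale of `ρ`. -/
theorem IsSubharmonic.exists_peak (hφ : IsSubharmonic φ) (hφμ : IsLaplacian φ μ)
    (h : IsDoublingWith c μ) {ε : ℝ} (hε : 0 < ε) (M : ℕ) : ∃ C : ℝ, ∀ η : ℂ, ∃ P : ℂ → ℂ,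
      Differentiable ℂ P ∧ P η = 1 ∧ ∀ z, ‖P z‖ * (1 + ‖z - η‖ / rho μ η) ^ M ≤
        Real.exp (ε * ((φ z).toReal - (φ η).toReal) + C) := by
  set b : ℝ := ε / (2 * Real.pi) with hbdef
  have hb : 0 < b := by positivity
  obtain ⟨C, k₀, hcore⟩ := exists_entire_le_exp_pot h.one_le hb M
  refine ⟨C, fun η => ?_⟩
  obtain ⟨hr, hr1⟩ := h.rho_spec η
  set r := rho μ η with hrdef
  have hr' : (r : ℂ) ≠ 0 := by exact_mod_cast hr.ne'
  set κ : Measure ℂ := ENNReal.ofReal b • μ.map fun w : ℂ => (w - η) / r with hκ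
  have hκd : IsDoublingWith c κ := (h.map_affine η hr).smul hb
  have hκ1 : κ.real (ball 0 1) = b := by
    rw [hκ, measureReal_ennreal_smul_apply, ENNReal.toReal_ofReal hb.le, map_affine_real_ball μ η hr,
      mul_zero, add_zero, mul_one, hr1, mul_one]
  obtain ⟨k₁, hk₁⟩ := pow_unbounded_of_one_lt (2 / r) one_lt_two
  rw [div_lt_iff₀ hr] at hk₁
  set N : ℕ → ℕ := fun n => n + (k₀ + k₁) with hN
  set R : ℕ → ℝ := fun n => r * 2 ^ N n - 2 with hRdef
  have hR0 : ∀ n, 0 < R n := by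
    intro n
    have : (2 : ℝ) ^ k₁ ≤ 2 ^ N n := pow_le_pow_right₀ one_le_two (by rw [hN]; simp only; omega)
    have := mul_le_mul_of_nonneg_left this hr.le
    rw [hRdef]; simp only
    linarith
  have hR : Tendsto R atTop atTop := by
    refine tendsto_atTop_add_const_right _ _ (Tendsto.const_mul_atTop hr ?_)
    exact (tendsto_pow_atTop_atTop_of_one_lt one_lt_two).comp (tendsto_add_atTop_nat _)
  choose F hFd hF0 hF using fun n => hcore κ hκd hκ1 (N n) (by rw [hN]; simp only; omega)
  choose G hGd hG using fun n => hφ.exists_analytic hφμ h η (hR0 n)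
  set f : ℕ → ℂ → ℂ := fun n z => Complex.exp (ε * (G n z - G n η)) * F n ((z - η) / r) with hf
  have hfη : ∀ n, f n η = 1 := fun n => by rw [hf]; simp [hF0]
  have hfd : ∀ n, DifferentiableOn ℂ (f n) (ball η (R n)) := fun n =>
    (((hGd n).sub_const _).const_mul _).cexp.mul
      ((hFd n).comp ((differentiable_id.sub_const _).div_const _)).differentiableOn
  have hfb : ∀ n, ∀ z ∈ ball η (R n), ‖f n z‖ * (1 + ‖z - η‖ / r) ^ M ≤
      Real.exp (ε * ((φ z).toReal - (φ η).toReal) + C) := by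
    intro n z hz
    have hnorm : ‖(z - η) / r‖ = ‖z - η‖ / r := by
      rw [norm_div, Complex.norm_real, Real.norm_of_nonneg hr.le]
    have h1 := hF n ((z - η) / r) (by
      rw [hnorm, div_lt_iff₀ hr]
      rw [mem_ball, dist_eq_norm] at hz
      change ‖z - η‖ < r * 2 ^ N n - 2 at hz
      linarith)
    rw [hnorm, hκ, h.pot_map_affine η hr hb] at h1
    have h2 := (hG n z hz).2
    have h3 := (hG n η (mem_ball_self (hR0 n))).2
    rw [show R n + 2 = r * 2 ^ N n by rw [hRdef]; ring] at h2 h3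
    have h4 : ‖Complex.exp (ε * (G n z - G n η))‖ = Real.exp (ε * ((G n z).re - (G n η).re)) := by
      rw [Complex.norm_exp, Complex.re_ofReal_mul, Complex.sub_re]
    rw [hf]
    simp only [norm_mul, h4]
    calc _ = Real.exp (ε * ((G n z).re - (G n η).re)) *
          (‖F n ((z - η) / r)‖ * (1 + ‖z - η‖ / r) ^ M) := by ring
      _ ≤ _ := mul_le_mul_of_nonneg_left h1 (Real.exp_nonneg _)
      _ = _ := by
          rw [← Real.exp_add, h2, h3, hbdef]
          congr 1
          field_simp
          ring
  have hbot := hφ.ne_bot hφμ h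
  obtain ⟨P, hPd, hP⟩ := exists_entire_tendsto hR hfd (fun T => by
    obtain ⟨B, hB⟩ := hφ.bddAbove_toReal hbot η T
    refine ⟨Real.exp (ε * (B - (φ η).toReal) + C), fun n z hz hzT => ?_⟩
    have h1 : 1 ≤ (1 + ‖z - η‖ / r) ^ M := one_le_pow₀ (by
      have : 0 ≤ ‖z - η‖ / r := by positivity
      linarith)
    calc ‖f n z‖ ≤ ‖f n z‖ * (1 + ‖z - η‖ / r) ^ M := le_mul_of_one_le_right (norm_nonneg _) h1
      _ ≤ _ := hfb n z hz
      _ ≤ _ := by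
          gcongr
          exact hB z hzT)
  refine ⟨P, hPd, ?_, fun z => ?_⟩
  · refine tendsto_nhds_unique (hP η) ?_
    simp only [hfη]
    exact tendsto_const_nhds
  · refine le_of_tendsto ((hP z).norm.mul_const _) ?_
    have hle : (hyperfilter ℕ : Filter ℕ) ≤ atTop := by
      rw [← Nat.cofinite_eq_atTop]; exact hyperfilter_le_cofinite
    filter_upwards [hle (hR.eventually_gt_atTop ‖z - η‖)] with n hn
    exact hfb n z (by rw [mem_ball, dist_eq_norm]; exact hn)

end Limit

end PeakFunctions

theorem mainTheorem7 (φ : ℂ → EReal) (hφ : PeakFunctions.IsSubharmonic φ)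
    (μ : MeasureTheory.Measure ℂ) (hμφ : PeakFunctions.IsLaplacian φ μ)
    (hμ0 : μ ≠ 0) (hμ : PeakFunctions.IsDoubling μ) :
    (∀ z, φ z ≠ ⊥) ∧
    ∀ (ε : ℝ), 0 < ε → ∀ (ω : ℂ → ℝ), PeakFunctions.IsFlatWeight μ ω → ∀ m : ℕ,
      ∃ C : ℝ, 0 < C ∧ ∀ η : ℂ, ∃ P : ℂ → ℂ, Differentiable ℂ P ∧ P η = 1 ∧
        ∀ z : ℂ, ‖P z‖ ≤ C * Real.exp (ε * ((φ z).toReal - (φ η).toReal)) * (ω η / ω z) *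
          (1 / (1 + PeakFunctions.rhoDist μ z η ^ m)) := by
  obtain ⟨c, h⟩ := hμ.exists_isDoublingWith hμ0 hμφ.measure_lt_top
  refine ⟨hφ.ne_bot hμφ h, fun ε hε ω hω m => ?_⟩
  obtain ⟨A, hA, hωA⟩ := hω.abs_log_sub_log_le
  obtain ⟨C₁, hC₁, k, hd⟩ := h.exists_rhoDist_le
  obtain ⟨C, hpeak⟩ := hφ.exists_peak hμφ h hε (⌈A * k⌉₊ + k * m)
  have hC₁0 : 0 < C₁ := by linarith
  refine ⟨Real.exp C * (Real.exp (A * (1 + Real.log C₁)) * (2 * C₁ ^ m)), by positivity, fun η => ?_⟩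
  obtain ⟨P, hPd, hPη, hP⟩ := hpeak η
  refine ⟨P, hPd, hPη, fun z => ?_⟩
  have hP := hP z
  have hρ := (h.rho_spec η).1
  set X := 1 + ‖z - η‖ / PeakFunctions.rho μ η with hX
  have hX1 : 1 ≤ X := by
    have : 0 ≤ ‖z - η‖ / PeakFunctions.rho μ η := by positivity
    linarith
  have hX0 : 0 < X := by linarith
  have hXk : 1 ≤ X ^ k := one_le_pow₀ hX1
  set D := PeakFunctions.rhoDist μ z η with hD
  have hD0 : 0 ≤ D := PeakFunctions.rhoDist_nonneg μ z η
  have hDX : D ≤ C₁ * X ^ k := hd z η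
  -- the flat weight costs a power of `X`
  have h1 : Real.posLog D ≤ Real.log C₁ + k * Real.log X := by
    rw [← Real.log_pow, ← Real.log_mul hC₁0.ne' (by positivity), Real.posLog_apply]
    have h2 : 0 ≤ Real.log (C₁ * X ^ k) := Real.log_nonneg (one_le_mul_of_one_le_of_one_le hC₁ hXk)
    refine max_le h2 ?_
    rcases hD0.eq_or_lt with h0 | h0
    · rw [← h0, Real.log_zero]; exact h2
    · exact Real.log_le_log h0 hDX
  have h2 : ω z / ω η ≤ Real.exp (A * (1 + Real.log C₁)) * X ^ ⌈A * k⌉₊ := by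
    have hlogX : 0 ≤ Real.log X := Real.log_nonneg hX1
    calc ω z / ω η = Real.exp (Real.log (ω z) - Real.log (ω η)) := by
          rw [Real.exp_sub, Real.exp_log (hω.pos z), Real.exp_log (hω.pos η)]
      _ ≤ Real.exp (A * (1 + Real.log C₁) + ⌈A * k⌉₊ * Real.log X) := by
          rw [Real.exp_le_exp]
          refine (le_abs_self _).trans ((hωA z η).trans ?_)
          have h3 := mul_le_mul_of_nonneg_left h1 hA.le
          have h4 := mul_le_mul_of_nonneg_right (Nat.le_ceil (A * k)) hlogX
          linarith
      _ = _ := by rw [Real.exp_add, Real.exp_nat_mul, Real.exp_log hX0]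
  have h3 : 1 + D ^ m ≤ 2 * C₁ ^ m * X ^ (k * m) := by
    have h4 : 1 ≤ C₁ ^ m * X ^ (k * m) :=
      one_le_mul_of_one_le_of_one_le (one_le_pow₀ hC₁) (one_le_pow₀ hX1)
    have h5 : D ^ m ≤ C₁ ^ m * X ^ (k * m) := by
      rw [pow_mul, ← mul_pow]; gcongr
    linarith
  have hDm : 0 < 1 + D ^ m := by positivity
  have hωz := hω.pos z
  have hωη := hω.pos η
  have h4 : ‖P z‖ * ((ω z / ω η) * (1 + D ^ m)) ≤
      Real.exp C * (Real.exp (A * (1 + Real.log C₁)) * (2 * C₁ ^ m)) *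
        Real.exp (ε * ((φ z).toReal - (φ η).toReal)) := by
    calc _ ≤ ‖P z‖ * ((Real.exp (A * (1 + Real.log C₁)) * X ^ ⌈A * k⌉₊) *
          (2 * C₁ ^ m * X ^ (k * m))) := by gcongr
      _ = (‖P z‖ * X ^ (⌈A * k⌉₊ + k * m)) * (Real.exp (A * (1 + Real.log C₁)) * (2 * C₁ ^ m)) := by
          rw [pow_add]; ring
      _ ≤ Real.exp (ε * ((φ z).toReal - (φ η).toReal) + C) *
          (Real.exp (A * (1 + Real.log C₁)) * (2 * C₁ ^ m)) := by gcongr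
      _ = _ := by rw [Real.exp_add]; ring
  calc ‖P z‖ = ‖P z‖ * ((ω z / ω η) * (1 + D ^ m)) * ((ω η / ω z) * (1 / (1 + D ^ m))) := by
        field_simp
    _ ≤ _ := by
        rw [mul_assoc (_ * _) (ω η / ω z)]
        gcongr
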